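/- Let $k\ge 1$ be an integer and let $\gamma:[0,L]\to\Gamma\subset\mathbb R^2$ be an injective parametrization of class $C^{k+1}$ on $[0,L]$ with $\gamma'\neq 0$ everywhere. For $0\le a<b\le L$ consider the (curved) edge $e=\gamma([a,b])$, with endpoints $\bar\nu=\gamma(a)$, $\nu'=\gamma(b)$ and curvilinear length $h_e$. Sobolev norms and seminorms on $e$ are taken with respect to arc length: for a field $v:e\to\mathbb R^2$, written as a function on $(0,h_e)$ of the arc-length parameter, and real $r=n+\theta\ge 0$ with $n=\lfloor r\rfloor$, $|v|_{H^r(e)}$ is $\|v^{(n)}\|_{L^2(0,h_e)}$ if $\theta=0$ and $$\Big(\int_0^{h_e}\!\!\int_0^{h_e}\frac{|v^{(n)}(x)-v^{(n)}(y)|^2}{|x-y|^{1+2\theta}}\,dy\,dx\Big)^{1/2}$$ if $0<\theta<1$ ($v^{(n)}$ is the weak derivative), and $\|v\|_{H^r(e)}^2=\sum_{j\le n}|v|_{H^j(e)}^2$, plus $|v|_{H^r(e)}^2$ if $\theta\ne0$. Let $R_h(e)$ be the space of restrictions to $e$ of the maps $$F(x)=c+\begin{pmatrix}x_1-\bar\nu_1&-(x_2-\bar\nu_2)\\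 x_2-\bar\nu_2&x_1-\bar\nu_1\end{pmatrix}d,\qquad c,d\in\mathbb R^2,$$ let $B_h(e)=\{p\circ(\gamma|_{[a,b]})^{-1}: p\in(\mathcal P_k[a,b])^2,\ p(a)=p(b)=0\}$, and let $V_h(e)=R_h(e)\oplus B_h(e)$. Let $\delta>0$, and let $s,m$ be real numbers with $1\le s\le k+1$ and $0\le m\le s$. Then there is a constant $C>0$, depending only on $k$, $\gamma$, $\delta$, $s$, $m$, such that the following holds for every edge $e$ as above, every bounded set (mesh element) $E\subset\mathbb R^2$ with $e\subset\partial E$ and diameter $h_E$, all nodes $x_1,\dots,x_{k+1}\in e$ with $x_1=\bar\nu$, $x_{k+1}=\nu'$ and $|x_i-x_j|\ge\delta h_e$ for $i\ne j$, and every $u\in[H^s(e)]^2$. There is a unique $u_I\in V_h(e)$ that coincides with (the continuous representative of) $u$ at $x_1,\dots,x_{k+1}$, and $$|u-u_I|_{H^m(e)}\le C\,h_E^{\,s-m}\,\|u\|_{H^s(e)}.$$ -/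

import Mathlib

open MeasureTheory Set
open scoped ENNReal ContDiff

noncomputable section

namespace CurvedEdge

/-- The plane `ℝ²` with its Euclidean norm. -/
abbrev Plane : Type := EuclideanSpace ℝ (Fin 2)

/-! ### Sobolev seminorms and norms on an interval `(0, ℓ)` -/

/-- `g` is the weak derivative of order `n` of `f` on `(0, ℓ)` (order `0`: `g = f` almost
everywhere). -/
def IsWeakDeriv (ℓ : ℝ) (n : ℕ) (f g : ℝ → Plane) : Prop :=
  LocallyIntegrableOn f (Ioo 0 ℓ) volume ∧ LocallyIntegrableOn g (Ioo 0 ℓ) volume ∧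
    ∀ φ : ℝ → ℝ, ContDiff ℝ ∞ φ → HasCompactSupport φ → tsupport φ ⊆ Ioo 0 ℓ →
      ∫ x in Ioo 0 ℓ, iteratedDeriv n φ x • f x = (-1 : ℝ) ^ n • ∫ x in Ioo 0 ℓ, φ x • g x

/-- For `θ = 0` the `L²(0, ℓ)` norm of `g`; for `0 < θ < 1` its Gagliardo–Slobodeckij seminorm
`(∫∫ |g x - g y|² / |x - y| ^ (1 + 2 θ) dx dy) ^ (1/2)`. -/
def fracSeminorm (ℓ θ : ℝ) (g : ℝ → Plane) : ℝ≥0∞ :=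
  if θ = 0 then eLpNorm g 2 (volume.restrict (Ioo 0 ℓ))
  else (∫⁻ x in Ioo 0 ℓ, ∫⁻ y in Ioo 0 ℓ,
    ENNReal.ofReal (‖g x - g y‖ ^ 2 / |x - y| ^ (1 + 2 * θ))) ^ (1 / 2 : ℝ)

/-- The seminorm `|f|_{H^s(0, ℓ)}`, `0 ≤ s` real: with `n = ⌊s⌋` and `θ = s - n`, the
`L²` norm (`θ = 0`) or the Gagliardo–Slobodeckij seminorm of exponent `θ` (`θ ≠ 0`) of the weak
derivative of order `n` of `f`. It is `∞` if that weak derivative does not exist; otherwise the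
weak derivative is unique up to null sets and the infimum is over one value. -/
def seminorm (ℓ s : ℝ) (f : ℝ → Plane) : ℝ≥0∞ :=
  ⨅ (g : ℝ → Plane) (_ : IsWeakDeriv ℓ ⌊s⌋₊ f g), fracSeminorm ℓ (s - ⌊s⌋₊) g

/-- The norm of `H^s(0, ℓ)`, `0 ≤ s` real:
`‖f‖² = ∑_{j ≤ ⌊s⌋} |f|²_{H^j}`, plus `|f|²_{H^s}` when `s` is not an integer. -/
def norm (ℓ s : ℝ) (f : ℝ → Plane) : ℝ≥0∞ :=
  (∑ j ∈ Finset.range (⌊s⌋₊ + 1), seminorm ℓ (j : ℝ) f ^ 2 +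
    if s = (⌊s⌋₊ : ℝ) then 0 else seminorm ℓ s f ^ 2) ^ (1 / 2 : ℝ)

/-! ### The curve, its edges and Sobolev spaces with respect to arc length -/

/-- `γ : [0, L] → Γ` is an invertible regular parametrization of class `C^n`. -/
structure IsRegularParam (n : ℕ) (L : ℝ) (γ : ℝ → Plane) : Prop where
  contDiffOn : ContDiffOn ℝ n γ (Icc 0 L)
  injOn : InjOn γ (Icc 0 L)
  deriv_ne_zero : ∀ t ∈ Icc 0 L, derivWithin γ (Icc 0 L) t ≠ 0

/-- The edge `e = γ([a, b])`. -/
def edge (γ : ℝ → Plane) (a b : ℝ) : Set Plane := γ '' Icc a b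

/-- The point `γ t` of the edge, for `t ∈ [a, b]`. -/
def edgePt (γ : ℝ → Plane) (a b : ℝ) (t : Icc a b) : edge γ a b :=
  ⟨γ t, mem_image_of_mem γ t.2⟩

/-- The arc length of the edge between the parameters `a` and `t`. -/
def arcLength (γ : ℝ → Plane) (a b t : ℝ) : ℝ :=
  ∫ τ in a..t, ‖derivWithin γ (Icc a b) τ‖

/-- The curvilinear length `h_e` of the edge. -/
def edgeLength (γ : ℝ → Plane) (a b : ℝ) : ℝ := arcLength γ a b b

/-- The arc-length parametrization `ρ : [0, h_e] → e`. -/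
def arcParam (γ : ℝ → Plane) (a b : ℝ) (σ : ℝ) : Plane :=
  γ (Function.invFunOn (arcLength γ a b) (Icc a b) σ)

/-- A vector field on the edge, written in the arc-length parameter (only the values on
`[0, h_e]` matter). -/
def inArcLength (γ : ℝ → Plane) (a b : ℝ) (u : edge γ a b → Plane) : ℝ → Plane :=
  fun σ => Function.extend (Subtype.val : edge γ a b → Plane) u 0 (arcParam γ a b σ)

/-- The seminorm `|u|_{H^s(e)}`. -/
def edgeSeminorm (γ : ℝ → Plane) (a b s : ℝ) (u : edge γ a b → Plane) : ℝ≥0∞ :=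
  seminorm (edgeLength γ a b) s (inArcLength γ a b u)

/-- The norm `‖u‖_{H^s(e)}`. -/
def edgeNorm (γ : ℝ → Plane) (a b s : ℝ) (u : edge γ a b → Plane) : ℝ≥0∞ :=
  norm (edgeLength γ a b) s (inArcLength γ a b u)

/-- `u ∈ [H^s(e)]²`. -/
def MemHs (γ : ℝ → Plane) (a b s : ℝ) (u : edge γ a b → Plane) : Prop :=
  edgeNorm γ a b s u < ⊤

/-! ### The discrete edge space -/

/-- The matrix field `𝔸(x)` with base point `ν`. -/
def matA (ν x : Plane) : Matrix (Fin 2) (Fin 2) ℝ :=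
  !![x 0 - ν 0, -(x 1 - ν 1); x 1 - ν 1, x 0 - ν 0]

/-- The map `F(x) = c + 𝔸(x) d` (translation, homothety and linearized rotation). -/
def mapF (ν c d x : Plane) : Plane := c + WithLp.toLp 2 ((matA ν x).mulVec d.ofLp)

/-- `R_h(e)`: the restrictions to `e` of the maps `F`, with base point `γ a`. -/
def RSpace (γ : ℝ → Plane) (a b : ℝ) : Submodule ℝ (edge γ a b → Plane) where
  carrier := {v | ∃ c d : Plane, ∀ x : edge γ a b, v x = mapF (γ a) c d x}
  zero_mem' := ⟨0, 0, fun x => by simp [mapF]⟩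
  add_mem' := by
    rintro v w ⟨c, d, h⟩ ⟨c', d', h'⟩
    refine ⟨c + c', d + d', fun x => ?_⟩
    simp only [Pi.add_apply, h, h', mapF, WithLp.ofLp_add, Matrix.mulVec_add, WithLp.toLp_add]
    abel
  smul_mem' := by
    rintro r v ⟨c, d, h⟩
    refine ⟨r • c, r • d, fun x => ?_⟩
    simp only [Pi.smul_apply, h, mapF, WithLp.ofLp_smul, Matrix.mulVec_smul, WithLp.toLp_smul,
      smul_add]

/-- `B_h(e)`: the fields `p ∘ γ_e⁻¹` with `p ∈ (𝒫_k[a, b])²`, `p(a) = p(b) = 0`. -/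
def BSpace (γ : ℝ → Plane) (a b : ℝ) (k : ℕ) : Submodule ℝ (edge γ a b → Plane) where
  carrier := {v | ∃ p : Fin 2 → Polynomial ℝ,
    (∀ i, p i ∈ Polynomial.degreeLE ℝ k ∧ (p i).eval a = 0 ∧ (p i).eval b = 0) ∧
      ∀ (t : Icc a b) (i : Fin 2), v (edgePt γ a b t) i = (p i).eval (t : ℝ)}
  zero_mem' := ⟨0, fun i => by simp, fun t i => by simp⟩
  add_mem' := by
    rintro v w ⟨p, hp, h⟩ ⟨q, hq, h'⟩
    refine ⟨p + q, fun i => ⟨Submodule.add_mem _ (hp i).1 (hq i).1, ?_, ?_⟩, fun t i => ?_⟩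
    · simp [(hp i).2.1, (hq i).2.1]
    · simp [(hp i).2.2, (hq i).2.2]
    · simp [h, h']
  smul_mem' := by
    rintro r v ⟨p, hp, h⟩
    refine ⟨r • p, fun i => ⟨Submodule.smul_mem _ r (hp i).1, ?_, ?_⟩, fun t i => ?_⟩
    · simp [(hp i).2.1]
    · simp [(hp i).2.2]
    · simp [h]

/-- The edge space `V_h(e) = R_h(e) ⊕ B_h(e)`. -/
def VSpace (γ : ℝ → Plane) (a b : ℝ) (k : ℕ) : Submodule ℝ (edge γ a b → Plane) :=
  RSpace γ a b ⊔ BSpace γ a b k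

/-- The sum defining `V_h(e)` is direct. -/
theorem disjoint_RSpace_BSpace (γ : ℝ → Plane) (a b : ℝ) (k : ℕ) (hab : a ≤ b)
    (hne : γ a ≠ γ b) : Disjoint (RSpace γ a b) (BSpace γ a b k) := by
  rw [Submodule.disjoint_def]
  rintro v ⟨c, d, hF⟩ ⟨p, hp, hB⟩
  have ha : v (edgePt γ a b ⟨a, left_mem_Icc.2 hab⟩) = 0 := by
    ext i; rw [hB]; exact (hp i).2.1
  have hb : v (edgePt γ a b ⟨b, right_mem_Icc.2 hab⟩) = 0 := by
    ext i; rw [hB]; exact (hp i).2.2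
  have hc : c = 0 := by
    rw [hF] at ha
    ext i
    have := congrArg (fun z : Plane => z i) ha
    fin_cases i <;> simpa [mapF, matA, edgePt] using this
  subst hc
  rw [hF] at hb
  have h0 := congrArg (fun z : Plane => z 0) hb
  have h1 := congrArg (fun z : Plane => z 1) hb
  simp [mapF, matA, edgePt, dotProduct, Fin.sum_univ_two] at h0 h1
  set X := γ b 0 - γ a 0 with hX
  set Y := γ b 1 - γ a 1 with hY
  have hXY : X ^ 2 + Y ^ 2 ≠ 0 := by
    intro h
    apply hne
    have hx : X = 0 := by nlinarith [sq_nonneg X, sq_nonneg Y]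
    have hy : Y = 0 := by nlinarith [sq_nonneg X, sq_nonneg Y]
    ext i
    fin_cases i
    · simp; linarith
    · simp; linarith
  have hd0 : d 0 = 0 := by
    have : (X ^ 2 + Y ^ 2) * d 0 = 0 := by linear_combination X * h0 + Y * h1
    exact (mul_eq_zero.1 this).resolve_left hXY
  have hd1 : d 1 = 0 := by
    have : (X ^ 2 + Y ^ 2) * d 1 = 0 := by linear_combination X * h1 - Y * h0
    exact (mul_eq_zero.1 this).resolve_left hXY
  have hd : d = 0 := by
    ext i; fin_cases i
    · simpa using hd0
    · simpa using hd1
  subst hd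
  funext x
  simp [hF, mapF]

/-- `x 0, …, x k` are admissible nodes on the edge: `x 0` and `x k` are the two endpoints, and
distinct nodes are at distance at least `δ h_e`. -/
structure IsNodes {k : ℕ} (γ : ℝ → Plane) (a b δ : ℝ) (x : Fin (k + 1) → edge γ a b) :
    Prop where
  left : (x 0 : Plane) = γ a
  right : (x (Fin.last k) : Plane) = γ b
  separated : ∀ i j, i ≠ j → δ * edgeLength γ a b ≤ dist (x i) (x j)

/-- `v` is the interpolant of `u` in `V_h(e)` at the nodes `x`: it belongs to `V_h(e)` and takes
at the nodes the values of the continuous representative of `u`. -/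
def IsInterpolant {k : ℕ} (γ : ℝ → Plane) (a b : ℝ) (x : Fin (k + 1) → edge γ a b)
    (u v : edge γ a b → Plane) : Prop :=
  v ∈ VSpace γ a b k ∧ ∃ w : edge γ a b → Plane, Continuous w ∧
    inArcLength γ a b w =ᵐ[volume.restrict (Ioo 0 (edgeLength γ a b))] inArcLength γ a b u ∧
    ∀ i, v (x i) = w (x i)

end CurvedEdge

end

/-! Unisolvence. With ℝ² read as ℂ, the space R_h(e) consists of the maps c + d(x - ν̄). Bubbles
vanish at both endpoints, so the endpoint values fix c, and then d because γ(a) ≠ γ(b). The rest of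
the nodal data vanishes at the endpoints and is matched by a unique polynomial of degree at most k,
which is therefore a bubble. All constants come from compactness: the speed is bounded above and
below, and injectivity gives the chord-arc inequality (`IsRegularParam.exists_chord_le`). Parameter,
arc length and chord are thus comparable, uniformly over all edges.

Estimate. Let h be the length of e, N = ‖u‖_{H^s(e)}, s = n + θ. In arc length,
`exists_decomposition` splits u into T + r. Here T is a polynomial of degree at most n with all
derivatives O(N h^{-1/2}), and r satisfies |r| ≤ N h^{s-1/2} and |r|_{H^m} = O(N h^{s-m}). The nodal
values of T and of r are interpolated separately.

For r, stability is enough: nodal data of size B have an interpolant whose j-th derivative in the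
parameter is O(B (b-a)^{-j}) (`exists_interpJet_le_of_le`). For T, the error vanishes at k+1 nodes,
so by Rolle all its derivatives are controlled by the one of order k+1. At that order the bubble
disappears, while d is only a difference quotient of T along the chord, hence bounded like T'
(`exists_interpJet_sub_le_of_smooth`). Rolle thus does the work usually done by reproduction of
polynomials.

Together, the j-th derivative of T - u_I is O(N h^{s-1/2-j}); this is where s ≤ k+1 enters.
Integration over an interval of length h turns this into h^{s-m}, and fractional m are reached
through the embedding of H¹ (`fracSeminorm_le_eLpNorm_deriv`). Finally h is at most a constant times
the chord, and the chord is at most h_E. -/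

noncomputable section

namespace CurvedEdge

/-! ### Derivative sequences: composition, zeros and products of linear factors -/

section Jets

variable {E : Type*} [NormedAddCommGroup E] [NormedSpace ℝ E]

/-- `F 0, …, F N` are the successive derivatives on `s` of the `C^N` function `F 0`. -/
structure IsJet (N : ℕ) (s : Set ℝ) (F : ℕ → ℝ → E) : Prop where
  hasDeriv : ∀ j < N, ∀ x ∈ s, HasDerivWithinAt (F j) (F (j + 1) x) s x
  cont : ContinuousOn (F N) s

namespace IsJet

variable {N : ℕ} {s t : Set ℝ} {F G : ℕ → ℝ → E}

theorem continuousOn (h : IsJet N s F) {j : ℕ} (hj : j ≤ N) : ContinuousOn (F j) s := by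
  rcases hj.lt_or_eq with hj | rfl
  · exact fun x hx => (h.hasDeriv j hj x hx).continuousWithinAt
  · exact h.cont

theorem mono (h : IsJet N s F) (hts : t ⊆ s) : IsJet N t F :=
  ⟨fun j hj x hx => (h.hasDeriv j hj x (hts hx)).mono hts, h.cont.mono hts⟩

theorem sub (h : IsJet N s F) (h' : IsJet N s G) : IsJet N s (fun j x => F j x - G j x) :=
  ⟨fun j hj x hx => (h.hasDeriv j hj x hx).sub (h'.hasDeriv j hj x hx), h.cont.sub h'.cont⟩

theorem add (h : IsJet N s F) (h' : IsJet N s G) : IsJet N s (fun j x => F j x + G j x) :=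
  ⟨fun j hj x hx => (h.hasDeriv j hj x hx).add (h'.hasDeriv j hj x hx), h.cont.add h'.cont⟩

theorem clm {E' : Type*} [NormedAddCommGroup E'] [NormedSpace ℝ E'] (h : IsJet N s F)
    (A : E →L[ℝ] E') : IsJet N s (fun j x => A (F j x)) :=
  ⟨fun j hj x hx => A.hasFDerivAt.comp_hasDerivWithinAt x (h.hasDeriv j hj x hx),
    A.continuous.comp_continuousOn h.cont⟩

theorem succ (h : IsJet (N + 1) s F) : IsJet N s (fun j => F (j + 1)) :=
  ⟨fun j hj x hx => h.hasDeriv (j + 1) (by omega) x hx, h.cont⟩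

/-- Subtracting a constant only changes the jet at order `0`. -/
theorem sub_const (h : IsJet N s F) (c : E) :
    IsJet N s (fun j x => F j x - if j = 0 then c else 0) := by
  refine h.sub ⟨fun j _ x _ => ?_, continuousOn_const⟩
  simpa using hasDerivWithinAt_const x s (if j = 0 then c else 0)

/-- Translation of the variable. -/
theorem comp_const_add (h : IsJet N s F) (c : ℝ) (hst : MapsTo (fun x => c + x) t s) :
    IsJet N t (fun j x => F j (c + x)) := by
  refine ⟨fun j hj x hx => ?_, h.cont.comp (by fun_prop) hst⟩
  have h1 : HasDerivWithinAt (fun x : ℝ => c + x) 1 t x := (hasDerivWithinAt_id x t).const_add c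
  simpa [Function.comp_def] using (h.hasDeriv j hj _ (hst hx)).scomp x h1 hst

theorem iteratedDerivWithin_eq (h : IsJet N s F) (hs : UniqueDiffOn ℝ s) {j : ℕ} (hj : j ≤ N)
    {x : ℝ} (hx : x ∈ s) : iteratedDerivWithin j (F 0) s x = F j x := by
  induction j generalizing x with
  | zero => simp
  | succ j ih =>
    rw [iteratedDerivWithin_succ, derivWithin_congr (fun y hy => ih (by omega) hy)
      (ih (by omega) hx)]
    exact (h.hasDeriv j (by omega) x hx).derivWithin (hs x hx)

theorem contDiffOn (h : IsJet N s F) (hs : UniqueDiffOn ℝ s) : ContDiffOn ℝ N (F 0) s := by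
  induction N generalizing F with
  | zero => simpa using contDiffOn_zero (𝕜 := ℝ) |>.2 h.cont
  | succ N ih =>
    push_cast
    rw [contDiffOn_succ_iff_derivWithin hs]
    refine ⟨fun x hx => (h.hasDeriv 0 (by omega) x hx).differentiableWithinAt, by simp, ?_⟩
    exact (ih h.succ).congr fun x hx =>
      (h.hasDeriv 0 (by omega) x hx).derivWithin (hs x hx)

end IsJet

theorem _root_.ContDiffOn.isJet {N : ℕ} {s : Set ℝ} {f : ℝ → E} (h : ContDiffOn ℝ N f s)
    (hs : UniqueDiffOn ℝ s) : IsJet N s (fun j => iteratedDerivWithin j f s) := by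
  refine ⟨fun j hj x hx => ?_, h.continuousOn_iteratedDerivWithin le_rfl hs⟩
  have := (h.differentiableOn_iteratedDerivWithin (Nat.cast_lt.2 hj) hs x hx).hasDerivWithinAt
  rwa [← iteratedDerivWithin_succ] at this

/-- Composition of jets, with the bound on the derivatives. -/
theorem IsJet.exists_comp {N : ℕ} {s t : Set ℝ} {F : ℕ → ℝ → E} {g : ℕ → ℝ → ℝ}
    (hF : IsJet N t F) (hg : IsJet N s g) (hs : UniqueDiffOn ℝ s) (ht : UniqueDiffOn ℝ t)
    (hst : MapsTo (g 0) s t) :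
    ∃ H : ℕ → ℝ → E, IsJet N s H ∧ (∀ x, H 0 x = F 0 (g 0 x)) ∧
      ∀ D : ℝ, 1 ≤ D → (∀ i ≤ N, 1 ≤ i → ∀ x ∈ s, |g i x| ≤ D) → ∀ j ≤ N, ∀ C : ℝ,
        (∀ i ≤ j, ∀ x ∈ t, ‖F i x‖ ≤ C) → ∀ x ∈ s, ‖H j x‖ ≤ j.factorial * C * D ^ j := by
  have hF' := hF.contDiffOn ht
  have hg' := hg.contDiffOn hs
  refine ⟨fun j => iteratedDerivWithin j (F 0 ∘ g 0) s, (hF'.comp hg' hst).isJet hs,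
    fun x => by simp, fun D hD hgD j hj C hC x hx => ?_⟩
  rw [← norm_iteratedFDerivWithin_eq_norm_iteratedDerivWithin]
  refine norm_iteratedFDerivWithin_comp_le hF' hg' (by exact_mod_cast hj) ht hs hst hx ?_ ?_
  · intro i hi
    rw [norm_iteratedFDerivWithin_eq_norm_iteratedDerivWithin,
      hF.iteratedDerivWithin_eq ht (hi.trans hj) (hst hx)]
    exact hC i hi _ (hst hx)
  · intro i h1 hi
    rw [norm_iteratedFDerivWithin_eq_norm_iteratedDerivWithin,
      hg.iteratedDerivWithin_eq hs (hi.trans hj) hx]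
    -- The composition bound asks for `D ^ i` at order `i`; since `1 ≤ D`, the uniform bound `D` is
    -- enough.
    exact (hgD i (hi.trans hj) h1 x hx).trans (le_self_pow₀ hD (by omega))

/-- A `C^N` function on `[a, b]` with `N` zeros is controlled by its `N`-th derivative. -/
theorem IsJet.abs_le_of_zeros {a b : ℝ} {N : ℕ} {F : ℕ → ℝ → ℝ}
    (hF : IsJet N (Icc a b) F) {z : Fin N → ℝ} (hz : StrictMono z) (hza : ∀ i, z i ∈ Icc a b)
    (h0 : ∀ i, F 0 (z i) = 0) {B : ℝ} (hB : ∀ x ∈ Icc a b, |F N x| ≤ B) :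
    ∀ j ≤ N, ∀ x ∈ Icc a b, |F j x| ≤ B * (b - a) ^ (N - j) := by
  induction N generalizing F with
  | zero =>
    intro j hj x hx
    obtain rfl : j = 0 := by omega
    simpa using hB x hx
  | succ N ih =>
    -- Rolle: the `N + 1` zeros of `F 0` interlace with `N` zeros of `F 1`, to which the induction
    -- hypothesis applies. Order `0` then follows from the mean value inequality started at the zero
    -- `z 0`.
    have hR : ∀ i : Fin N, ∃ y ∈ Ioo (z i.castSucc) (z i.succ), F 1 y = 0 := by
      intro i
      have hlt := hz (Fin.castSucc_lt_succ (i := i))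
      have hsub : Icc (z i.castSucc) (z i.succ) ⊆ Icc a b :=
        Icc_subset_Icc (hza _).1 (hza _).2
      refine exists_hasDerivAt_eq_zero (f := F 0) hlt
        ((hF.continuousOn (Nat.zero_le _)).mono hsub) (by rw [h0, h0]) fun x hx => ?_
      refine (hF.hasDeriv 0 (by omega) x (hsub (Ioo_subset_Icc_self hx))).hasDerivAt ?_
      exact Filter.mem_of_superset (Icc_mem_nhds hx.1 hx.2) hsub
    choose y hy hy0 using hR
    have hymono : StrictMono y := by
      intro i j hij
      have h1 : i.succ ≤ j.castSucc := by
        rw [Fin.le_def]; simp only [Fin.val_succ, Fin.val_castSucc]; omega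
      exact (hy i).2.trans_le ((hz.monotone h1).trans (hy j).1.le)
    have key := ih hF.succ hymono
      (fun i => ⟨(hza _).1.trans (hy i).1.le, (hy i).2.le.trans (hza _).2⟩) hy0 hB
    intro j hj x hx
    rcases j with _ | j
    · have hb : ∀ y ∈ Icc a b, ‖F 1 y‖ ≤ B * (b - a) ^ N := fun y hy =>
        by simpa using key 0 (Nat.zero_le _) y hy
      have hba : (0 : ℝ) ≤ b - a := by have := hx.1.trans hx.2; linarith
      have hB0 : 0 ≤ B := (abs_nonneg _).trans (hB x hx)
      have := (convex_Icc a b).norm_image_sub_le_of_norm_hasDerivWithin_le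
        (fun y hy => hF.hasDeriv 0 (by omega) y hy) hb (hza 0) hx
      rw [h0, sub_zero, Real.norm_eq_abs, Real.norm_eq_abs] at this
      refine this.trans ?_
      rw [Nat.sub_zero, pow_succ, ← mul_assoc]
      have : |x - z 0| ≤ b - a := by
        rw [abs_le]; constructor <;> linarith [hx.1, hx.2, (hza 0).1, (hza 0).2]
      gcongr
    · simpa using key j (by omega) x hx

/-- The derivatives of a product of linear factors whose roots lie in the interval. -/
theorem abs_iterate_derivative_prod_le {ι : Type*} {a b : ℝ} (I : Finset ι) (z : ι → ℝ)
    (hz : ∀ i ∈ I, z i ∈ Icc a b) (j : ℕ) {x : ℝ} (hx : x ∈ Icc a b) :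
    |((Polynomial.derivative^[j] (∏ i ∈ I, (Polynomial.X - Polynomial.C (z i)))).eval x)|
      * (b - a) ^ j ≤ (1 + j : ℝ) ^ I.card * (b - a) ^ I.card := by
  classical
  have hba : (0 : ℝ) ≤ b - a := by have := hx.1.trans hx.2; linarith
  induction I using Finset.induction_on generalizing j with
  | empty =>
    rcases j with _ | j
    · simp
    · simp [Function.iterate_succ_apply]
  | insert i I hi ih =>
    rw [Finset.prod_insert hi, Finset.card_insert_of_notMem hi]
    set q := ∏ i ∈ I, (Polynomial.X - Polynomial.C (z i))
    have ih' := ih (fun i hi => hz i (Finset.mem_insert_of_mem hi))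
    have hzi := hz i (Finset.mem_insert_self i I)
    have hxz : |x - z i| ≤ b - a := by
      rw [abs_le]; constructor <;> linarith [hx.1, hx.2, hzi.1, hzi.2]
    rcases j with _ | j
    · have := ih' 0
      simp only [Function.iterate_zero, id_eq, pow_zero, mul_one, Nat.cast_zero, add_zero, one_pow,
        one_mul, Polynomial.eval_mul, Polynomial.eval_sub, Polynomial.eval_X,
        Polynomial.eval_C, abs_mul] at this ⊢
      rw [pow_succ']
      gcongr
    -- Leibniz with a linear factor has only two terms, with coefficients `1` and `j + 1`. Each new
    -- root therefore costs the factor `1 + (j + 1)` and one length `b - a`.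
    · have hder : Polynomial.derivative^[j + 1] ((Polynomial.X - Polynomial.C (z i)) * q) =
          (Polynomial.X - Polynomial.C (z i)) * Polynomial.derivative^[j + 1] q +
            (j + 1 : ℕ) • Polynomial.derivative^[j] q := by
        have hX : ∀ n : ℕ, Polynomial.derivative^[n + 1] (Polynomial.X * q) =
            Polynomial.X * Polynomial.derivative^[n + 1] q +
              (n + 1 : ℕ) • Polynomial.derivative^[n] q := by
          intro n
          induction n with
          | zero => simp [add_comm]
          | succ n ihn =>
            rw [Function.iterate_succ_apply', ihn]
            simp only [Polynomial.derivative_add, Polynomial.derivative_mul,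
              Polynomial.derivative_X, one_mul, map_nsmul, Function.iterate_succ_apply']
            simp only [nsmul_eq_mul]
            push_cast
            ring
        rw [sub_mul, Polynomial.iterate_derivative_sub, hX,
          Polynomial.iterate_derivative_C_mul, sub_mul]
        ring
      rw [hder]
      simp only [Polynomial.eval_add, Polynomial.eval_mul, Polynomial.eval_sub, Polynomial.eval_X,
        Polynomial.eval_C, nsmul_eq_mul, Polynomial.eval_natCast]
      set u := |(Polynomial.derivative^[j + 1] q).eval x| with hu
      set v := |(Polynomial.derivative^[j] q).eval x| with hv
      have h1 := ih' (j + 1)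
      have h2 := ih' j
      rw [← hu] at h1
      rw [← hv] at h2
      have h3 : |(x - z i) * (Polynomial.derivative^[j + 1] q).eval x +
          ((j + 1 : ℕ) : ℝ) * (Polynomial.derivative^[j] q).eval x| ≤
          (b - a) * u + (j + 1) * v := by
        refine (abs_add_le _ _).trans ?_
        rw [abs_mul, abs_mul, Nat.abs_cast, ← hu, ← hv]
        push_cast
        have hu0 : 0 ≤ u := abs_nonneg _
        gcongr
      have h4 : (1 + j : ℝ) ^ I.card ≤ (1 + (j + 1 : ℕ) : ℝ) ^ I.card := by
        push_cast
        gcongr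
        linarith
      calc _ ≤ ((b - a) * u + (j + 1) * v) * (b - a) ^ (j + 1) := by gcongr
        _ = (b - a) * (u * (b - a) ^ (j + 1)) + (j + 1) * (b - a) * (v * (b - a) ^ j) := by ring
        _ ≤ (b - a) * ((1 + (j + 1 : ℕ) : ℝ) ^ I.card * (b - a) ^ I.card) +
            (j + 1) * (b - a) * ((1 + (j + 1 : ℕ) : ℝ) ^ I.card * (b - a) ^ I.card) := by
          have h5 := h2.trans (mul_le_mul_of_nonneg_right h4 (pow_nonneg hba I.card))
          exact add_le_add (mul_le_mul_of_nonneg_left h1 hba)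
            (mul_le_mul_of_nonneg_left h5 (by positivity))
        _ = _ := by push_cast; ring

end Jets

/-! ### Weak derivatives on an interval and primitives -/

section WeakDerivatives

/-- Smooth functions with compact support in `(0, ℓ)`. -/
structure IsTest (ℓ : ℝ) (φ : ℝ → ℝ) : Prop where
  smooth : ContDiff ℝ ∞ φ
  compact : HasCompactSupport φ
  supp : tsupport φ ⊆ Ioo 0 ℓ

theorem IsTest.deriv {ℓ : ℝ} {φ : ℝ → ℝ} (h : IsTest ℓ φ) : IsTest ℓ (deriv φ) := by
  refine ⟨(contDiff_infty_iff_deriv.1 h.smooth).2, h.compact.deriv, ?_⟩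
  exact (closure_minimal support_deriv_subset (isClosed_tsupport φ)).trans h.supp

theorem IsTest.eq_zero {ℓ : ℝ} {φ : ℝ → ℝ} (h : IsTest ℓ φ) {x : ℝ} (hx : x ∉ Ioo 0 ℓ) : φ x = 0 :=
  image_eq_zero_of_notMem_tsupport fun h' => hx (h.supp h')

theorem IsTest.integrable_smul {ℓ : ℝ} {φ : ℝ → ℝ} (h : IsTest ℓ φ) {f : ℝ → Plane}
    (hf : LocallyIntegrableOn f (Ioo 0 ℓ) volume) :
    Integrable (fun x => φ x • f x) (volume.restrict (Ioo 0 ℓ)) := by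
  have hK : IntegrableOn f (tsupport φ) volume :=
    hf.integrableOn_compact_subset h.supp h.compact
  have h1 : IntegrableOn (fun x => φ x • f x) (tsupport φ) volume :=
    hK.continuousOn_smul h.smooth.continuous.continuousOn h.compact
  have h2 : Integrable (fun x => φ x • f x) volume := by
    refine (integrableOn_iff_integrable_of_support_subset fun x hx => ?_).1 h1
    by_contra hx'
    exact hx (by simp [image_eq_zero_of_notMem_tsupport hx'])
  exact h2.integrableOn

variable {ℓ : ℝ} {n : ℕ} {f g f' g' : ℝ → Plane}

theorem IsWeakDeriv.integral_eq (h : IsWeakDeriv ℓ n f g) {φ : ℝ → ℝ} (hφ : IsTest ℓ φ) :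
    ∫ x in Ioo 0 ℓ, iteratedDeriv n φ x • f x = (-1 : ℝ) ^ n • ∫ x in Ioo 0 ℓ, φ x • g x :=
  h.2.2 φ hφ.smooth hφ.compact hφ.supp

theorem IsTest.iteratedDeriv {φ : ℝ → ℝ} (h : IsTest ℓ φ) (n : ℕ) :
    IsTest ℓ (iteratedDeriv n φ) := by
  induction n with
  | zero => simpa using h
  | succ n ih => rw [iteratedDeriv_succ]; exact ih.deriv

theorem isWeakDeriv_iff : IsWeakDeriv ℓ n f g ↔
    LocallyIntegrableOn f (Ioo 0 ℓ) volume ∧ LocallyIntegrableOn g (Ioo 0 ℓ) volume ∧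
    ∀ φ : ℝ → ℝ, IsTest ℓ φ →
      ∫ x in Ioo 0 ℓ, iteratedDeriv n φ x • f x = (-1 : ℝ) ^ n • ∫ x in Ioo 0 ℓ, φ x • g x :=
  ⟨fun h => ⟨h.1, h.2.1, fun _ hφ => h.integral_eq hφ⟩,
    fun h => ⟨h.1, h.2.1, fun φ h1 h2 h3 => h.2.2 φ ⟨h1, h2, h3⟩⟩⟩

theorem ae_eq_zero_of_test (hf : LocallyIntegrableOn f (Ioo 0 ℓ) volume)
    (h : ∀ φ : ℝ → ℝ, IsTest ℓ φ → ∫ x in Ioo 0 ℓ, φ x • f x = 0) :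
    f =ᵐ[volume.restrict (Ioo 0 ℓ)] 0 := by
  have := isOpen_Ioo.ae_eq_zero_of_integral_contDiff_smul_eq_zero hf fun φ h1 h2 h3 => by
    rw [← h φ ⟨h1, h2, h3⟩, setIntegral_eq_integral_of_forall_compl_eq_zero]
    intro x hx
    rw [IsTest.eq_zero ⟨h1, h2, h3⟩ hx, zero_smul]
  exact (ae_restrict_iff' measurableSet_Ioo).2 this

theorem _root_.MeasureTheory.LocallyIntegrableOn.congr_ae_restrict {s : Set ℝ}
    (hf : LocallyIntegrableOn f s volume) (h : f =ᵐ[volume.restrict s] g) :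
    LocallyIntegrableOn g s volume := by
  intro x hx
  obtain ⟨t, ht, hft⟩ := hf x hx
  refine ⟨t ∩ s, Filter.inter_mem ht self_mem_nhdsWithin, ?_⟩
  refine (hft.mono_set inter_subset_left).congr ?_
  exact ae_restrict_of_ae_restrict_of_subset inter_subset_right h

theorem IsWeakDeriv.congr (h : IsWeakDeriv ℓ n f g) (hf : f =ᵐ[volume.restrict (Ioo 0 ℓ)] f')
    (hg : g =ᵐ[volume.restrict (Ioo 0 ℓ)] g') : IsWeakDeriv ℓ n f' g' := by
  refine isWeakDeriv_iff.2 ⟨h.1.congr_ae_restrict hf, h.2.1.congr_ae_restrict hg, fun φ hφ => ?_⟩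
  have h1 : ∫ x in Ioo 0 ℓ, iteratedDeriv n φ x • f' x =
      ∫ x in Ioo 0 ℓ, iteratedDeriv n φ x • f x :=
    integral_congr_ae (hf.mono fun x hx => by simp only [hx])
  have h2 : ∫ x in Ioo 0 ℓ, φ x • g' x = ∫ x in Ioo 0 ℓ, φ x • g x :=
    integral_congr_ae (hg.mono fun x hx => by simp only [hx])
  rw [h1, h2, h.integral_eq hφ]

theorem IsWeakDeriv.sub (h : IsWeakDeriv ℓ n f g) (h' : IsWeakDeriv ℓ n f' g') :
    IsWeakDeriv ℓ n (f - f') (g - g') := by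
  refine isWeakDeriv_iff.2 ⟨h.1.sub h'.1, h.2.1.sub h'.2.1, fun φ hφ => ?_⟩
  simp only [Pi.sub_apply, smul_sub]
  rw [integral_sub ((hφ.iteratedDeriv n).integrable_smul h.1)
      ((hφ.iteratedDeriv n).integrable_smul h'.1),
    integral_sub (hφ.integrable_smul h.2.1) (hφ.integrable_smul h'.2.1), h.integral_eq hφ,
    h'.integral_eq hφ, smul_sub]

theorem IsWeakDeriv.unique (h : IsWeakDeriv ℓ n f g) (h' : IsWeakDeriv ℓ n f g') :
    g =ᵐ[volume.restrict (Ioo 0 ℓ)] g' := by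
  have h0 := h.sub h'
  rw [sub_self] at h0
  have := ae_eq_zero_of_test h0.2.1 fun φ hφ => by
    have := h0.integral_eq hφ
    simp only [Pi.zero_apply, smul_zero, integral_zero] at this
    exact (smul_eq_zero.1 this.symm).resolve_left (by positivity)
  exact this.mono fun x hx => sub_eq_zero.1 hx

theorem isWeakDeriv_zero_self (hf : LocallyIntegrableOn f (Ioo 0 ℓ) volume) :
    IsWeakDeriv ℓ 0 f f :=
  ⟨hf, hf, fun φ _ _ _ => by simp⟩

theorem IsWeakDeriv.trans_one (h : IsWeakDeriv ℓ n f g) (h' : IsWeakDeriv ℓ 1 g g') :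
    IsWeakDeriv ℓ (n + 1) f g' := by
  refine isWeakDeriv_iff.2 ⟨h.1, h'.2.1, fun φ hφ => ?_⟩
  have h1 := h.integral_eq hφ.deriv
  have h2 := h'.integral_eq hφ
  rw [iteratedDeriv_one] at h2
  rw [iteratedDeriv_succ', h1, h2, pow_one, smul_smul, pow_succ]

/-- The identity of order `n` tested against `deriv φ` has the same left side as the identity of
order `n + 1` tested against `φ`. It links weak derivatives that are each given only relative to
`f`. -/
theorem IsWeakDeriv.one_of_succ (h : IsWeakDeriv ℓ n f g) (h' : IsWeakDeriv ℓ (n + 1) f g') :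
    IsWeakDeriv ℓ 1 g g' := by
  refine isWeakDeriv_iff.2 ⟨h.2.1, h'.2.1, fun φ hφ => ?_⟩
  have h1 := h.integral_eq hφ.deriv
  have h2 := h'.integral_eq hφ
  rw [iteratedDeriv_succ', h1, pow_succ, mul_smul] at h2
  rw [iteratedDeriv_one, pow_one]
  exact smul_right_injective _ (pow_ne_zero n (by norm_num : (-1 : ℝ) ≠ 0)) h2

theorem continuousOn_primitive_Icc (hℓ : 0 ≤ ℓ) (hg : IntegrableOn g (Ioo 0 ℓ) volume) :
    ContinuousOn (fun x => ∫ y in (0 : ℝ)..x, g y) (Icc 0 ℓ) := by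
  rw [← uIcc_of_le hℓ]
  refine intervalIntegral.continuousOn_primitive_interval ?_
  rw [uIcc_of_le hℓ, integrableOn_Icc_iff_integrableOn_Ioo]
  exact hg

theorem IsTest.integral_deriv {φ : ℝ → ℝ} (h : IsTest ℓ φ) (x y : ℝ) :
    ∫ t in x..y, _root_.deriv φ t = φ y - φ x := by
  refine intervalIntegral.integral_deriv_eq_sub
    (fun t _ => (h.smooth.differentiable (by simp)).differentiableAt) ?_
  exact (h.deriv.smooth.continuous).intervalIntegrable _ _

/-- Fubini on the triangle `y ≤ x`: the inner integral of `deriv φ` over `(y, ℓ)` is `-φ y`. The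
constant `c` drops out because `deriv φ` has integral zero. -/
theorem isWeakDeriv_primitive (hg : IntegrableOn g (Ioo 0 ℓ) volume) (c : Plane)
    (hf : ∀ x ∈ Ioo 0 ℓ, f x = c + ∫ y in (0 : ℝ)..x, g y) : IsWeakDeriv ℓ 1 f g := by
  rcases le_or_gt ℓ 0 with hℓ | hℓ
  · rw [isWeakDeriv_iff]
    simp [Ioo_eq_empty_of_le hℓ, LocallyIntegrableOn]
  have hG := continuousOn_primitive_Icc hℓ.le hg
  set G : ℝ → Plane := fun x => ∫ y in (0 : ℝ)..x, g y with hGdef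
  have hGl : LocallyIntegrableOn G (Ioo 0 ℓ) volume :=
    (hG.mono Ioo_subset_Icc_self).locallyIntegrableOn measurableSet_Ioo
  have hcl : LocallyIntegrableOn (fun _ : ℝ => c) (Ioo 0 ℓ) volume :=
    (continuousOn_const).locallyIntegrableOn measurableSet_Ioo
  have hfG : f =ᵐ[volume.restrict (Ioo 0 ℓ)] fun x => c + G x :=
    (ae_restrict_iff' measurableSet_Ioo).2 (Filter.Eventually.of_forall hf)
  refine IsWeakDeriv.congr (f := fun x => c + G x) (g := g) ?_ hfG.symm Filter.EventuallyEq.rfl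
  refine isWeakDeriv_iff.2 ⟨hcl.add hGl, hg.locallyIntegrableOn, fun φ hφ => ?_⟩
  rw [iteratedDeriv_one, pow_one]
  simp only [smul_add]
  rw [integral_add (hφ.deriv.integrable_smul hcl) (hφ.deriv.integrable_smul hGl),
    integral_smul_const]
  have h0 : ∫ x in Ioo 0 ℓ, deriv φ x = 0 := by
    rw [← integral_Ioc_eq_integral_Ioo, ← intervalIntegral.integral_of_le hℓ.le,
      hφ.integral_deriv, hφ.eq_zero (by simp), hφ.eq_zero (by simp), sub_zero]
  rw [h0, zero_smul, zero_add]
  set ν := volume.restrict (Ioo 0 ℓ) with hν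
  have hint : Integrable (fun z : ℝ × ℝ => deriv φ z.1 • g z.2) (ν.prod ν) := by
    refine Integrable.smul_prod (f := deriv φ) (g := g) ?_ hg
    exact (hφ.deriv.smooth.continuous.integrable_of_hasCompactSupport hφ.deriv.compact).integrableOn
  have hset : MeasurableSet {z : ℝ × ℝ | z.2 ≤ z.1} :=
    measurableSet_le measurable_snd measurable_fst
  have hint' := hint.indicator hset
  have hL : ∫ x, deriv φ x • G x ∂ν =
      ∫ x, ∫ y, ({z : ℝ × ℝ | z.2 ≤ z.1}.indicator
        (fun z : ℝ × ℝ => deriv φ z.1 • g z.2)) (x, y) ∂ν ∂ν := by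
    refine setIntegral_congr_fun measurableSet_Ioo fun x hx => ?_
    have : (fun y => ({z : ℝ × ℝ | z.2 ≤ z.1}.indicator
        (fun z : ℝ × ℝ => deriv φ z.1 • g z.2)) (x, y)) =
        fun y => deriv φ x • (Iic x).indicator g y := by
      funext y
      by_cases hy : y ≤ x <;> simp [indicator, hy]
    simp only [this]
    rw [integral_smul, hν, setIntegral_indicator measurableSet_Iic, hGdef]
    simp only
    rw [intervalIntegral.integral_of_le hx.1.le]
    congr 2
    have : Ioo 0 ℓ ∩ Iic x = Ioc 0 x := by
      ext y; simp only [mem_inter_iff, mem_Ioo, mem_Iic, mem_Ioc]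
      exact ⟨fun h => ⟨h.1.1, h.2⟩, fun h => ⟨⟨h.1, h.2.trans_lt hx.2⟩, h.2⟩⟩
    rw [this]
  rw [hL, integral_integral_swap (f := fun x y => ({z : ℝ × ℝ | z.2 ≤ z.1}.indicator
    (fun z : ℝ × ℝ => deriv φ z.1 • g z.2)) (x, y)) hint', neg_smul, one_smul, ← integral_neg]
  refine setIntegral_congr_fun measurableSet_Ioo fun y hy => ?_
  have : (fun x => ({z : ℝ × ℝ | z.2 ≤ z.1}.indicator
      (fun z : ℝ × ℝ => deriv φ z.1 • g z.2)) (x, y)) =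
      fun x => (Ici y).indicator (deriv φ) x • g y := by
    funext x
    by_cases hy : y ≤ x <;> simp [indicator, hy]
  simp only [this]
  rw [integral_smul_const, hν, setIntegral_indicator measurableSet_Ici]
  have : Ioo 0 ℓ ∩ Ici y = Ico y ℓ := by
    ext x; simp only [mem_inter_iff, mem_Ioo, mem_Ici, mem_Ico]
    exact ⟨fun h => ⟨h.2, h.1.2⟩, fun h => ⟨⟨hy.1.trans_le h.1, h.2⟩, h.1⟩⟩
  rw [this, integral_Ico_eq_integral_Ioo, ← integral_Ioc_eq_integral_Ioo,
    ← intervalIntegral.integral_of_le hy.2.le, hφ.integral_deriv, hφ.eq_zero (by simp), zero_sub,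
    neg_smul]

/-- Du Bois-Reymond: for a fixed `ψ` of integral one and any test function `φ`, the function `φ - (∫
φ) ψ` has integral zero, so it is the derivative of a test function `η`. Testing with `η` shows that
`f` minus its `ψ`-average is orthogonal to every `φ`. -/
theorem exists_ae_eq_const (hf : LocallyIntegrableOn f (Ioo 0 ℓ) volume) (hℓ : 0 < ℓ)
    (h : IsWeakDeriv ℓ 1 f 0) : ∃ c, f =ᵐ[volume.restrict (Ioo 0 ℓ)] fun _ => c := by
  obtain ⟨ψ, hψ, hψ1⟩ : ∃ ψ, IsTest ℓ ψ ∧ ∫ x, ψ x = 1 := by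
    let B : ContDiffBump (ℓ / 2) := ⟨ℓ / 8, ℓ / 4, by positivity, by linarith⟩
    refine ⟨B.normed volume, ⟨B.contDiff_normed, B.hasCompactSupport_normed, ?_⟩,
      B.integral_normed⟩
    rw [B.tsupport_normed_eq, Real.closedBall_eq_Icc]
    refine Icc_subset_Ioo ?_ ?_ <;> simp only [B] <;> linarith
  refine ⟨∫ x in Ioo 0 ℓ, ψ x • f x, ?_⟩
  set c := ∫ x in Ioo 0 ℓ, ψ x • f x with hc
  have hcl : LocallyIntegrableOn (fun _ : ℝ => c) (Ioo 0 ℓ) volume :=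
    (continuousOn_const).locallyIntegrableOn measurableSet_Ioo
  have key := ae_eq_zero_of_test (hf.sub hcl) fun φ hφ => by
    set I := ∫ x, φ x with hI
    set ζ : ℝ → ℝ := fun x => φ x - I * ψ x with hζdef
    have hζc : Continuous ζ := hφ.smooth.continuous.sub (continuous_const.mul hψ.smooth.continuous)
    have hζs : ContDiff ℝ ∞ ζ := hφ.smooth.sub (contDiff_const.mul hψ.smooth)
    have hζ0 : ∫ x, ζ x = 0 := by
      rw [hζdef, integral_sub (hφ.smooth.continuous.integrable_of_hasCompactSupport hφ.compact)
        ((hψ.smooth.continuous.integrable_of_hasCompactSupport hψ.compact).const_mul I),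
        integral_const_mul, hψ1, mul_one, sub_self]
    -- A compact interval inside `(0, ℓ)` that holds both supports; the midpoint is added only to
    -- make the compact set nonempty.
    obtain ⟨α, β, hα, hαβ, hβ, hsupp⟩ : ∃ α β : ℝ, 0 < α ∧ α ≤ β ∧ β < ℓ ∧
        ∀ x, x ∉ Icc α β → ζ x = 0 := by
      have hK : IsCompact (tsupport φ ∪ tsupport ψ ∪ {ℓ / 2}) :=
        (hφ.compact.isCompact.union hψ.compact.isCompact).union isCompact_singleton
      have hsub : tsupport φ ∪ tsupport ψ ∪ {ℓ / 2} ⊆ Ioo 0 ℓ := by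
        refine union_subset (union_subset hφ.supp hψ.supp) ?_
        rw [singleton_subset_iff]; constructor <;> linarith
      have hne : (tsupport φ ∪ tsupport ψ ∪ {ℓ / 2}).Nonempty := ⟨ℓ / 2, by simp⟩
      obtain ⟨α, hα, hα'⟩ := hK.exists_isLeast hne
      obtain ⟨β, hβ, hβ'⟩ := hK.exists_isGreatest hne
      refine ⟨α, β, (hsub hα).1, hα' hβ, (hsub hβ).2, fun x hx => ?_⟩
      have hx' : x ∉ tsupport φ ∪ tsupport ψ ∪ {ℓ / 2} := fun h => hx ⟨hα' h, hβ' h⟩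
      simp only [mem_union, not_or] at hx'
      simp [hζdef, image_eq_zero_of_notMem_tsupport hx'.1.1,
        image_eq_zero_of_notMem_tsupport hx'.1.2]
    set η : ℝ → ℝ := fun x => ∫ t in (0 : ℝ)..x, ζ t with hη
    have hηd : ∀ x, HasDerivAt η (ζ x) x := fun x =>
      intervalIntegral.integral_hasDerivAt_right (hζc.intervalIntegrable _ _)
        (hζc.stronglyMeasurableAtFilter _ _) hζc.continuousAt
    have hηderiv : deriv η = ζ := funext fun x => (hηd x).deriv
    have hη0 : ∀ x, x ∉ Icc α β → η x = 0 := by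
      intro x hx
      rw [mem_Icc, not_and_or, not_le, not_le] at hx
      rcases hx with hx | hx
      · refine intervalIntegral.integral_zero_ae (Filter.Eventually.of_forall fun t ht => ?_)
        refine hsupp t fun h => ?_
        rcases le_total 0 x with h0 | h0
        · rw [uIoc_of_le h0] at ht; linarith [ht.2, h.1]
        · rw [uIoc_of_ge h0] at ht; linarith [ht.2, h.1]
      · have h0x : (0 : ℝ) ≤ x := by linarith
        rw [hη]
        simp only
        rw [intervalIntegral.integral_of_le h0x,
          setIntegral_eq_integral_of_forall_compl_eq_zero, hζ0]
        intro t ht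
        exact hsupp t fun h => ht ⟨hα.trans_le h.1, by linarith [h.2]⟩
    have hηtest : IsTest ℓ η := by
      have hts : tsupport η ⊆ Icc α β := by
        refine closure_minimal (fun x hx => ?_) isClosed_Icc
        by_contra h
        exact hx (hη0 x h)
      refine ⟨contDiff_infty_iff_deriv.2 ⟨fun x => (hηd x).differentiableAt, hηderiv ▸ hζs⟩,
        HasCompactSupport.of_support_subset_isCompact isCompact_Icc (subset_closure.trans hts),
        hts.trans (Icc_subset_Ioo hα hβ)⟩
    have h1 := h.integral_eq hηtest
    rw [iteratedDeriv_one, hηderiv] at h1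
    simp only [Pi.zero_apply, smul_zero, integral_zero, hζdef, sub_smul, mul_smul] at h1
    have hψf : Integrable (fun x => I • ψ x • f x) (volume.restrict (Ioo 0 ℓ)) :=
      (hψ.integrable_smul hf).smul I
    rw [integral_sub (hφ.integrable_smul hf) hψf, integral_smul, ← hc, sub_eq_zero] at h1
    simp only [Pi.sub_apply, smul_sub]
    rw [integral_sub (hφ.integrable_smul hf) (hφ.integrable_smul hcl), h1, integral_smul_const,
      setIntegral_eq_integral_of_forall_compl_eq_zero (fun x hx => hφ.eq_zero hx), ← hI, sub_self]
  exact key.mono fun x hx => sub_eq_zero.1 hx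

theorem IsWeakDeriv.exists_primitive (hℓ : 0 < ℓ) (h : IsWeakDeriv ℓ 1 f g)
    (hg : IntegrableOn g (Ioo 0 ℓ) volume) :
    ∃ c, f =ᵐ[volume.restrict (Ioo 0 ℓ)] fun x => c + ∫ y in (0 : ℝ)..x, g y := by
  have h1 := h.sub (isWeakDeriv_primitive hg 0 (f := fun x => ∫ y in (0 : ℝ)..x, g y)
    fun x _ => (zero_add _).symm)
  rw [sub_self] at h1
  obtain ⟨c, hc⟩ := exists_ae_eq_const h1.1 hℓ h1
  exact ⟨c, hc.mono fun x hx => sub_eq_iff_eq_add.1 hx⟩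

end WeakDerivatives

/-! ### Gagliardo–Slobodeckij seminorms: Poincaré inequality and embeddings -/

section FractionalSeminorms

theorem sq_lintegral_le {α : Type*} [MeasurableSpace α] (μ : Measure α) {f : α → ℝ≥0∞}
    (hf : AEMeasurable f μ) : (∫⁻ x, f x ∂μ) ^ 2 ≤ μ univ * ∫⁻ x, f x ^ 2 ∂μ := by
  have h := ENNReal.lintegral_mul_le_Lp_mul_Lq μ Real.HolderConjugate.two_two
    (f := fun _ => 1) aemeasurable_const hf
  simp only [Pi.mul_apply, one_mul, ENNReal.rpow_two, one_pow, lintegral_one] at h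
  calc (∫⁻ x, f x ∂μ) ^ 2
      ≤ (μ univ ^ (1 / 2 : ℝ) * (∫⁻ x, f x ^ 2 ∂μ) ^ (1 / 2 : ℝ)) ^ 2 := by gcongr
    _ = _ := by
      rw [← ENNReal.rpow_two, ENNReal.mul_rpow_of_nonneg _ _ (by norm_num), ← ENNReal.rpow_mul,
        ← ENNReal.rpow_mul]
      norm_num

theorem sq_enorm_intervalIntegral_le {g : ℝ → Plane} {x y : ℝ}
    (hg : AEStronglyMeasurable g (volume.restrict (uIoc x y))) :
    ‖∫ t in x..y, g t‖ₑ ^ 2 ≤ ENNReal.ofReal |y - x| * ∫⁻ t in uIoc x y, ‖g t‖ₑ ^ 2 := by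
  have h1 : ‖∫ t in x..y, g t‖ₑ ≤ ∫⁻ t in uIoc x y, ‖g t‖ₑ := by
    rw [intervalIntegral.intervalIntegral_eq_integral_uIoc]
    refine le_trans ?_ (enorm_integral_le_lintegral_enorm _)
    rw [enorm_smul]
    split_ifs <;> simp
  calc _ ≤ (∫⁻ t in uIoc x y, ‖g t‖ₑ) ^ 2 := by gcongr
    _ ≤ _ := sq_lintegral_le _ hg.enorm
    _ = _ := by rw [Measure.restrict_apply_univ, uIoc, Real.volume_Ioc, max_sub_min_eq_abs]

theorem eLpNorm_two_eq {ν : Measure ℝ} (g : ℝ → Plane) :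
    eLpNorm g 2 ν = (∫⁻ t, ‖g t‖ₑ ^ 2 ∂ν) ^ (1 / 2 : ℝ) := by
  rw [eLpNorm_eq_lintegral_rpow_enorm_toReal (by norm_num) (by norm_num)]
  simp

theorem sqrt_sq_ennreal (a : ℝ≥0∞) : (a ^ 2) ^ (1 / 2 : ℝ) = a := by
  rw [← ENNReal.rpow_two, ← ENNReal.rpow_mul]; norm_num

variable {ℓ : ℝ} {f g g' : ℝ → Plane}

theorem restrict_uIoc_le {x y : ℝ} (hx : x ∈ Icc 0 ℓ) (hy : y ∈ Icc 0 ℓ) :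
    (volume : Measure ℝ).restrict (uIoc x y) ≤ volume.restrict (Ioo 0 ℓ) := by
  rw [Measure.restrict_congr_set (Ioo_ae_eq_Ioc (μ := volume) (a := 0) (b := ℓ))]
  refine Measure.restrict_mono (Ioc_subset_Ioc ?_ ?_) le_rfl
  · exact le_min hx.1 hy.1
  · exact max_le hx.2 hy.2

theorem norm_intervalIntegral_le (hℓ : 0 ≤ ℓ)
    (hg : AEStronglyMeasurable g (volume.restrict (Ioo 0 ℓ))) {K : ℝ} (hK : 0 ≤ K)
    (hgK : eLpNorm g 2 (volume.restrict (Ioo 0 ℓ)) ≤ ENNReal.ofReal K) {x y : ℝ}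
    (hx : x ∈ Icc 0 ℓ) (hy : y ∈ Icc 0 ℓ) : ‖∫ t in x..y, g t‖ ≤ √ℓ * K := by
  have hle := restrict_uIoc_le hx hy
  have h1 := sq_enorm_intervalIntegral_le (hg.mono_measure hle)
  have h2 : ∫⁻ t in uIoc x y, ‖g t‖ₑ ^ 2 ≤ ENNReal.ofReal (K ^ 2) := by
    refine (lintegral_mono' hle le_rfl).trans ?_
    rw [eLpNorm_two_eq] at hgK
    have := ENNReal.rpow_le_rpow hgK (z := 2) (by norm_num)
    rw [← ENNReal.rpow_mul] at this
    norm_num at this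
    rwa [← ENNReal.ofReal_pow hK] at this
  have h3 : |y - x| ≤ ℓ := by
    rw [abs_le]; constructor <;> linarith [hx.1, hx.2, hy.1, hy.2]
  have h4 : ‖∫ t in x..y, g t‖ₑ ^ 2 ≤ ENNReal.ofReal (ℓ * K ^ 2) := by
    rw [ENNReal.ofReal_mul hℓ]
    exact h1.trans (mul_le_mul' (ENNReal.ofReal_le_ofReal h3) h2)
  rw [← ofReal_norm, ← ENNReal.ofReal_pow (norm_nonneg _),
    ENNReal.ofReal_le_ofReal_iff (by positivity)] at h4
  refine abs_le_of_sq_le_sq' ?_ (by positivity) |>.2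
  rwa [mul_pow, Real.sq_sqrt hℓ]

theorem eLpNorm_le_of_norm_le (hℓ : 0 ≤ ℓ) {K : ℝ}
    (hgK : ∀ x ∈ Ioo 0 ℓ, ‖g x‖ ≤ K) :
    eLpNorm g 2 (volume.restrict (Ioo 0 ℓ)) ≤ ENNReal.ofReal (√ℓ * K) := by
  refine (eLpNorm_le_of_ae_bound ((ae_restrict_iff' measurableSet_Ioo).2
    (Filter.Eventually.of_forall hgK))).trans ?_
  rw [Measure.restrict_apply_univ, Real.volume_Ioo, sub_zero, ENNReal.ofReal_mul (by positivity),
    Real.sqrt_eq_rpow, ENNReal.ofReal_rpow_of_nonneg hℓ (by simp)]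
  simp

theorem fracSeminorm_zero : fracSeminorm ℓ 0 g = eLpNorm g 2 (volume.restrict (Ioo 0 ℓ)) :=
  if_pos rfl

/-- The integrand of the Gagliardo–Slobodeckij seminorm. -/
def slobIntegrand (θ : ℝ) (g : ℝ → Plane) (x y : ℝ) : ℝ≥0∞ :=
  ENNReal.ofReal (‖g x - g y‖ ^ 2 / |x - y| ^ (1 + 2 * θ))

theorem fracSeminorm_of_ne {θ : ℝ} (hθ : θ ≠ 0) : fracSeminorm ℓ θ g =
    (∫⁻ x in Ioo 0 ℓ, ∫⁻ y in Ioo 0 ℓ, slobIntegrand θ g x y) ^ (1 / 2 : ℝ) :=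
  if_neg hθ

theorem fracSeminorm_congr (θ : ℝ) (h : f =ᵐ[volume.restrict (Ioo 0 ℓ)] g) :
    fracSeminorm ℓ θ f = fracSeminorm ℓ θ g := by
  rcases eq_or_ne θ 0 with rfl | hθ
  · rw [fracSeminorm_zero, fracSeminorm_zero, eLpNorm_congr_ae h]
  · rw [fracSeminorm_of_ne hθ, fracSeminorm_of_ne hθ]
    congr 1
    refine lintegral_congr_ae (h.mono fun x hx => ?_)
    refine lintegral_congr_ae (h.mono fun y hy => ?_)
    simp only [slobIntegrand, hx, hy]

theorem aemeasurable_slobIntegrand (θ : ℝ) (ν : Measure ℝ) [SFinite ν]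
    (hf : AEStronglyMeasurable f ν) :
    AEMeasurable (fun z : ℝ × ℝ => slobIntegrand θ f z.1 z.2) (ν.prod ν) := by
  have h1 : AEMeasurable (fun z : ℝ × ℝ => ‖f z.1 - f z.2‖) (ν.prod ν) :=
    (hf.comp_fst.sub hf.comp_snd).norm.aemeasurable
  have h2 : Measurable (fun z : ℝ × ℝ => |z.1 - z.2| ^ (1 + 2 * θ)) := by fun_prop
  exact ((h1.pow_const 2).div h2.aemeasurable).ennreal_ofReal

theorem aemeasurable_slobIntegrand_right (θ : ℝ) (ν : Measure ℝ)
    (hf : AEStronglyMeasurable f ν) (x : ℝ) :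
    AEMeasurable (fun y : ℝ => slobIntegrand θ f x y) ν := by
  have h1 : AEMeasurable (fun y : ℝ => ‖f x - f y‖) ν :=
    (aestronglyMeasurable_const.sub hf).norm.aemeasurable
  have h2 : Measurable (fun y : ℝ => |x - y| ^ (1 + 2 * θ)) := by fun_prop
  exact ((h1.pow_const 2).div h2.aemeasurable).ennreal_ofReal

theorem slobIntegrand_add_le (θ x y : ℝ) :
    slobIntegrand θ (f + g) x y ≤ 2 * slobIntegrand θ f x y + 2 * slobIntegrand θ g x y := by
  have h2 : ∀ r : ℝ, 2 * ENNReal.ofReal r = ENNReal.ofReal (2 * r) := fun r => by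
    rw [ENNReal.ofReal_mul (by norm_num)]; simp
  rw [slobIntegrand, slobIntegrand, slobIntegrand, h2, h2,
    ← ENNReal.ofReal_add (by positivity) (by positivity)]
  refine ENNReal.ofReal_le_ofReal ?_
  rw [← mul_div_assoc, ← mul_div_assoc, ← add_div]
  gcongr
  have h : ‖(f + g) x - (f + g) y‖ ≤ ‖f x - f y‖ + ‖g x - g y‖ := by
    rw [Pi.add_apply, Pi.add_apply, add_sub_add_comm]
    exact norm_add_le _ _
  have := norm_nonneg ((f + g) x - (f + g) y)
  nlinarith [sq_nonneg (‖f x - f y‖ - ‖g x - g y‖)]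

/-- The constant `2` is harmless later, so the pointwise inequality `(p + q)² ≤ 2 p² + 2 q²` can
stand in for Minkowski's. -/
theorem fracSeminorm_add_le (θ : ℝ) (hf : AEStronglyMeasurable f (volume.restrict (Ioo 0 ℓ)))
    (hg : AEStronglyMeasurable g (volume.restrict (Ioo 0 ℓ))) :
    fracSeminorm ℓ θ (f + g) ≤ 2 * (fracSeminorm ℓ θ f + fracSeminorm ℓ θ g) := by
  rcases eq_or_ne θ 0 with rfl | hθ
  · simp only [fracSeminorm_zero]
    refine (eLpNorm_add_le hf hg (by norm_num)).trans ?_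
    exact le_mul_of_one_le_left' (by norm_num)
  · simp only [fracSeminorm_of_ne hθ]
    set ν := volume.restrict (Ioo 0 ℓ)
    set A := ∫⁻ x, ∫⁻ y, slobIntegrand θ f x y ∂ν ∂ν
    set B := ∫⁻ x, ∫⁻ y, slobIntegrand θ g x y ∂ν ∂ν
    have key : ∫⁻ x, ∫⁻ y, slobIntegrand θ (f + g) x y ∂ν ∂ν ≤ 2 * A + 2 * B := by
      calc _ ≤ ∫⁻ x, ∫⁻ y, (2 * slobIntegrand θ f x y + 2 * slobIntegrand θ g x y) ∂ν ∂ν :=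
            lintegral_mono fun x => lintegral_mono fun y => slobIntegrand_add_le θ x y
        _ = ∫⁻ x, (2 * ∫⁻ y, slobIntegrand θ f x y ∂ν + 2 * ∫⁻ y, slobIntegrand θ g x y ∂ν) ∂ν := by
            refine lintegral_congr fun x => ?_
            rw [lintegral_add_left' ((aemeasurable_slobIntegrand_right θ ν hf x).const_mul 2),
              lintegral_const_mul' _ _ (by norm_num), lintegral_const_mul' _ _ (by norm_num)]
        _ = _ := by
            rw [lintegral_add_left' ((aemeasurable_slobIntegrand θ ν hf).lintegral_prod_right'.const_mul 2),
              lintegral_const_mul' _ _ (by norm_num), lintegral_const_mul' _ _ (by norm_num)]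
    have hs : ∀ a : ℝ≥0∞, a = (a ^ (1 / 2 : ℝ)) ^ 2 := fun a => by
      rw [← ENNReal.rpow_two, ← ENNReal.rpow_mul]; norm_num
    refine (ENNReal.rpow_le_rpow key (by norm_num)).trans ?_
    rw [hs A, hs B, sqrt_sq_ennreal, sqrt_sq_ennreal]
    set α := A ^ (1 / 2 : ℝ)
    set β := B ^ (1 / 2 : ℝ)
    rw [← sqrt_sq_ennreal (2 * (α + β))]
    refine ENNReal.rpow_le_rpow ?_ (by norm_num)
    have e : (2 * (α + β)) ^ 2 = 2 * α ^ 2 + 2 * β ^ 2 + (2 * α ^ 2 + 2 * β ^ 2 + 8 * (α * β)) := by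
      ring
    rw [e]
    exact le_self_add

/-- Lowering the order gains a power of `ℓ` because `|x - y| ≤ ℓ` on the interval. -/
theorem slobIntegrand_mul_le {θ μ : ℝ} (hμθ : μ ≤ θ) {x y : ℝ}
    (hx : x ∈ Ioo 0 ℓ) (hy : y ∈ Ioo 0 ℓ) :
    slobIntegrand μ g x y ≤ ENNReal.ofReal (ℓ ^ (2 * (θ - μ))) * slobIntegrand θ g x y := by
  have hℓ : 0 < ℓ := hx.1.trans hx.2
  rw [slobIntegrand, slobIntegrand, ← ENNReal.ofReal_mul (by positivity)]
  refine ENNReal.ofReal_le_ofReal ?_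
  rcases eq_or_ne x y with rfl | hxy
  · simp
  have hd : 0 < |x - y| := abs_pos.2 (sub_ne_zero.2 hxy)
  have hdℓ : |x - y| ≤ ℓ := by
    rw [abs_le]; constructor <;> linarith [hx.1, hx.2, hy.1, hy.2]
  rw [← mul_div_assoc, div_le_div_iff₀ (by positivity) (by positivity)]
  have h : |x - y| ^ (1 + 2 * θ) ≤ ℓ ^ (2 * (θ - μ)) * |x - y| ^ (1 + 2 * μ) := by
    have : (1 + 2 * θ) = 2 * (θ - μ) + (1 + 2 * μ) := by ring
    rw [this, Real.rpow_add hd]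
    gcongr
  calc _ ≤ ‖g x - g y‖ ^ 2 * (ℓ ^ (2 * (θ - μ)) * |x - y| ^ (1 + 2 * μ)) := by gcongr
    _ = _ := by ring

theorem fracSeminorm_le_of_le {θ μ : ℝ} (hℓ : 0 < ℓ) (hμ : 0 < μ) (hμθ : μ ≤ θ) :
    fracSeminorm ℓ μ g ≤ ENNReal.ofReal (ℓ ^ (θ - μ)) * fracSeminorm ℓ θ g := by
  rw [fracSeminorm_of_ne hμ.ne', fracSeminorm_of_ne (hμ.trans_le hμθ).ne']
  have key : ∫⁻ x in Ioo 0 ℓ, ∫⁻ y in Ioo 0 ℓ, slobIntegrand μ g x y ≤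
      ENNReal.ofReal (ℓ ^ (2 * (θ - μ))) *
        ∫⁻ x in Ioo 0 ℓ, ∫⁻ y in Ioo 0 ℓ, slobIntegrand θ g x y := by
    rw [← lintegral_const_mul' _ _ ENNReal.ofReal_ne_top]
    refine setLIntegral_mono' measurableSet_Ioo fun x hx => ?_
    rw [← lintegral_const_mul' _ _ ENNReal.ofReal_ne_top]
    exact setLIntegral_mono' measurableSet_Ioo fun y hy => slobIntegrand_mul_le hμθ hx hy
  refine (ENNReal.rpow_le_rpow key (by norm_num)).trans ?_
  rw [ENNReal.mul_rpow_of_nonneg _ _ (by norm_num), ENNReal.ofReal_rpow_of_nonneg (by positivity)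
    (by norm_num), ← Real.rpow_mul hℓ.le]
  have : 2 * (θ - μ) * (1 / 2) = θ - μ := by ring
  rw [this]

/-- Poincaré inequality for the fractional seminorm. -/
theorem eLpNorm_sub_mean_le {θ : ℝ} (hℓ : 0 < ℓ) (hθ : 0 < θ)
    (hg : IntegrableOn g (Ioo 0 ℓ) volume) :
    eLpNorm (fun x => g x - ℓ⁻¹ • ∫ y in Ioo 0 ℓ, g y) 2 (volume.restrict (Ioo 0 ℓ)) ≤
      ENNReal.ofReal (ℓ ^ θ) * fracSeminorm ℓ θ g := by
  rw [eLpNorm_two_eq, fracSeminorm_of_ne hθ.ne']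
  have hvol : volume.restrict (Ioo 0 ℓ) (univ : Set ℝ) = ENNReal.ofReal ℓ := by
    simp
  have key : ∫⁻ x in Ioo 0 ℓ, ‖g x - ℓ⁻¹ • ∫ y in Ioo 0 ℓ, g y‖ₑ ^ 2 ≤
      ENNReal.ofReal (ℓ ^ (2 * θ)) *
        ∫⁻ x in Ioo 0 ℓ, ∫⁻ y in Ioo 0 ℓ, slobIntegrand θ g x y := by
    rw [← lintegral_const_mul' _ _ ENNReal.ofReal_ne_top]
    refine setLIntegral_mono' measurableSet_Ioo fun x hx => ?_
    -- The deviation from the mean is the mean of the differences `g x - g y`. Cauchy–Schwarz in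
    -- `y`, then `|x - y| ≤ ℓ` to insert the kernel, give the factor `ℓ⁻² · ℓ · ℓ ^ (1 + 2 θ) = ℓ ^
    -- (2 θ)`.
    have h1 : g x - ℓ⁻¹ • ∫ y in Ioo 0 ℓ, g y = ℓ⁻¹ • ∫ y in Ioo 0 ℓ, (g x - g y) := by
      rw [integral_sub (integrable_const _) hg, smul_sub]
      simp [hℓ.le, smul_smul, hℓ.ne']
    have h2 : ‖∫ y in Ioo 0 ℓ, (g x - g y)‖ₑ ^ 2 ≤
        ENNReal.ofReal ℓ * ∫⁻ y in Ioo 0 ℓ, ‖g x - g y‖ₑ ^ 2 := by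
      rw [← hvol]
      refine le_trans ?_ (sq_lintegral_le _
        (aestronglyMeasurable_const.sub hg.aestronglyMeasurable).enorm)
      gcongr
      exact enorm_integral_le_lintegral_enorm _
    have h3 : ∫⁻ y in Ioo 0 ℓ, ‖g x - g y‖ₑ ^ 2 ≤
        ENNReal.ofReal (ℓ ^ (1 + 2 * θ)) * ∫⁻ y in Ioo 0 ℓ, slobIntegrand θ g x y := by
      rw [← lintegral_const_mul' _ _ ENNReal.ofReal_ne_top]
      refine setLIntegral_mono' measurableSet_Ioo fun y hy => ?_
      rw [slobIntegrand, ← ENNReal.ofReal_mul (by positivity), ← ofReal_norm,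
        ← ENNReal.ofReal_pow (norm_nonneg _)]
      refine ENNReal.ofReal_le_ofReal ?_
      rcases eq_or_ne x y with rfl | hxy
      · simp
      have hd : 0 < |x - y| := abs_pos.2 (sub_ne_zero.2 hxy)
      have hdℓ : |x - y| ≤ ℓ := by
        rw [abs_le]; constructor <;> linarith [hx.1, hx.2, hy.1, hy.2]
      rw [← mul_div_assoc, le_div_iff₀ (by positivity), mul_comm]
      gcongr
    rw [h1, enorm_smul, mul_pow]
    have h4 : ‖ℓ⁻¹‖ₑ ^ 2 = ENNReal.ofReal (ℓ⁻¹ ^ 2) := by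
      rw [← ofReal_norm, ← ENNReal.ofReal_pow (norm_nonneg _), Real.norm_eq_abs, sq_abs]
    have h5 : ENNReal.ofReal (ℓ⁻¹ ^ 2) * (ENNReal.ofReal ℓ * ENNReal.ofReal (ℓ ^ (1 + 2 * θ))) =
        ENNReal.ofReal (ℓ ^ (2 * θ)) := by
      rw [← ENNReal.ofReal_mul hℓ.le, ← ENNReal.ofReal_mul (by positivity),
        Real.rpow_add hℓ, Real.rpow_one]
      congr 1
      field_simp
    rw [h4, ← h5, mul_assoc, mul_assoc]
    gcongr
    exact h2.trans (by gcongr)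
  refine (ENNReal.rpow_le_rpow key (by norm_num)).trans ?_
  rw [ENNReal.mul_rpow_of_nonneg _ _ (by norm_num), ENNReal.ofReal_rpow_of_nonneg (by positivity)
    (by norm_num), ← Real.rpow_mul hℓ.le]
  have : 2 * θ * (1 / 2) = θ := by ring
  rw [this]

/-- Translating the singularity to the origin leaves a domain inside `[-ℓ, ℓ]`, which makes the
bound uniform in `t`. By symmetry it is twice the integral over `(0, ℓ]`, finite for `μ < 1`. -/
theorem lintegral_abs_rpow_le {μ : ℝ} (hμ : μ < 1) (hℓ : 0 < ℓ) {t : ℝ} (ht : t ∈ Icc 0 ℓ) :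
    ∫⁻ x in Ioo 0 ℓ, ENNReal.ofReal (|x - t| ^ (-μ)) ≤
      ENNReal.ofReal (2 / (1 - μ) * ℓ ^ (1 - μ)) := by
  set a : ℝ → ℝ≥0∞ := fun z => ENNReal.ofReal (|z| ^ (-μ)) with ha
  have h0 : ∫⁻ z in Ioc 0 ℓ, a z = ENNReal.ofReal (ℓ ^ (1 - μ) / (1 - μ)) := by
    have hi : IntervalIntegrable (fun z : ℝ => z ^ (-μ)) volume 0 ℓ :=
      intervalIntegral.intervalIntegrable_rpow' (by linarith)
    rw [intervalIntegrable_iff_integrableOn_Ioc_of_le hℓ.le] at hi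
    have h2 : ∫ z in Ioc 0 ℓ, z ^ (-μ) = ℓ ^ (1 - μ) / (1 - μ) := by
      rw [← intervalIntegral.integral_of_le hℓ.le, integral_rpow (Or.inl (by linarith)),
        Real.zero_rpow (by linarith), sub_zero]
      rw [neg_add_eq_sub]
    rw [← h2, ofReal_integral_eq_lintegral_ofReal hi
      ((ae_restrict_iff' measurableSet_Ioc).2 (Filter.Eventually.of_forall fun z hz =>
        Real.rpow_nonneg hz.1.le _))]
    exact setLIntegral_congr_fun measurableSet_Ioc fun z hz => by
      simp only [ha, abs_of_pos hz.1]
  have h1 : ∫⁻ z in Ico (-ℓ) 0, a z = ∫⁻ z in Ioc 0 ℓ, a z := by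
    rw [← lintegral_indicator measurableSet_Ioc, ← lintegral_indicator measurableSet_Ico,
      ← lintegral_neg_eq_self]
    refine lintegral_congr fun z => ?_
    have : -z ∈ Ico (-ℓ) 0 ↔ z ∈ Ioc 0 ℓ := by
      simp only [mem_Ico, mem_Ioc]; constructor <;> rintro ⟨h, h'⟩ <;> constructor <;> linarith
    by_cases hz : z ∈ Ioc 0 ℓ
    · rw [indicator_of_mem (this.2 hz), indicator_of_mem hz]; simp [ha]
    · rw [indicator_of_notMem (fun h => hz (this.1 h)), indicator_of_notMem hz]
  calc ∫⁻ x in Ioo 0 ℓ, ENNReal.ofReal (|x - t| ^ (-μ))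
      = ∫⁻ x, (Ioo 0 ℓ).indicator (fun x => a (x - t)) x :=
        (lintegral_indicator measurableSet_Ioo _).symm
    _ ≤ ∫⁻ x, (Icc (-ℓ) ℓ).indicator a (x - t) := by
        refine lintegral_mono fun x => ?_
        by_cases hx : x ∈ Ioo 0 ℓ
        · have : x - t ∈ Icc (-ℓ) ℓ := ⟨by linarith [hx.1, ht.2], by linarith [hx.2, ht.1]⟩
          rw [indicator_of_mem hx, indicator_of_mem this]
        · rw [indicator_of_notMem hx]; exact zero_le
    _ = ∫⁻ z in Icc (-ℓ) ℓ, a z := by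
        rw [lintegral_sub_right_eq_self (fun z => (Icc (-ℓ) ℓ).indicator a z) t,
          lintegral_indicator measurableSet_Icc]
    _ ≤ ∫⁻ z in Ico (-ℓ) 0 ∪ Icc 0 ℓ, a z := by
        refine lintegral_mono_set fun z hz => ?_
        rcases lt_or_ge z 0 with h | h
        · exact Or.inl ⟨hz.1, h⟩
        · exact Or.inr ⟨h, hz.2⟩
    _ ≤ (∫⁻ z in Ico (-ℓ) 0, a z) + ∫⁻ z in Icc 0 ℓ, a z := lintegral_union_le _ _ _
    _ = _ := by
        rw [h1, setLIntegral_congr Ioc_ae_eq_Icc.symm, h0, ← ENNReal.ofReal_add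
          (by have := sub_pos.2 hμ; positivity) (by have := sub_pos.2 hμ; positivity)]
        congr 1
        ring

/-- Embedding of `H¹` into the fractional spaces of lower order. -/
theorem fracSeminorm_le_eLpNorm_deriv {μ : ℝ} (hℓ : 0 < ℓ) (hμ : 0 < μ) (hμ1 : μ < 1)
    (hg' : AEStronglyMeasurable g' (volume.restrict (Ioo 0 ℓ)))
    (h : ∀ x ∈ Ioo 0 ℓ, ∀ y ∈ Ioo 0 ℓ, g x - g y = ∫ t in y..x, g' t) :
    fracSeminorm ℓ μ g ≤ ENNReal.ofReal (2 / (1 - μ) * ℓ ^ (1 - μ)) *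
      eLpNorm g' 2 (volume.restrict (Ioo 0 ℓ)) := by
  rw [fracSeminorm_of_ne hμ.ne', eLpNorm_two_eq]
  set ν := volume.restrict (Ioo 0 ℓ) with hν
  set K := ENNReal.ofReal (2 / (1 - μ) * ℓ ^ (1 - μ)) with hK
  set a : ℝ → ℝ → ℝ≥0∞ := fun x t => ENNReal.ofReal (|x - t| ^ (-μ)) with ha
  have ham : Measurable (fun z : ℝ × ℝ => a z.1 z.2) := by
    simp only [ha]; fun_prop
  have hat : ∀ t, Measurable (fun x => a x t) := fun t => by
    simp only [ha]; fun_prop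
  have haK : ∀ t ∈ Ioo 0 ℓ, ∫⁻ x, a x t ∂ν ≤ K := fun t ht =>
    lintegral_abs_rpow_le hμ1 hℓ (Ioo_subset_Icc_self ht)
  have hpt : ∀ x ∈ Ioo 0 ℓ, ∀ y ∈ Ioo 0 ℓ,
      slobIntegrand μ g x y ≤ ∫⁻ t, a x t * a y t * ‖g' t‖ₑ ^ 2 ∂ν := by
    intro x hx y hy
    rcases eq_or_ne x y with rfl | hxy
    · simp [slobIntegrand]
    have hle := restrict_uIoc_le (Ioo_subset_Icc_self hy) (Ioo_subset_Icc_self hx)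
    have hd : 0 < |x - y| := abs_pos.2 (sub_ne_zero.2 hxy)
    have h1 := sq_enorm_intervalIntegral_le (hg'.mono_measure hle)
    rw [← h x hx y hy] at h1
    have h2 : slobIntegrand μ g x y =
        ENNReal.ofReal (|x - y| ^ (-(1 + 2 * μ))) * ‖g x - g y‖ₑ ^ 2 := by
      rw [slobIntegrand, ← ofReal_norm, ← ENNReal.ofReal_pow (norm_nonneg _),
        ← ENNReal.ofReal_mul (by positivity), Real.rpow_neg hd.le]
      congr 1
      rw [div_eq_inv_mul]
    have h3 : ENNReal.ofReal (|x - y| ^ (-(1 + 2 * μ))) * ENNReal.ofReal |x - y| =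
        ENNReal.ofReal (|x - y| ^ (-(2 * μ))) := by
      rw [← ENNReal.ofReal_mul (by positivity)]
      congr 1
      nth_rewrite 2 [← Real.rpow_one |x - y|]
      rw [← Real.rpow_add hd]
      congr 1
      ring
    -- Extending the integral of `‖g' t‖²` at once to the whole interval would leave the kernel `|x
    -- - y| ^ (-2μ)`, not integrable for `μ ≥ 1/2`. Instead it is split as `|x - t| ^ (-μ) |y - t| ^
    -- (-μ)` for `t` between `x` and `y`; by Tonelli each factor is integrated separately and
    -- contributes one `K`.
    calc slobIntegrand μ g x y
        ≤ ENNReal.ofReal (|x - y| ^ (-(2 * μ))) * ∫⁻ t in uIoc y x, ‖g' t‖ₑ ^ 2 := by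
          rw [h2, ← h3, mul_assoc]
          gcongr
      _ = ∫⁻ t in uIoc y x, ENNReal.ofReal (|x - y| ^ (-(2 * μ))) * ‖g' t‖ₑ ^ 2 :=
          (lintegral_const_mul' _ _ ENNReal.ofReal_ne_top).symm
      _ ≤ ∫⁻ t in uIoc y x, a x t * a y t * ‖g' t‖ₑ ^ 2 := by
          refine lintegral_mono_ae ?_
          rw [ae_restrict_iff' measurableSet_uIoc]
          -- At `t = x` or `t = y` the power `0 ^ (-μ)` has the default value `0` and the pointwise
          -- bound may fail; these two points are null.
          have hne : ∀ᵐ t : ℝ, t ≠ x ∧ t ≠ y := by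
            rw [Filter.eventually_and]
            exact ⟨Measure.ae_ne volume x, Measure.ae_ne volume y⟩
          refine hne.mono fun t ht htm => ?_
          gcongr
          rw [← ENNReal.ofReal_mul (by positivity)]
          refine ENNReal.ofReal_le_ofReal ?_
          have e : -(2 * μ) = -μ + -μ := by ring
          rw [e, Real.rpow_add hd]
          have htm' := uIoc_subset_uIcc htm
          have hxt : 0 < |x - t| := abs_pos.2 (sub_ne_zero.2 ht.1.symm)
          have hyt : 0 < |y - t| := abs_pos.2 (sub_ne_zero.2 ht.2.symm)
          have hbx : |x - t| ≤ |x - y| := by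
            rw [abs_sub_comm x y]; rw [abs_sub_comm x t, abs_sub_comm y x]
            rw [abs_sub_comm]; exact abs_sub_right_of_mem_uIcc htm'
          have hby : |y - t| ≤ |x - y| := by
            rw [abs_sub_comm y t]; exact abs_sub_left_of_mem_uIcc htm'
          exact mul_le_mul (Real.rpow_le_rpow_of_nonpos hxt hbx (by linarith))
            (Real.rpow_le_rpow_of_nonpos hyt hby (by linarith)) (by positivity) (by positivity)
      _ ≤ _ := lintegral_mono' hle le_rfl
  have hG : AEMeasurable (fun t => ‖g' t‖ₑ ^ 2) ν := hg'.enorm.pow_const 2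
  have key : ∫⁻ x, ∫⁻ y, slobIntegrand μ g x y ∂ν ∂ν ≤ K ^ 2 * ∫⁻ t, ‖g' t‖ₑ ^ 2 ∂ν := by
    have hinner : ∀ x ∈ Ioo 0 ℓ, ∫⁻ y, slobIntegrand μ g x y ∂ν ≤
        ∫⁻ t, K * (a x t * ‖g' t‖ₑ ^ 2) ∂ν := by
      intro x hx
      calc _ ≤ ∫⁻ y, ∫⁻ t, a x t * a y t * ‖g' t‖ₑ ^ 2 ∂ν ∂ν :=
            setLIntegral_mono' measurableSet_Ioo fun y hy => hpt x hx y hy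
        _ = ∫⁻ t, ∫⁻ y, a x t * a y t * ‖g' t‖ₑ ^ 2 ∂ν ∂ν := by
            refine lintegral_lintegral_swap ?_
            refine AEMeasurable.mul (AEMeasurable.mul ?_ ham.aemeasurable) hG.comp_snd
            exact (ham.comp (measurable_const.prodMk measurable_snd)).aemeasurable
        _ ≤ _ := by
            refine setLIntegral_mono' measurableSet_Ioo fun t ht => ?_
            have : ∀ y, a x t * a y t * ‖g' t‖ₑ ^ 2 = a x t * ‖g' t‖ₑ ^ 2 * a y t := fun y => by
              ring
            simp only [this]
            rw [lintegral_const_mul _ (hat t), mul_comm]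
            gcongr
            exact haK t ht
    calc _ ≤ ∫⁻ x, ∫⁻ t, K * (a x t * ‖g' t‖ₑ ^ 2) ∂ν ∂ν :=
          setLIntegral_mono' measurableSet_Ioo hinner
      _ = ∫⁻ t, ∫⁻ x, K * (a x t * ‖g' t‖ₑ ^ 2) ∂ν ∂ν := by
          refine lintegral_lintegral_swap ?_
          exact AEMeasurable.const_mul (ham.aemeasurable.mul hG.comp_snd) K
      _ ≤ ∫⁻ t, K ^ 2 * ‖g' t‖ₑ ^ 2 ∂ν := by
          refine setLIntegral_mono' measurableSet_Ioo fun t ht => ?_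
          have : ∀ x, K * (a x t * ‖g' t‖ₑ ^ 2) = K * ‖g' t‖ₑ ^ 2 * a x t := fun x => by ring
          simp only [this]
          rw [lintegral_const_mul _ (hat t)]
          calc _ ≤ K * ‖g' t‖ₑ ^ 2 * K := by gcongr; exact haK t ht
            _ = _ := by ring
      _ = _ := lintegral_const_mul' _ _ (by simp [hK])
  refine (ENNReal.rpow_le_rpow key (by norm_num)).trans ?_
  rw [ENNReal.mul_rpow_of_nonneg _ _ (by norm_num), sqrt_sq_ennreal]

end FractionalSeminorms

/-! ### Continuous representatives, seminorms of smooth functions, Taylor polynomials -/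

section SobolevFunctions

variable {ℓ s : ℝ} {f g : ℝ → Plane}

theorem seminorm_eq (h : IsWeakDeriv ℓ ⌊s⌋₊ f g) :
    seminorm ℓ s f = fracSeminorm ℓ (s - ⌊s⌋₊) g := by
  refine le_antisymm (iInf₂_le g h) (le_iInf₂ fun g' h' => ?_)
  rw [fracSeminorm_congr _ (h.unique h')]

theorem seminorm_natCast_eq {j : ℕ} (h : IsWeakDeriv ℓ j f g) :
    seminorm ℓ j f = eLpNorm g 2 (volume.restrict (Ioo 0 ℓ)) := by
  rw [seminorm_eq (g := g) (by simpa using h), Nat.floor_natCast, sub_self, fracSeminorm_zero]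

theorem exists_isWeakDeriv_of_seminorm_lt_top (h : seminorm ℓ s f < ⊤) :
    ∃ g, IsWeakDeriv ℓ ⌊s⌋₊ f g := by
  by_contra hne
  push Not at hne
  refine h.ne ?_
  rw [seminorm]
  simp [hne]

theorem seminorm_natCast_le_norm {j : ℕ} (hj : j ≤ ⌊s⌋₊) : seminorm ℓ j f ≤ norm ℓ s f := by
  rw [norm, ← sqrt_sq_ennreal (seminorm ℓ j f)]
  refine ENNReal.rpow_le_rpow ?_ (by norm_num)
  refine le_trans ?_ le_self_add
  exact Finset.single_le_sum (f := fun j : ℕ => seminorm ℓ (j : ℝ) f ^ 2) (fun _ _ => zero_le)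
    (Finset.mem_range.2 (by omega))

theorem seminorm_le_norm : seminorm ℓ s f ≤ norm ℓ s f := by
  by_cases hs : s = (⌊s⌋₊ : ℝ)
  · nth_rewrite 1 [hs]
    exact seminorm_natCast_le_norm le_rfl
  · rw [norm, if_neg hs]
    nth_rewrite 1 [← sqrt_sq_ennreal (seminorm ℓ s f)]
    exact ENNReal.rpow_le_rpow le_add_self (by norm_num)

/-- A function of `H^s(0, ℓ)` with its derivatives: all but the last are continuous. -/
theorem exists_representation (hℓ : 0 < ℓ) (h : norm ℓ s f < ⊤) :
    ∃ w : ℕ → ℝ → Plane, (∀ j ≤ ⌊s⌋₊, IsWeakDeriv ℓ j f (w j)) ∧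
      (∀ j ≤ ⌊s⌋₊, eLpNorm (w j) 2 (volume.restrict (Ioo 0 ℓ)) ≤ norm ℓ s f) ∧
      (∀ j < ⌊s⌋₊, ∀ x ∈ Icc 0 ℓ, w j x = w j 0 + ∫ y in (0 : ℝ)..x, w (j + 1) y) ∧
      fracSeminorm ℓ (s - ⌊s⌋₊) (w ⌊s⌋₊) ≤ norm ℓ s f := by
  set n := ⌊s⌋₊ with hn
  have hex : ∀ j, ∃ g, j ≤ n → IsWeakDeriv ℓ j f g := by
    intro j
    by_cases hj : j ≤ n
    · obtain ⟨g, hg⟩ := exists_isWeakDeriv_of_seminorm_lt_top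
        (s := (j : ℝ)) ((seminorm_natCast_le_norm hj).trans_lt h)
      exact ⟨g, fun _ => by simpa using hg⟩
    · exact ⟨0, fun h => absurd h hj⟩
  choose g hg using hex
  have hgL : ∀ j ≤ n, eLpNorm (g j) 2 (volume.restrict (Ioo 0 ℓ)) ≤ norm ℓ s f := fun j hj => by
    rw [← seminorm_natCast_eq (hg j hj)]
    exact seminorm_natCast_le_norm hj
  have hgm : ∀ j ≤ n, MemLp (g j) 2 (volume.restrict (Ioo 0 ℓ)) := fun j hj =>
    ⟨(hg j hj).2.1.aestronglyMeasurable, (hgL j hj).trans_lt h⟩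
  have hgi : ∀ j ≤ n, IntegrableOn (g j) (Ioo 0 ℓ) volume := fun j hj =>
    (hgm j hj).integrable (by norm_num)
  have hc : ∀ j, ∃ c, j < n → g j =ᵐ[volume.restrict (Ioo 0 ℓ)]
      fun x => c + ∫ y in (0 : ℝ)..x, g (j + 1) y := by
    intro j
    by_cases hj : j < n
    · obtain ⟨c, hc⟩ := ((hg j hj.le).one_of_succ (hg (j + 1) hj)).exists_primitive hℓ (hgi _ hj)
      exact ⟨c, fun _ => hc⟩
    · exact ⟨0, fun h => absurd h hj⟩
  choose c hc using hc
  -- Below order `n` each weak derivative is replaced by the primitive of the next one, so that its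
  -- values at points make sense; the last one stays an `L²` function.
  set w : ℕ → ℝ → Plane := fun j =>
    if j < n then fun x => c j + ∫ y in (0 : ℝ)..x, g (j + 1) y else g j with hw
  have hwg : ∀ j ≤ n, g j =ᵐ[volume.restrict (Ioo 0 ℓ)] w j := by
    intro j hj
    by_cases hj' : j < n
    · simp only [hw, if_pos hj']; exact hc j hj'
    · simp only [hw, if_neg hj']; exact Filter.EventuallyEq.rfl
  refine ⟨w, fun j hj => (hg j hj).congr Filter.EventuallyEq.rfl (hwg j hj), fun j hj => ?_,
    fun j hj x hx => ?_, ?_⟩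
  · rw [← eLpNorm_congr_ae (hwg j hj)]; exact hgL j hj
  · have h1 : ∫ y in (0 : ℝ)..x, w (j + 1) y = ∫ y in (0 : ℝ)..x, g (j + 1) y := by
      refine intervalIntegral.integral_congr_ae_restrict ?_
      exact ae_mono (restrict_uIoc_le (left_mem_Icc.2 hℓ.le) hx) (hwg (j + 1) hj).symm
    rw [h1]
    simp only [hw, if_pos hj, intervalIntegral.integral_same, add_zero]
  · rw [← fracSeminorm_congr _ (hwg n le_rfl), ← seminorm_eq (hg n le_rfl)]
    exact seminorm_le_norm

theorem IsJet.isWeakDeriv {N : ℕ} {U : ℕ → ℝ → Plane} (hU : IsJet N (Icc 0 ℓ) U) {j : ℕ}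
    (hj : j ≤ N) : IsWeakDeriv ℓ j (U 0) (U j) := by
  have hloc : ∀ j ≤ N, LocallyIntegrableOn (U j) (Ioo 0 ℓ) volume := fun j hj =>
    ((hU.continuousOn hj).mono Ioo_subset_Icc_self).locallyIntegrableOn measurableSet_Ioo
  induction j with
  | zero => exact isWeakDeriv_zero_self (hloc 0 hj)
  | succ j ih =>
    refine (ih (by omega)).trans_one (isWeakDeriv_primitive ?_ (U j 0) fun x hx => ?_)
    · exact ((hU.continuousOn hj).integrableOn_Icc).mono_set Ioo_subset_Icc_self
    · have hsub : Icc 0 x ⊆ Icc 0 ℓ := Icc_subset_Icc_right hx.2.le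
      rw [intervalIntegral.integral_eq_sub_of_hasDerivAt_of_le hx.1.le
        ((hU.continuousOn (by omega)).mono hsub)
        (fun y hy => (hU.hasDeriv j (by omega) y (hsub (Ioo_subset_Icc_self hy))).hasDerivAt
          (Filter.mem_of_superset (Icc_mem_nhds hy.1 hy.2) hsub))]
      · abel
      · refine ContinuousOn.intervalIntegrable ?_
        rw [uIcc_of_le hx.1.le]
        exact (hU.continuousOn hj).mono hsub

/-- The seminorm of order `i + μ` of a jet in terms of uniform bounds. -/
theorem IsJet.fracSeminorm_le {N : ℕ} {U : ℕ → ℝ → Plane} (hℓ : 0 < ℓ)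
    (hU : IsJet N (Icc 0 ℓ) U) {i : ℕ} {μ : ℝ} (hμ : 0 ≤ μ) (hμ1 : μ < 1) (hi : i + μ ≤ N)
    {B : ℝ} (hB : 0 ≤ B) (hUB : ∀ j ≤ N, ∀ x ∈ Icc 0 ℓ, ‖U j x‖ ≤ B * ℓ ^ (-(j : ℝ))) :
    fracSeminorm ℓ μ (U i) ≤ ENNReal.ofReal (2 / (1 - μ) * (B * ℓ ^ (1 / 2 - (i + μ)))) := by
  have hμ1' := sub_pos.2 hμ1
  have hL2 : ∀ j ≤ N, eLpNorm (U j) 2 (volume.restrict (Ioo 0 ℓ)) ≤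
      ENNReal.ofReal (B * ℓ ^ (1 / 2 - (j : ℝ))) := fun j hj => by
    refine (eLpNorm_le_of_norm_le hℓ.le
      fun x hx => hUB j hj x (Ioo_subset_Icc_self hx)).trans (le_of_eq ?_)
    congr 1
    rw [Real.sqrt_eq_rpow, sub_eq_add_neg, Real.rpow_add hℓ]
    ring
  rcases hμ.eq_or_lt with rfl | hμ0
  · rw [fracSeminorm_zero]
    have hi' : i ≤ N := by exact_mod_cast (by simpa using hi : (i : ℝ) ≤ N)
    refine (hL2 i hi').trans (ENNReal.ofReal_le_ofReal ?_)
    rw [add_zero]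
    have : 0 ≤ B * ℓ ^ (1 / 2 - (i : ℝ)) := by positivity
    linarith
  -- For `μ > 0` the condition `i + μ ≤ N` leaves one more derivative, so the embedding of `H¹`
  -- applies to `U i`.
  · have hi' : i < N := by
      have : (i : ℝ) < N := by linarith
      exact_mod_cast this
    have hd : ∀ x ∈ Ioo 0 ℓ, ∀ y ∈ Ioo 0 ℓ, U i x - U i y = ∫ t in y..x, U (i + 1) t := by
      intro x hx y hy
      have hsub : uIcc y x ⊆ Ioo 0 ℓ := by
        rw [uIcc]; exact Icc_subset_Ioo (lt_min hy.1 hx.1) (max_lt hy.2 hx.2)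
      refine (intervalIntegral.integral_eq_sub_of_hasDerivAt (fun t ht => ?_) ?_).symm
      · exact (hU.hasDeriv i hi' t (Ioo_subset_Icc_self (hsub ht))).hasDerivAt
          (Icc_mem_nhds (hsub ht).1 (hsub ht).2)
      · exact ((hU.continuousOn hi').mono
          (hsub.trans Ioo_subset_Icc_self)).intervalIntegrable
    refine (fracSeminorm_le_eLpNorm_deriv hℓ hμ0 hμ1 ?_ hd).trans ?_
    · exact ((hU.continuousOn hi').mono Ioo_subset_Icc_self).aestronglyMeasurable measurableSet_Ioo
    · refine (mul_le_mul_right (hL2 (i + 1) hi') _).trans (le_of_eq ?_)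
      rw [← ENNReal.ofReal_mul (by positivity)]
      congr 1
      have e : 1 / 2 - ((i : ℝ) + μ) = (1 - μ) + (1 / 2 - ((i + 1 : ℕ) : ℝ)) := by push_cast; ring
      rw [e, Real.rpow_add hℓ]
      ring

/-- The polynomial with `j`-th derivative `c j` at the origin, and its derivatives. -/
def taylorJet (n : ℕ) (c : ℕ → Plane) (j : ℕ) (x : ℝ) : Plane :=
  ∑ i ∈ Finset.range (n + 1), (x ^ i / i.factorial) • c (i + j)

theorem taylorJet_zero (n : ℕ) (c : ℕ → Plane) (j : ℕ) : taylorJet n c j 0 = c j := by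
  rw [taylorJet, Finset.sum_range_succ']
  simp

/-- Every order uses the same range of summation with shifted coefficients. Differentiation loses
one term, and the missing last one has the coefficient `c (n + (j + 1)) = 0`. -/
theorem hasDerivAt_taylorJet {n : ℕ} {c : ℕ → Plane} (hc : ∀ i, n < i → c i = 0) (j : ℕ) (x : ℝ) :
    HasDerivAt (taylorJet n c j) (taylorJet n c (j + 1) x) x := by
  have h : HasDerivAt (fun x : ℝ => ∑ i ∈ Finset.range n,
      (x ^ (i + 1) / (i + 1).factorial) • c (i + 1 + j) + (x ^ 0 / Nat.factorial 0 : ℝ) • c (0 + j))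
      (∑ i ∈ Finset.range n, (x ^ i / i.factorial) • c (i + 1 + j)) x := by
    simp only [pow_zero]
    refine (HasDerivAt.fun_sum fun i _ => ?_).add_const _
    refine HasDerivAt.smul_const ?_ _
    have := (hasDerivAt_pow (i + 1) x).div_const ((i + 1).factorial : ℝ)
    convert! this using 1
    rw [Nat.factorial_succ]
    push_cast
    have : (i.factorial : ℝ) ≠ 0 := by positivity
    have h2 : (i : ℝ) + 1 ≠ 0 := by positivity
    field_simp
  have e1 : taylorJet n c j = fun x : ℝ => ∑ i ∈ Finset.range n,
      (x ^ (i + 1) / (i + 1).factorial) • c (i + 1 + j) +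
        (x ^ 0 / Nat.factorial 0 : ℝ) • c (0 + j) := by
    funext x
    rw [taylorJet, Finset.sum_range_succ']
  have e2 : taylorJet n c (j + 1) x =
      ∑ i ∈ Finset.range n, (x ^ i / i.factorial) • c (i + 1 + j) := by
    rw [taylorJet, Finset.sum_range_succ, hc (n + (j + 1)) (by omega), smul_zero, add_zero]
    refine Finset.sum_congr rfl fun i _ => ?_
    congr 2
    omega
  rw [e1, e2]
  exact h

theorem norm_taylorJet_le {n : ℕ} {c : ℕ → Plane} {A H : ℝ} (hA : ∀ i, ‖c i‖ ≤ A) (hH : 1 ≤ H)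
    (j : ℕ) {x : ℝ} (hx : x ∈ Icc 0 H) : ‖taylorJet n c j x‖ ≤ (n + 1) * H ^ n * A := by
  have hA0 : 0 ≤ A := (norm_nonneg _).trans (hA 0)
  refine (norm_sum_le_of_le (f := fun i => (x ^ i / i.factorial) • c (i + j))
    (n := fun _ => H ^ n * A) _ fun i hi => ?_).trans (le_of_eq ?_)
  · rw [norm_smul, Real.norm_of_nonneg (div_nonneg (pow_nonneg hx.1 i) (by positivity))]
    have h1 : x ^ i / i.factorial ≤ H ^ n := by
      refine (div_le_self (pow_nonneg hx.1 i) (by exact_mod_cast i.factorial_pos)).trans ?_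
      refine (pow_le_pow_left₀ hx.1 hx.2 i).trans (pow_le_pow_right₀ hH ?_)
      have := Finset.mem_range.1 hi
      omega
    exact mul_le_mul h1 (hA _) (norm_nonneg _) (by positivity)
  · simp; ring

end SobolevFunctions

/-! ### Polynomial part and remainder of a Sobolev function -/

section Decomposition

variable {ℓ : ℝ}

/-- A primitive chain `r` with `r j 0 = 0` is controlled by its last term. -/
theorem eLpNorm_primitive_chain_le (hℓ : 0 < ℓ) {n : ℕ} {r : ℕ → ℝ → Plane} {K : ℝ} (hK : 0 ≤ K)
    (hrm : ∀ j ≤ n, AEStronglyMeasurable (r j) (volume.restrict (Ioo 0 ℓ)))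
    (hr : ∀ j < n, ∀ x ∈ Icc 0 ℓ, r j x = ∫ y in (0 : ℝ)..x, r (j + 1) y)
    (hrn : eLpNorm (r n) 2 (volume.restrict (Ioo 0 ℓ)) ≤ ENNReal.ofReal K) {j : ℕ} (hj : j ≤ n) :
    eLpNorm (r j) 2 (volume.restrict (Ioo 0 ℓ)) ≤ ENNReal.ofReal (ℓ ^ (n - j) * K) := by
  obtain ⟨i, rfl⟩ : ∃ i, n = j + i := ⟨n - j, by omega⟩
  induction i generalizing j with
  | zero => simpa using hrn
  | succ i ih =>
    have h1 := ih (j := j + 1) (by rwa [show j + 1 + i = j + (i + 1) by omega])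
      (by rwa [show j + 1 + i = j + (i + 1) by omega])
      (by rwa [show j + 1 + i = j + (i + 1) by omega]) (by omega)
    rw [show j + 1 + i - (j + 1) = i by omega] at h1
    refine (eLpNorm_le_of_norm_le hℓ.le (K := √ℓ * (ℓ ^ i * K)) fun x hx => ?_).trans
      (le_of_eq ?_)
    · rw [hr j (by omega) x (Ioo_subset_Icc_self hx)]
      exact norm_intervalIntegral_le hℓ.le (hrm (j + 1) (by omega)) (by positivity) h1
        (left_mem_Icc.2 hℓ.le) (Ioo_subset_Icc_self hx)
    · congr 1
      rw [show j + (i + 1) - j = i + 1 by omega, ← mul_assoc, Real.mul_self_sqrt hℓ.le, pow_succ]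
      ring

theorem norm_le_of_eLpNorm_const_le (hℓ : 0 < ℓ) {c : Plane} {K : ℝ} (hK : 0 ≤ K)
    (h : eLpNorm (fun _ : ℝ => c) 2 (volume.restrict (Ioo 0 ℓ)) ≤ ENNReal.ofReal K) :
    ‖c‖ ≤ K * ℓ ^ (-(1 / 2) : ℝ) := by
  have hv : volume.restrict (Ioo 0 ℓ) ≠ 0 := by
    rw [Ne, Measure.restrict_eq_zero]
    simpa using hℓ
  rw [eLpNorm_const c (by norm_num) hv, Measure.restrict_apply_univ, Real.volume_Ioo, sub_zero,
    ENNReal.ofReal_rpow_of_pos hℓ, ← ofReal_norm, ← ENNReal.ofReal_mul (norm_nonneg _),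
    ENNReal.ofReal_le_ofReal_iff hK] at h
  rw [Real.rpow_neg hℓ.le, ← div_eq_mul_inv, le_div_iff₀ (by positivity)]
  simpa using h

/-- Splitting of an `H^{n + θ}` function into a polynomial and a remainder. -/
theorem exists_decomposition {n : ℕ} {θ N H : ℝ} (hℓ : 0 < ℓ) (hℓH : ℓ ≤ H) (hH : 1 ≤ H)
    (hn : 1 ≤ n) (hθ : 0 ≤ θ) (hθ1 : θ < 1) (hN : 0 ≤ N) {w : ℕ → ℝ → Plane}
    (hwm : ∀ j ≤ n, AEStronglyMeasurable (w j) (volume.restrict (Ioo 0 ℓ)))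
    (hwN : ∀ j ≤ n, eLpNorm (w j) 2 (volume.restrict (Ioo 0 ℓ)) ≤ ENNReal.ofReal N)
    (hw : ∀ j < n, ∀ x ∈ Icc 0 ℓ, w j x = w j 0 + ∫ y in (0 : ℝ)..x, w (j + 1) y)
    (hfr : fracSeminorm ℓ θ (w n) ≤ ENNReal.ofReal N) :
    ∃ T : ℕ → ℝ → Plane, (∀ j x, HasDerivAt (T j) (T (j + 1) x) x) ∧
      (∀ j, ∀ x ∈ Icc 0 ℓ, ‖T j x‖ ≤ (n + 1) * H ^ n * (1 + H) * (N * ℓ ^ (-(1 / 2) : ℝ))) ∧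
      (∀ x ∈ Icc 0 ℓ, ‖w 0 x - T 0 x‖ ≤ N * ℓ ^ (n + θ - 1 / 2)) ∧
      ∀ (i : ℕ) (μ : ℝ), 0 ≤ μ → μ < 1 → i + μ ≤ n + θ →
        fracSeminorm ℓ μ (w i - T i) ≤
          ENNReal.ofReal (2 / (1 - μ) * (N * ℓ ^ (n + θ - (i + μ)))) := by
  set ν := volume.restrict (Ioo 0 ℓ) with hν
  have hwi : ∀ j ≤ n, IntegrableOn (w j) (Ioo 0 ℓ) volume := fun j hj =>
    MemLp.integrable (q := 2) (by norm_num)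
      ⟨hwm j hj, (hwN j hj).trans_lt ENNReal.ofReal_lt_top⟩
  -- The top coefficient. For `θ = 0` nothing is to be gained and it is zero; for `θ > 0` the mean
  -- of `w n` lets Poincaré's inequality gain `ℓ ^ θ`. The lower coefficients are values at the
  -- origin, so that the remainders vanish there and are successive primitives.
  set M : Plane := if θ = 0 then 0 else ℓ⁻¹ • ∫ y in Ioo 0 ℓ, w n y with hM
  set c : ℕ → Plane := fun j => if j < n then w j 0 else if j = n then M else 0 with hc
  have hc0 : ∀ i, n < i → c i = 0 := fun i hi => by
    simp only [hc, if_neg (show ¬ i < n by omega), if_neg (show ¬ i = n by omega)]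
  have hcn : c n = M := by simp [hc]
  set T := taylorJet n c with hT
  have hTd : ∀ j x, HasDerivAt (T j) (T (j + 1) x) x := hasDerivAt_taylorJet hc0
  have hTc : ∀ j, Continuous (T j) := fun j =>
    continuous_iff_continuousAt.2 fun x => (hTd j x).continuousAt
  have hTn : ∀ x, T n x = M := by
    intro x
    rw [hT, taylorJet, Finset.sum_range_succ', Finset.sum_eq_zero, zero_add]
    · simp [hcn]
    · intro i _
      rw [hc0 _ (by omega), smul_zero]
  set r : ℕ → ℝ → Plane := fun j => w j - T j with hr
  have hrm : ∀ j ≤ n, AEStronglyMeasurable (r j) ν := fun j hj =>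
    (hwm j hj).sub (hTc j).aestronglyMeasurable
  have hrc : ∀ j < n, ∀ x ∈ Icc 0 ℓ, r j x = ∫ y in (0 : ℝ)..x, r (j + 1) y := by
    intro j hj x hx
    have hwii : IntervalIntegrable (w (j + 1)) volume 0 x :=
      intervalIntegrable_iff.2 (Integrable.mono_measure (hwi (j + 1) hj)
        (restrict_uIoc_le (left_mem_Icc.2 hℓ.le) hx))
    simp only [hr, Pi.sub_apply]
    rw [intervalIntegral.integral_sub hwii ((hTc _).intervalIntegrable _ _),
      intervalIntegral.integral_eq_sub_of_hasDerivAt (fun y _ => hTd j y)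
        ((hTc _).intervalIntegrable _ _), hw j hj x hx]
    have : T j 0 = w j 0 := by
      rw [hT, taylorJet_zero]; simp [hc, hj]
    rw [this]
    abel
  have hrn : eLpNorm (r n) 2 ν ≤ ENNReal.ofReal (ℓ ^ θ * N) := by
    have e : r n = fun x => w n x - M := by
      funext x; simp [hr, hTn]
    rw [e]
    rcases eq_or_ne θ 0 with h0 | h0
    · simp only [hM, h0, if_true, sub_zero, Real.rpow_zero, one_mul]
      exact hwN n le_rfl
    · simp only [hM, if_neg h0]
      refine (eLpNorm_sub_mean_le hℓ (lt_of_le_of_ne hθ (Ne.symm h0)) (hwi n le_rfl)).trans ?_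
      rw [ENNReal.ofReal_mul (by positivity)]
      gcongr
  have hrj : ∀ j ≤ n, eLpNorm (r j) 2 ν ≤ ENNReal.ofReal (N * ℓ ^ (n + θ - j)) := by
    intro j hj
    refine (eLpNorm_primitive_chain_le hℓ (by positivity) hrm hrc hrn hj).trans (le_of_eq ?_)
    congr 1
    have : (n : ℝ) + θ - j = ((n - j : ℕ) : ℝ) + θ := by
      rw [Nat.cast_sub hj]; ring
    rw [this, Real.rpow_add hℓ, Real.rpow_natCast]
    ring
  refine ⟨T, hTd, ?_, ?_, ?_⟩
  -- For `i < n` the constant `w i 0` is `w i` minus a primitive, so its `L²` norm is at most `(1 +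
  -- ℓ) N`. Since a constant `c` has `L²` norm `‖c‖ ℓ ^ (1/2)`, the factor `ℓ ^ (-1/2)` appears.
  · have hcA : ∀ i, ‖c i‖ ≤ (1 + H) * (N * ℓ ^ (-(1 / 2) : ℝ)) := by
      intro i
      have hpos : 0 ≤ N * ℓ ^ (-(1 / 2) : ℝ) := by positivity
      rcases lt_trichotomy i n with hi | rfl | hi
      · have hci : c i = w i 0 := by simp only [hc, if_pos hi]
        rw [hci]
        set G : ℝ → Plane := fun x => ∫ y in (0 : ℝ)..x, w (i + 1) y with hG
        have hGb : ∀ x ∈ Ioo 0 ℓ, ‖G x‖ ≤ √ℓ * N := fun x hx =>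
          norm_intervalIntegral_le hℓ.le (hwm _ hi) hN (hwN _ hi) (left_mem_Icc.2 hℓ.le)
            (Ioo_subset_Icc_self hx)
        have hGm : AEStronglyMeasurable G ν :=
          ((continuousOn_primitive_Icc hℓ.le (hwi _ hi)).mono
            Ioo_subset_Icc_self).aestronglyMeasurable measurableSet_Ioo
        have hGL := eLpNorm_le_of_norm_le hℓ.le hGb
        have e : (fun _ : ℝ => w i 0) =ᵐ[ν] w i - G := by
          refine (ae_restrict_iff' measurableSet_Ioo).2 (Filter.Eventually.of_forall fun x hx => ?_)
          simp only [Pi.sub_apply, hG]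
          rw [hw i hi x (Ioo_subset_Icc_self hx), add_sub_cancel_right]
        have := norm_le_of_eLpNorm_const_le (c := w i 0) hℓ (K := N + √ℓ * (√ℓ * N))
          (by positivity) (by
            rw [eLpNorm_congr_ae e, ENNReal.ofReal_add hN (by positivity)]
            exact (eLpNorm_sub_le (hwm i hi.le) hGm (by norm_num)).trans
              (add_le_add (hwN i hi.le) hGL))
        refine this.trans ?_
        rw [← mul_assoc √ℓ, Real.mul_self_sqrt hℓ.le]
        have : (N + ℓ * N) * ℓ ^ (-(1 / 2) : ℝ) = (1 + ℓ) * (N * ℓ ^ (-(1 / 2) : ℝ)) := by ring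
        rw [this]
        gcongr
      · rw [hcn, hM]
        split_ifs with h0
        · rw [norm_zero]; positivity
        · rw [← integral_Ioc_eq_integral_Ioo, ← intervalIntegral.integral_of_le hℓ.le, norm_smul,
            Real.norm_of_nonneg (by positivity)]
          have h1 := norm_intervalIntegral_le hℓ.le (hwm _ le_rfl) hN (hwN _ le_rfl)
            (left_mem_Icc.2 hℓ.le) (right_mem_Icc.2 hℓ.le)
          calc _ ≤ ℓ⁻¹ * (√ℓ * N) := by gcongr
            _ = N * ℓ ^ (-(1 / 2) : ℝ) := by
              have : (-(1 / 2) : ℝ) = -1 + 1 / 2 := by norm_num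
              rw [this, Real.rpow_add hℓ, Real.rpow_neg_one, Real.sqrt_eq_rpow]
              ring
            _ ≤ _ := le_mul_of_one_le_left hpos (by linarith)
      · rw [hc0 i hi, norm_zero]; positivity
    intro j x hx
    refine (norm_taylorJet_le hcA hH j ⟨hx.1, hx.2.trans hℓH⟩).trans (le_of_eq ?_)
    ring
  · intro x hx
    have h1 : w 0 x - T 0 x = r 0 x := rfl
    rw [h1, hrc 0 hn x hx]
    refine (norm_intervalIntegral_le hℓ.le (hrm 1 hn) (by positivity) (hrj 1 hn)
      (left_mem_Icc.2 hℓ.le) hx).trans (le_of_eq ?_)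
    have : (n : ℝ) + θ - 1 / 2 = 1 / 2 + (n + θ - (1 : ℕ)) := by push_cast; ring
    rw [this, Real.rpow_add hℓ, Real.sqrt_eq_rpow]
    ring
  · intro i μ hμ hμ1 hiμ
    have hμ1' := sub_pos.2 hμ1
    have hi : i ≤ n := by
      have : (i : ℝ) < n + 1 := by linarith
      have : i < n + 1 := by exact_mod_cast this
      omega
    have h2 : (1 : ℝ) ≤ 2 / (1 - μ) := by rw [le_div_iff₀ hμ1']; linarith
    change fracSeminorm ℓ μ (r i) ≤ _
    rcases hμ.eq_or_lt with rfl | hμ0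
    · rw [fracSeminorm_zero]
      refine (hrj i hi).trans (ENNReal.ofReal_le_ofReal ?_)
      rw [add_zero]
      exact le_mul_of_one_le_left (by positivity) h2
    rcases hi.lt_or_eq with hi | rfl
    · refine (fracSeminorm_le_eLpNorm_deriv (g' := r (i + 1)) hℓ hμ0 hμ1 (hrm _ hi)
        fun x hx y hy => ?_).trans ?_
      · rw [hrc i hi x (Ioo_subset_Icc_self hx), hrc i hi y (Ioo_subset_Icc_self hy)]
        have hri : IntegrableOn (r (i + 1)) (Ioo 0 ℓ) volume :=
          MemLp.integrable (q := 2) (by norm_num)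
            ⟨hrm _ hi, (hrj _ hi).trans_lt ENNReal.ofReal_lt_top⟩
        have hii : ∀ z ∈ Ioo 0 ℓ, IntervalIntegrable (r (i + 1)) volume 0 z := fun z hz =>
          intervalIntegrable_iff.2 (Integrable.mono_measure hri
            (restrict_uIoc_le (left_mem_Icc.2 hℓ.le) (Ioo_subset_Icc_self hz)))
        exact intervalIntegral.integral_interval_sub_left (hii x hx) (hii y hy)
      · refine (mul_le_mul_right (hrj (i + 1) hi) _).trans (le_of_eq ?_)
        rw [← ENNReal.ofReal_mul (by positivity)]
        congr 1
        have e : (n : ℝ) + θ - (i + μ) = (1 - μ) + (n + θ - ((i + 1 : ℕ) : ℝ)) := by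
          push_cast; ring
        rw [e, Real.rpow_add hℓ]
        ring
    -- At the top order `T i` is the constant `M`, which the double integral does not see; only the
    -- order is lowered from `θ` to `μ`.
    · have hμθ : μ ≤ θ := by linarith
      have e : fracSeminorm ℓ θ (r i) = fracSeminorm ℓ θ (w i) := by
        have h0 : θ ≠ 0 := (hμ0.trans_le hμθ).ne'
        rw [fracSeminorm_of_ne h0, fracSeminorm_of_ne h0]
        simp [slobIntegrand, hr, hTn]
      refine (fracSeminorm_le_of_le hℓ hμ0 hμθ).trans ?_
      rw [e]
      calc _ ≤ ENNReal.ofReal (ℓ ^ (θ - μ)) * ENNReal.ofReal N := by gcongr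
        _ = ENNReal.ofReal (N * ℓ ^ (i + θ - (i + μ))) := by
          rw [← ENNReal.ofReal_mul (by positivity)]
          congr 1
          rw [mul_comm]
          congr 2
          ring
        _ ≤ _ := ENNReal.ofReal_le_ofReal (le_mul_of_one_le_left (by positivity) h2)

end Decomposition

/-! ### Arc length, its inverse, and the chord-arc inequality -/

section Geometry

/-- A regular curve with its arc length `S 0`, the inverse `T 0` of the arc length, the
derivatives of these functions and uniform bounds. -/
structure ArcLengthData (k : ℕ) (L : ℝ) (γ : ℝ → Plane) where
  S : ℕ → ℝ → ℝ
  T : ℕ → ℝ → ℝ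
  G : ℕ → ℝ → Plane
  c : ℝ
  D : ℝ
  c_pos : 0 < c
  one_le_D : 1 ≤ D
  G_zero : G 0 = γ
  jet_G : IsJet (k + 1) (Icc 0 L) G
  jet_S : IsJet (k + 1) (Icc 0 L) S
  S_zero : S 0 0 = 0
  jet_T : IsJet (k + 1) (Icc 0 (S 0 L)) T
  T_S : ∀ t, T 0 (S 0 t) = t
  S_T : ∀ t, S 0 (T 0 t) = t
  strictMono_S : StrictMono (S 0)
  arcLength_eq : ∀ a b t, 0 ≤ a → a < b → b ≤ L → t ∈ Icc a b →
    arcLength γ a b t = S 0 t - S 0 a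
  G_le : ∀ j ≤ k + 1, ∀ t ∈ Icc 0 L, ‖G j t‖ ≤ D
  S_le : ∀ j ≤ k + 1, ∀ t ∈ Icc 0 L, |S j t| ≤ D
  T_le : ∀ j ≤ k + 1, ∀ t ∈ Icc 0 (S 0 L), |T j t| ≤ D
  S_sub_le : ∀ x y, x ≤ y → S 0 y - S 0 x ≤ D * (y - x)
  le_S_sub : ∀ x y, x ≤ y → c * (y - x) ≤ S 0 y - S 0 x
  chord : ∀ x y, 0 ≤ x → x ≤ y → y ≤ L → c * (y - x) ≤ ‖γ y - γ x‖

theorem IsJet.exists_bound {E : Type*} [NormedAddCommGroup E] [NormedSpace ℝ E] {N : ℕ} {a b : ℝ}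
    {F : ℕ → ℝ → E} (h : IsJet N (Icc a b) F) :
    ∃ C, 0 ≤ C ∧ ∀ j ≤ N, ∀ t ∈ Icc a b, ‖F j t‖ ≤ C := by
  have : ∀ j, ∃ C, 0 ≤ C ∧ (j ≤ N → ∀ t ∈ Icc a b, ‖F j t‖ ≤ C) := by
    intro j
    by_cases hj : j ≤ N
    · obtain ⟨C, hC⟩ := isCompact_Icc.exists_bound_of_continuousOn (h.continuousOn hj)
      exact ⟨max C 0, le_max_right _ _, fun _ t ht => (hC t ht).trans (le_max_left _ _)⟩
    · exact ⟨0, le_rfl, fun h => absurd h hj⟩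
  choose C hC0 hC using this
  refine ⟨∑ j ∈ Finset.range (N + 1), C j, Finset.sum_nonneg fun j _ => hC0 j,
    fun j hj t ht => (hC j hj t ht).trans ?_⟩
  exact Finset.single_le_sum (fun j _ => hC0 j) (Finset.mem_range.2 (by omega))

/-- Two regimes. For parameters closer than `η`, uniform continuity keeps `γ'` within `c₀ / 2` of
`γ' x`, where `c₀` is the minimal speed, so the chord is at least `c₀ / 2` times `y - x`. For
parameters at least `η` apart, injectivity and compactness give a positive minimal chord `m`, and `y
- x ≤ L`. -/
theorem IsRegularParam.exists_chord_le {k : ℕ} {L : ℝ} (hL : 0 < L) {γ : ℝ → Plane}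
    (hγ : IsRegularParam (k + 1) L γ) :
    ∃ c > 0, ∀ x y, 0 ≤ x → x ≤ y → y ≤ L → c * (y - x) ≤ ‖γ y - γ x‖ := by
  have hu := uniqueDiffOn_Icc hL
  have hjet := hγ.contDiffOn.isJet hu
  have hcont : ContinuousOn γ (Icc 0 L) := hγ.contDiffOn.continuousOn
  set γ' := derivWithin γ (Icc 0 L) with hγ'
  have hd : ∀ x ∈ Icc 0 L, HasDerivWithinAt γ (γ' x) (Icc 0 L) x := fun x hx => by
    exact (hγ.contDiffOn.differentiableOn (by simp) x hx).hasDerivWithinAt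
  have hγ'c : ContinuousOn γ' (Icc 0 L) := by
    have := hjet.continuousOn (j := 1) (by omega)
    simpa [iteratedDerivWithin_one] using this
  obtain ⟨t₀, ht₀, hmin⟩ := isCompact_Icc.exists_isMinOn (nonempty_Icc.2 hL.le) hγ'c.norm
  set c₀ := ‖γ' t₀‖
  have hc₀ : 0 < c₀ := norm_pos_iff.2 (hγ.deriv_ne_zero t₀ ht₀)
  have huc := isCompact_Icc.uniformContinuousOn_of_continuous hγ'c
  obtain ⟨η, hη, hη'⟩ := Metric.uniformContinuousOn_iff.1 huc (c₀ / 2) (by positivity)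
  have hnear : ∀ x y, 0 ≤ x → x ≤ y → y ≤ L → y - x < η → c₀ / 2 * (y - x) ≤ ‖γ y - γ x‖ := by
    intro x y hx hxy hy hlt
    have hsub : Icc x y ⊆ Icc 0 L := Icc_subset_Icc hx hy
    have hxm : x ∈ Icc 0 L := ⟨hx, hxy.trans hy⟩
    have := (convex_Icc x y).norm_image_sub_le_of_norm_hasDerivWithin_le
      (f := fun t => γ t - t • γ' x) (f' := fun t => γ' t - (1 : ℝ) • γ' x) (C := c₀ / 2)
      (fun t ht => ((hd t (hsub ht)).mono hsub).sub
        ((hasDerivWithinAt_id t _).smul_const (γ' x)))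
      (fun t ht => by
        rw [one_smul, ← dist_eq_norm]
        refine (hη' t (hsub ht) x hxm ?_).le
        rw [Real.dist_eq, abs_of_nonneg (by linarith [ht.1])]
        linarith [ht.2]) (left_mem_Icc.2 hxy) (right_mem_Icc.2 hxy)
    have e : γ y - y • γ' x - (γ x - x • γ' x) = (γ y - γ x) - (y - x) • γ' x := by
      rw [sub_smul]; abel
    rw [e, Real.norm_of_nonneg (by linarith)] at this
    have h2 : ‖(y - x) • γ' x‖ ≤ ‖γ y - γ x‖ + ‖(γ y - γ x) - (y - x) • γ' x‖ := by
      have := norm_sub_le (γ y - γ x) ((γ y - γ x) - (y - x) • γ' x)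
      rwa [sub_sub_cancel] at this
    rw [norm_smul, Real.norm_of_nonneg (by linarith)] at h2
    have h3 : c₀ ≤ ‖γ' x‖ := hmin hxm
    nlinarith [mul_le_mul_of_nonneg_left h3 (show 0 ≤ y - x by linarith)]
  set K : Set (ℝ × ℝ) := (Icc 0 L ×ˢ Icc 0 L) ∩ {z | η ≤ z.2 - z.1} with hK
  have hKc : IsCompact K := (isCompact_Icc.prod isCompact_Icc).inter_right
    (isClosed_le continuous_const (continuous_snd.sub continuous_fst))
  obtain ⟨m, hm, hfar⟩ : ∃ m > 0, ∀ z ∈ K, m ≤ ‖γ z.2 - γ z.1‖ := by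
    rcases K.eq_empty_or_nonempty with h | h
    · exact ⟨1, one_pos, fun z hz => by simp [h] at hz⟩
    · have hc : ContinuousOn (fun z : ℝ × ℝ => ‖γ z.2 - γ z.1‖) K :=
        ((hcont.comp continuousOn_snd fun z hz => hz.1.2).sub
          (hcont.comp continuousOn_fst fun z hz => hz.1.1)).norm
      obtain ⟨z, hz, hzmin⟩ := hKc.exists_isMinOn h hc
      refine ⟨_, norm_pos_iff.2 (sub_ne_zero.2 fun h => ?_), fun w hw => hzmin hw⟩
      have := hγ.injOn hz.1.2 hz.1.1 h
      have h2 : η ≤ z.2 - z.1 := hz.2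
      linarith
  refine ⟨min (c₀ / 2) (m / L), by positivity, fun x y hx hxy hy => ?_⟩
  rcases lt_or_ge (y - x) η with h | h
  · exact (mul_le_mul_of_nonneg_right (min_le_left _ _) (by linarith)).trans
      (hnear x y hx hxy hy h)
  · refine le_trans ?_ (hfar (x, y) ⟨⟨⟨hx, hxy.trans hy⟩, ⟨hx.trans hxy, hy⟩⟩, h⟩)
    calc _ ≤ m / L * L := by
          have : y - x ≤ L := by linarith
          exact mul_le_mul (min_le_right _ _) this (by linarith) (by positivity)
      _ = m := by field_simp

theorem IsRegularParam.nonempty_arcLengthData {k : ℕ} {L : ℝ} (hL : 0 < L) {γ : ℝ → Plane}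
    (hγ : IsRegularParam (k + 1) L γ) : Nonempty (ArcLengthData k L γ) := by
  have hu := uniqueDiffOn_Icc hL
  have hjet := hγ.contDiffOn.isJet hu
  obtain ⟨cc, hcc, hchord⟩ := hγ.exists_chord_le hL
  set γ' := derivWithin γ (Icc 0 L) with hγ'
  have hγ's : ContDiffOn ℝ k γ' (Icc 0 L) :=
    ((contDiffOn_succ_iff_derivWithin hu).1 (by exact_mod_cast hγ.contDiffOn)).2.2
  set v : ℝ → ℝ := fun t => ‖γ' t‖ with hv
  have hvs : ContDiffOn ℝ k v (Icc 0 L) := hγ's.norm ℝ hγ.deriv_ne_zero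
  have hvc : ContinuousOn v (Icc 0 L) := hvs.continuousOn
  obtain ⟨t₀, ht₀, hmin⟩ := isCompact_Icc.exists_isMinOn (nonempty_Icc.2 hL.le) hvc
  obtain ⟨t₁, ht₁, hmax⟩ := isCompact_Icc.exists_isMaxOn (nonempty_Icc.2 hL.le) hvc
  have hc₀ : 0 < v t₀ := norm_pos_iff.2 (hγ.deriv_ne_zero t₀ ht₀)
  -- The speed is extended by its end values, so that `S` becomes an increasing bijection of `ℝ`;
  -- the identities between `S` and its inverse then hold without conditions on the argument.
  set ve : ℝ → ℝ := IccExtend hL.le ((Icc 0 L).domRestrict v) with hve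
  have hvec : Continuous ve := (continuousOn_iff_continuous_domRestrict.1 hvc).Icc_extend'
  have hveq : ∀ t ∈ Icc 0 L, ve t = v t := fun t ht => IccExtend_of_mem hL.le _ ht
  have hve0 : ∀ t, v t₀ ≤ ve t := fun t => hmin (projIcc 0 L hL.le t).2
  have hve1 : ∀ t, ve t ≤ v t₁ := fun t => hmax (projIcc 0 L hL.le t).2
  set S : ℝ → ℝ := fun t => ∫ τ in (0 : ℝ)..t, ve τ with hS
  have hSd : ∀ t, HasDerivAt S (ve t) t := fun t =>
    intervalIntegral.integral_hasDerivAt_right (hvec.intervalIntegrable _ _)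
      (hvec.stronglyMeasurableAtFilter _ _) hvec.continuousAt
  have hSsub : ∀ x y, S y - S x = ∫ τ in x..y, ve τ := fun x y =>
    intervalIntegral.integral_interval_sub_left (hvec.intervalIntegrable _ _)
      (hvec.intervalIntegrable _ _)
  have hSlow : ∀ x y, x ≤ y → v t₀ * (y - x) ≤ S y - S x := fun x y hxy => by
    rw [hSsub]
    have := intervalIntegral.integral_mono_on (μ := volume) hxy
      (intervalIntegrable_const (c := v t₀)) (hvec.intervalIntegrable _ _) fun t _ => hve0 t
    simpa [mul_comm] using this
  have hSup : ∀ x y, x ≤ y → S y - S x ≤ v t₁ * (y - x) := fun x y hxy => by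
    rw [hSsub]
    have := intervalIntegral.integral_mono_on (μ := volume) hxy (hvec.intervalIntegrable _ _)
      (intervalIntegrable_const (c := v t₁)) fun t _ => hve1 t
    simpa [mul_comm] using this
  have hSmono : StrictMono S := fun x y hxy => by
    have := hSlow x y hxy.le
    have : 0 < v t₀ * (y - x) := mul_pos hc₀ (by linarith)
    linarith
  have hS0 : S 0 = 0 := by simp [hS]
  have hScont : Continuous S := continuous_iff_continuousAt.2 fun t => (hSd t).continuousAt
  have hSsurj : Function.Surjective S := by
    refine hScont.surjective ?_ ?_
    · refine Filter.tendsto_atTop_mono' _ ?_ (Filter.tendsto_id.const_mul_atTop hc₀)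
      filter_upwards [Filter.eventually_ge_atTop 0] with t ht
      have := hSlow 0 t ht
      rw [hS0] at this
      simpa using this
    · refine Filter.tendsto_atBot_mono' _ ?_ (Filter.tendsto_id.const_mul_atBot hc₀)
      filter_upwards [Filter.eventually_le_atBot 0] with t ht
      have := hSlow t 0 ht
      rw [hS0] at this
      simp only [id]
      linarith
  set e := hSmono.orderIsoOfSurjective S hSsurj with he
  set T : ℝ → ℝ := fun σ => e.symm σ with hT
  have hTS : ∀ t, T (S t) = t := fun t => e.symm_apply_apply t
  have hST : ∀ t, S (T t) = t := fun t => e.apply_symm_apply t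
  have hTcont : Continuous T := e.symm.continuous
  have hTd : ∀ σ, HasDerivAt T (ve (T σ))⁻¹ σ := fun σ =>
    HasDerivAt.of_local_left_inverse hTcont.continuousAt (hSd (T σ))
      (hc₀.trans_le (hve0 _)).ne' (Filter.Eventually.of_forall hST)
  have hSL : 0 < S L := by rw [← hS0]; exact hSmono hL
  have huJ := uniqueDiffOn_Icc hSL
  have hmaps : MapsTo T (Icc 0 (S L)) (Icc 0 L) := fun σ hσ => by
    rw [← hST σ, ← hS0] at hσ
    exact ⟨hSmono.le_iff_le.1 hσ.1, hSmono.le_iff_le.1 hσ.2⟩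
  have hSs : ContDiffOn ℝ (k + 1 : ℕ) S (Icc 0 L) := by
    push_cast
    rw [contDiffOn_succ_iff_derivWithin hu]
    refine ⟨fun t _ => (hSd t).differentiableAt.differentiableWithinAt, by simp, ?_⟩
    refine hvs.congr fun t ht => ?_
    rw [(hSd t).hasDerivWithinAt.derivWithin (hu t ht), hveq t ht]
  -- Bootstrap on `T' = 1 / v(T)`: the speed `v` is `C^k` because `γ'` avoids the origin, so each
  -- order of smoothness of `T` yields the next, up to `k + 1`.
  have hTs : ∀ n ≤ k + 1, ContDiffOn ℝ (n : ℕ) T (Icc 0 (S L)) := by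
    intro n
    induction n with
    | zero => intro _; exact contDiffOn_zero.2 hTcont.continuousOn
    | succ n ih =>
      intro hn
      push_cast
      rw [contDiffOn_succ_iff_derivWithin huJ]
      refine ⟨fun t _ => (hTd t).differentiableAt.differentiableWithinAt, by simp, ?_⟩
      have h1 : ContDiffOn ℝ n (fun σ => (v (T σ))⁻¹) (Icc 0 (S L)) :=
        ((hvs.of_le (by exact_mod_cast (by omega : n ≤ k))).comp (ih (by omega)) hmaps).inv
          fun σ hσ => (hc₀.trans_le (hmin (hmaps hσ))).ne'
      refine h1.congr fun σ hσ => ?_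
      rw [(hTd σ).hasDerivWithinAt.derivWithin (huJ σ hσ), hveq _ (hmaps hσ)]
  have hjS := hSs.isJet hu
  have hjT := (hTs (k + 1) le_rfl).isJet huJ
  obtain ⟨C1, hC1, hb1⟩ := hjet.exists_bound
  obtain ⟨C2, hC2, hb2⟩ := hjS.exists_bound
  obtain ⟨C3, hC3, hb3⟩ := hjT.exists_bound
  have hvt1 : 0 ≤ v t₁ := norm_nonneg _
  refine ⟨{ S := fun j => iteratedDerivWithin j S (Icc 0 L)
            T := fun j => iteratedDerivWithin j T (Icc 0 (S L))
            G := fun j => iteratedDerivWithin j γ (Icc 0 L)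
            c := min cc (v t₀)
            D := 1 + C1 + C2 + C3 + v t₁
            c_pos := by positivity
            one_le_D := by linarith
            G_zero := by simp
            jet_G := hjet
            jet_S := hjS
            S_zero := by simpa using hS0
            jet_T := by simpa using hjT
            T_S := by simpa using hTS
            S_T := by simpa using hST
            strictMono_S := by simpa using hSmono
            arcLength_eq := ?_
            G_le := fun j hj t ht => (hb1 j hj t ht).trans (by linarith)
            S_le := fun j hj t ht => (hb2 j hj t ht).trans (by linarith)
            T_le := fun j hj t ht => (hb3 j hj t (by simpa using ht)).trans (by linarith)
            S_sub_le := fun x y hxy => by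
              simp only [iteratedDerivWithin_zero]
              refine (hSup x y hxy).trans (mul_le_mul_of_nonneg_right ?_ (by linarith))
              linarith
            le_S_sub := fun x y hxy => by
              simp only [iteratedDerivWithin_zero]
              refine le_trans (mul_le_mul_of_nonneg_right (min_le_right _ _) ?_) (hSlow x y hxy)
              linarith
            chord := fun x y hx hxy hy =>
              le_trans (mul_le_mul_of_nonneg_right (min_le_left _ _) (by linarith))
                (hchord x y hx hxy hy) }⟩
  intro a b t ha hab hb ht
  simp only [iteratedDerivWithin_zero]
  rw [hSsub, arcLength]
  refine intervalIntegral.integral_congr fun τ hτ => ?_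
  rw [uIcc_of_le ht.1] at hτ
  have hτab : τ ∈ Icc a b := ⟨hτ.1, hτ.2.trans ht.2⟩
  have hτL : τ ∈ Icc 0 L := ⟨ha.trans hτab.1, hτab.2.trans hb⟩
  -- `arcLength` uses the derivative within `[a, b]`; on this nondegenerate subinterval it agrees
  -- with the derivative within `[0, L]`, also at the endpoints.
  have hd : HasDerivWithinAt γ (γ' τ) (Icc 0 L) τ :=
    (hγ.contDiffOn.differentiableOn (by simp) τ hτL).hasDerivWithinAt
  rw [hveq τ hτL, (hd.mono (Icc_subset_Icc ha hb)).derivWithin (uniqueDiffOn_Icc hab τ hτab)]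

end Geometry

/-! ### Complex multiplication, Lagrange polynomials and the interpolant -/

section Interpolation

/-- Multiplication by `d` in the plane, identified with `ℂ`. -/
def rot (d : Plane) : Plane →L[ℝ] Plane :=
  LinearMap.mkContinuous
    { toFun := fun y => WithLp.toLp 2 ![y 0 * d 0 - y 1 * d 1, y 1 * d 0 + y 0 * d 1]
      map_add' := fun y z => by ext i; fin_cases i <;> simp <;> ring
      map_smul' := fun r y => by ext i; fin_cases i <;> simp <;> ring } ‖d‖ fun y => by
    refine abs_le_of_sq_le_sq' ?_ (by positivity) |>.2
    rw [mul_pow, EuclideanSpace.real_norm_sq_eq, EuclideanSpace.real_norm_sq_eq,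
      EuclideanSpace.real_norm_sq_eq]
    simp [Fin.sum_univ_two]
    nlinarith

theorem rot_apply_zero (d y : Plane) : rot d y 0 = y 0 * d 0 - y 1 * d 1 := rfl

theorem rot_apply_one (d y : Plane) : rot d y 1 = y 1 * d 0 + y 0 * d 1 := rfl

/-- The modulus is multiplicative in ℂ. As an equality it works both ways: it bounds the field in
terms of `d`, and recovers the size of `d` from the value on the chord. -/
theorem norm_rot (d y : Plane) : ‖rot d y‖ = ‖d‖ * ‖y‖ := by
  refine (sq_eq_sq₀ (norm_nonneg _) (by positivity)).1 ?_
  rw [mul_pow, EuclideanSpace.real_norm_sq_eq, EuclideanSpace.real_norm_sq_eq,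
    EuclideanSpace.real_norm_sq_eq, Fin.sum_univ_two, Fin.sum_univ_two, Fin.sum_univ_two,
    rot_apply_zero, rot_apply_one]
  ring

theorem rot_add (d e y : Plane) : rot (d + e) y = rot d y + rot e y := by
  ext i
  fin_cases i
  · simp [rot_apply_zero]; ring
  · simp [rot_apply_one]; ring

/-- The matrix `𝔸(x)` acts as multiplication by the complex number `x - ν`. Hence these maps are
complex affine and determined by their values at two distinct points. -/
theorem mapF_eq (ν c d x : Plane) : mapF ν c d x = c + rot d (x - ν) := by
  ext i
  fin_cases i
  · simp [mapF, matA, rot_apply_zero, dotProduct, Fin.sum_univ_two]; ring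
  · simp [mapF, matA, rot_apply_one, dotProduct, Fin.sum_univ_two]; ring

theorem exists_rot_eq {y : Plane} (hy : y ≠ 0) (z : Plane) : ∃ d, rot d y = z := by
  have hn : y 0 ^ 2 + y 1 ^ 2 ≠ 0 := by
    intro h
    apply hy
    ext i
    fin_cases i
    · simp; nlinarith [sq_nonneg (y 0), sq_nonneg (y 1)]
    · simp; nlinarith [sq_nonneg (y 0), sq_nonneg (y 1)]
  refine ⟨WithLp.toLp 2 ![(y 0 * z 0 + y 1 * z 1) / (y 0 ^ 2 + y 1 ^ 2),
    (y 0 * z 1 - y 1 * z 0) / (y 0 ^ 2 + y 1 ^ 2)], ?_⟩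
  ext i
  fin_cases i
  · simp [rot_apply_zero]; field_simp; ring
  · simp [rot_apply_one]; field_simp; ring

theorem norm_le_abs_add_abs (x : Plane) : ‖x‖ ≤ |x 0| + |x 1| := by
  refine abs_le_of_sq_le_sq' ?_ (by positivity) |>.2
  rw [EuclideanSpace.real_norm_sq_eq, Fin.sum_univ_two]
  nlinarith [sq_abs (x 0), sq_abs (x 1), abs_nonneg (x 0), abs_nonneg (x 1),
    mul_nonneg (abs_nonneg (x 0)) (abs_nonneg (x 1))]

theorem abs_apply_le_norm (x : Plane) (i : Fin 2) : |x i| ≤ ‖x‖ := by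
  simpa using PiLp.norm_apply_le x i

/-- The derivatives of a field with polynomial components. -/
def polyJet (p : Fin 2 → Polynomial ℝ) (j : ℕ) (t : ℝ) : Plane :=
  WithLp.toLp 2 fun i => (Polynomial.derivative^[j] (p i)).eval t

theorem polyJet_add (p q : Fin 2 → Polynomial ℝ) (j : ℕ) (t : ℝ) :
    polyJet (p + q) j t = polyJet p j t + polyJet q j t := by
  ext i; simp [polyJet]

theorem hasDerivAt_polyJet (p : Fin 2 → Polynomial ℝ) (j : ℕ) (t : ℝ) :
    HasDerivAt (polyJet p j) (polyJet p (j + 1) t) t := by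
  have h : HasDerivAt (fun (t : ℝ) (i : Fin 2) => (Polynomial.derivative^[j] (p i)).eval t)
      (fun i => (Polynomial.derivative^[j + 1] (p i)).eval t) t := by
    refine hasDerivAt_pi.2 fun i => ?_
    rw [Function.iterate_succ_apply']
    exact Polynomial.hasDerivAt _ t
  exact ((PiLp.continuousLinearEquiv 2 ℝ (fun _ : Fin 2 => ℝ)).symm.toContinuousLinearMap
    |>.hasFDerivAt).comp_hasDerivAt t h

theorem isJet_of_hasDerivAt {E : Type*} [NormedAddCommGroup E] [NormedSpace ℝ E]
    {F : ℕ → ℝ → E} (h : ∀ j x, HasDerivAt (F j) (F (j + 1) x) x) (N : ℕ) (s : Set ℝ) :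
    IsJet N s F :=
  ⟨fun j _ x _ => (h j x).hasDerivWithinAt, fun x _ => (h N x).continuousAt.continuousWithinAt⟩

/-- Lagrange interpolation with bounds on the derivatives. -/
theorem exists_lagrange {k : ℕ} {a b ε : ℝ} (hab : a < b) (hε : 0 < ε) {t : Fin (k + 1) → ℝ}
    (ht : ∀ i, t i ∈ Icc a b) (hsep : ∀ i j, i ≠ j → ε * (b - a) ≤ |t i - t j|)
    {y : Fin (k + 1) → ℝ} {B : ℝ} (hy : ∀ i, |y i| ≤ B) :
    ∃ p ∈ Polynomial.degreeLE ℝ k, (∀ i, p.eval (t i) = y i) ∧ ∀ j, ∀ x ∈ Icc a b,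
      |(Polynomial.derivative^[j] p).eval x| * (b - a) ^ j ≤
        (k + 1) * ((1 + j) ^ k * (ε ^ k)⁻¹ * B) := by
  classical
  have hba : 0 < b - a := by linarith
  have hB : 0 ≤ B := (abs_nonneg _).trans (hy 0)
  set q : Fin (k + 1) → Polynomial ℝ := fun i =>
    ∏ j ∈ Finset.univ.erase i, (Polynomial.X - Polynomial.C (t j)) with hq
  set e : Fin (k + 1) → ℝ := fun i => ∏ j ∈ Finset.univ.erase i, (t i - t j) with he
  have hcard : ∀ i : Fin (k + 1), (Finset.univ.erase i).card = k := fun i => by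
    rw [Finset.card_erase_of_mem (Finset.mem_univ i)]; simp
  have hqe : ∀ i, (q i).eval (t i) = e i := fun i => by simp [hq, he, Polynomial.eval_prod]
  have hqo : ∀ i j, i ≠ j → (q i).eval (t j) = 0 := fun i j hij => by
    rw [hq, Polynomial.eval_prod]
    exact Finset.prod_eq_zero (Finset.mem_erase.2 ⟨hij.symm, Finset.mem_univ j⟩) (by simp)
  -- Separation bounds the Lagrange denominators below by `(ε (b - a)) ^ k`; this cancels the `(b -
  -- a) ^ k` coming from the numerators and leaves a scale-free constant.
  have hel : ∀ i, ε ^ k * (b - a) ^ k ≤ |e i| := fun i => by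
    rw [he, Finset.abs_prod, ← mul_pow]
    calc (ε * (b - a)) ^ k = ∏ j ∈ Finset.univ.erase i, (ε * (b - a)) := by
          rw [Finset.prod_const, hcard]
      _ ≤ _ := Finset.prod_le_prod (fun _ _ => by positivity)
          fun j hj => hsep i j (Finset.ne_of_mem_erase hj).symm
  have he0 : ∀ i, e i ≠ 0 := fun i => abs_pos.1 (lt_of_lt_of_le (by positivity) (hel i))
  refine ⟨∑ i, Polynomial.C (y i / e i) * q i, ?_, ?_, ?_⟩
  · refine Submodule.sum_mem _ fun i _ => ?_
    rw [← Polynomial.smul_eq_C_mul]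
    refine Submodule.smul_mem _ _ ?_
    rw [Polynomial.mem_degreeLE]
    rw [hq, Polynomial.degree_prod]
    simp
  · intro i
    rw [Polynomial.eval_finsetSum, Finset.sum_eq_single i]
    · simp [hqe, he0 i]
    · intro j _ hj; simp [hqo j i hj]
    · simp
  · intro j x hx
    rw [Polynomial.iterate_derivative_sum, Polynomial.eval_finsetSum]
    have hterm : ∀ i, |(Polynomial.derivative^[j] (Polynomial.C (y i / e i) * q i)).eval x| *
        (b - a) ^ j ≤ (1 + j) ^ k * (ε ^ k)⁻¹ * B := by
      intro i
      rw [Polynomial.iterate_derivative_C_mul, Polynomial.eval_mul, Polynomial.eval_C, abs_mul,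
        abs_div]
      have h1 := abs_iterate_derivative_prod_le (Finset.univ.erase i) t (fun j _ => ht j) j hx
      rw [hcard] at h1
      have h2 : |y i| / |e i| ≤ B / (ε ^ k * (b - a) ^ k) := by
        gcongr
        · exact hy i
        · exact hel i
      calc _ = |y i| / |e i| * (|(Polynomial.derivative^[j] (q i)).eval x| * (b - a) ^ j) := by ring
        _ ≤ B / (ε ^ k * (b - a) ^ k) * ((1 + j) ^ k * (b - a) ^ k) := by gcongr
        _ = _ := by field_simp
    calc _ ≤ (∑ i, |(Polynomial.derivative^[j] (Polynomial.C (y i / e i) * q i)).eval x|) *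
          (b - a) ^ j := by gcongr; exact Finset.abs_sum_le_sum_abs _ _
      _ = ∑ i, |(Polynomial.derivative^[j] (Polynomial.C (y i / e i) * q i)).eval x| *
          (b - a) ^ j := Finset.sum_mul _ _ _
      _ ≤ ∑ _i : Fin (k + 1), (1 + j : ℝ) ^ k * (ε ^ k)⁻¹ * B := Finset.sum_le_sum fun i _ => hterm i
      _ = _ := by simp

/-- Interpolation nodes in the parameter interval `[a, b]`. -/
structure IsParamNodes (k : ℕ) (L a b ε : ℝ) (t : Fin (k + 1) → ℝ) : Prop where
  a_nonneg : 0 ≤ a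
  lt : a < b
  b_le : b ≤ L
  left : t 0 = a
  right : t (Fin.last k) = b
  mem : ∀ i, t i ∈ Icc a b
  sep : ∀ i j, i ≠ j → ε * (b - a) ≤ |t i - t j|

theorem IsParamNodes.subset {k : ℕ} {L a b ε : ℝ} {t : Fin (k + 1) → ℝ}
    (h : IsParamNodes k L a b ε t) : Icc a b ⊆ Icc 0 L := Icc_subset_Icc h.a_nonneg h.b_le

theorem IsParamNodes.injective {k : ℕ} {L a b ε : ℝ} {t : Fin (k + 1) → ℝ}
    (h : IsParamNodes k L a b ε t) (hε : 0 < ε) : Function.Injective t := fun i j hij => by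
  by_contra hne
  have := h.sep i j hne
  rw [hij, sub_self, abs_zero] at this
  have h2 : 0 < ε * (b - a) := mul_pos hε (sub_pos.2 h.lt)
  linarith

/-- Polynomials of degree at most `k` vanishing at the end points. -/
def IsBubble (k : ℕ) (a b : ℝ) (p : Fin 2 → Polynomial ℝ) : Prop :=
  ∀ i, p i ∈ Polynomial.degreeLE ℝ k ∧ (p i).eval a = 0 ∧ (p i).eval b = 0

variable {k : ℕ} {L : ℝ} {γ : ℝ → Plane}

/-- The derivatives of `t ↦ c + 𝔸(γ t) d + p t`. -/
def interpJet (A : ArcLengthData k L γ) (a : ℝ) (c d : Plane) (p : Fin 2 → Polynomial ℝ)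
    (j : ℕ) (t : ℝ) : Plane :=
  rot d (A.G j t - if j = 0 then γ a else 0) + (if j = 0 then c else 0) + polyJet p j t

theorem interpJet_zero (A : ArcLengthData k L γ) (a : ℝ) (c d : Plane)
    (p : Fin 2 → Polynomial ℝ) (t : ℝ) :
    interpJet A a c d p 0 t = c + rot d (γ t - γ a) + polyJet p 0 t := by
  simp [interpJet, A.G_zero, add_comm]

theorem interpJet_add (A : ArcLengthData k L γ) (a : ℝ) (c d c' d' : Plane)
    (p p' : Fin 2 → Polynomial ℝ) (j : ℕ) (t : ℝ) :
    interpJet A a (c + c') (d + d') (p + p') j t =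
      interpJet A a c d p j t + interpJet A a c' d' p' j t := by
  simp only [interpJet, rot_add, polyJet_add]
  split_ifs <;> abel

theorem isJet_interpJet (A : ArcLengthData k L γ) (a : ℝ) (c d : Plane)
    (p : Fin 2 → Polynomial ℝ) : IsJet (k + 1) (Icc 0 L) (interpJet A a c d p) := by
  have h1 := (A.jet_G.sub_const (γ a)).clm (rot d)
  have h2 : IsJet (k + 1) (Icc 0 L) (fun j (_ : ℝ) => if j = 0 then c else (0 : Plane)) :=
    ⟨fun j _ x _ => by simpa using hasDerivWithinAt_const x _ (if j = 0 then c else 0),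
      continuousOn_const⟩
  exact (h1.add h2).add (isJet_of_hasDerivAt (hasDerivAt_polyJet p) _ _)

theorem ArcLengthData.norm_sub_le (A : ArcLengthData k L γ) {x y : ℝ} (hx : x ∈ Icc 0 L)
    (hy : y ∈ Icc 0 L) : ‖γ y - γ x‖ ≤ A.D * |y - x| := by
  have := (convex_Icc 0 L).norm_image_sub_le_of_norm_hasDerivWithin_le
    (fun t ht => A.jet_G.hasDeriv 0 (by omega) t ht) (fun t ht => A.G_le 1 (by omega) t ht) hx hy
  rwa [A.G_zero] at this

/-- The interpolant exists; its coefficients are bounded in terms of the data. -/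
theorem exists_interpJet (A : ArcLengthData k L γ) {a b ε : ℝ} (hε : 0 < ε)
    {t : Fin (k + 1) → ℝ} (ht : IsParamNodes k L a b ε t) (y : Fin (k + 1) → Plane) :
    ∃ d p, IsBubble k a b p ∧ (∀ i, interpJet A a (y 0) d p 0 (t i) = y i) ∧
      A.c * (b - a) * ‖d‖ ≤ ‖y (Fin.last k) - y 0‖ ∧
      ∀ B, (∀ i, ‖y i - y 0 - rot d (γ (t i) - γ a)‖ ≤ B) → ∀ j, ∀ x ∈ Icc a b,
        ‖polyJet p j x‖ * (b - a) ^ j ≤ 2 * ((k + 1) * ((1 + j) ^ k * (ε ^ k)⁻¹ * B)) := by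
  have hba : 0 < b - a := sub_pos.2 ht.lt
  have hch := A.chord a b ht.a_nonneg ht.lt.le ht.b_le
  have hne : γ b - γ a ≠ 0 := norm_pos_iff.1 (lt_of_lt_of_le (mul_pos A.c_pos hba) hch)
  -- Since a bubble vanishes at both ends, the endpoint data leave no choice for `c = y 0` and `d`.
  -- The residual data `z` vanish at the first and last nodes, so their Lagrange interpolant is a
  -- bubble.
  obtain ⟨d, hd⟩ := exists_rot_eq hne (y (Fin.last k) - y 0)
  set z : Fin (k + 1) → Plane := fun i => y i - y 0 - rot d (γ (t i) - γ a) with hz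
  have hex : ∀ l : Fin 2, ∃ p ∈ Polynomial.degreeLE ℝ k, (∀ i, p.eval (t i) = z i l) ∧
      ∀ B, (∀ i, ‖z i‖ ≤ B) → ∀ j, ∀ x ∈ Icc a b,
      |(Polynomial.derivative^[j] p).eval x| * (b - a) ^ j ≤
        (k + 1) * ((1 + j) ^ k * (ε ^ k)⁻¹ * B) := by
    intro l
    -- The polynomial is to be chosen before `B`; it is built with the largest `‖z i‖`, which any
    -- admissible `B` dominates.
    have hB0 : ∀ i, ‖z i‖ ≤ Finset.univ.sup' Finset.univ_nonempty (fun i => ‖z i‖) := fun i =>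
      Finset.le_sup' (fun i => ‖z i‖) (Finset.mem_univ i)
    obtain ⟨p, hp, hpt, hpb⟩ := exists_lagrange ht.lt hε ht.mem ht.sep
      (y := fun i => z i l) fun i => (abs_apply_le_norm (z i) l).trans (hB0 i)
    refine ⟨p, hp, hpt, fun B hB j x hx => (hpb j x hx).trans ?_⟩
    gcongr
    exact Finset.sup'_le _ _ fun i _ => hB i
  choose p hp hpt hpb using hex
  refine ⟨d, p, fun l => ⟨hp l, ?_, ?_⟩, fun i => ?_, ?_, fun B hB j x hx => ?_⟩
  · rw [← ht.left, hpt]; simp [hz, ht.left]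
  · have hz0 : z (Fin.last k) = 0 := by simp only [hz]; rw [ht.right, hd, sub_self]
    rw [← ht.right, hpt, hz0]; rfl
  · rw [interpJet_zero]
    have : polyJet p 0 (t i) = z i := by ext l; simp [polyJet, hpt]
    rw [this]
    simp only [hz]
    abel
  · rw [← hd, norm_rot, mul_comm]
    gcongr
  · refine (mul_le_mul_of_nonneg_right (norm_le_abs_add_abs _) (by positivity)).trans ?_
    have h0 := hpb 0 B hB j x hx
    have h1 := hpb 1 B hB j x hx
    simp only [polyJet]
    linarith

end Interpolation

/-! ### Stability of the interpolation and error for smooth data -/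

section InterpolationBounds

variable {k : ℕ} {L : ℝ} {γ : ℝ → Plane}

theorem pow_le_max_one_pow {x : ℝ} (hx : 0 ≤ x) (hxL : x ≤ L) {i n : ℕ} (hi : i ≤ n) :
    x ^ i ≤ max 1 L ^ n :=
  (pow_le_pow_left₀ hx (hxL.trans (le_max_right 1 L)) i).trans
    (pow_le_pow_right₀ (le_max_left 1 L) hi)

/-- By the chord-arc inequality `‖d‖ (b - a)` is at most a constant times `B`. A derivative of `rot
d γ` of order `j ≥ 1` needs just one factor `b - a` to compensate `d`; the remaining ones are
absorbed in `H`. The residual data of the bubble are then also of size `B`. -/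
theorem exists_interpJet_le_of_le (A : ArcLengthData k L γ) {ε : ℝ} (hε : 0 < ε) :
    ∃ C, 0 ≤ C ∧ ∀ a b (t : Fin (k + 1) → ℝ), IsParamNodes k L a b ε t →
      ∀ (y : Fin (k + 1) → Plane) (B : ℝ), (∀ i, ‖y i‖ ≤ B) →
      ∃ c d p, IsBubble k a b p ∧ (∀ i, interpJet A a c d p 0 (t i) = y i) ∧
        ∀ j ≤ k + 1, ∀ x ∈ Icc a b, ‖interpJet A a c d p j x‖ * (b - a) ^ j ≤ C * B := by
  have hc := A.c_pos
  have hD := A.one_le_D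
  set H := max 1 L with hH
  have hH1 : 1 ≤ H := le_max_left 1 L
  set E := 2 * A.D / A.c with hE
  have hE0 : 0 ≤ E := by positivity
  refine ⟨E * H ^ (k + 1) + 1 +
    2 * ((k + 1) * ((1 + (k + 1 : ℕ)) ^ k * (ε ^ k)⁻¹ * (2 + E))), by positivity,
    fun a b t ht y B hy => ?_⟩
  have hB : 0 ≤ B := (norm_nonneg _).trans (hy 0)
  have hba : 0 < b - a := sub_pos.2 ht.lt
  have hbaL : b - a ≤ L := by linarith [ht.a_nonneg, ht.b_le]
  obtain ⟨d, p, hp, hpt, hd, hpb⟩ := exists_interpJet A hε ht y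
  have hd' : ‖d‖ * (b - a) * A.D ≤ E * B := by
    have h1 : A.c * (b - a) * ‖d‖ ≤ 2 * B :=
      hd.trans ((norm_sub_le _ _).trans (by linarith [hy (Fin.last k), hy 0]))
    rw [hE, div_mul_eq_mul_div, le_div_iff₀ hc]
    nlinarith [mul_le_mul_of_nonneg_right h1 (show 0 ≤ A.D by linarith)]
  have hγ : ∀ x ∈ Icc a b, ‖rot d (γ x - γ a)‖ ≤ E * B := fun x hx => by
    rw [norm_rot]
    refine le_trans ?_ hd'
    rw [mul_assoc, mul_comm (b - a)]
    refine mul_le_mul_of_nonneg_left ?_ (norm_nonneg _)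
    refine (A.norm_sub_le (ht.subset (left_mem_Icc.2 ht.lt.le)) (ht.subset hx)).trans ?_
    gcongr
    rw [abs_of_nonneg (by linarith [hx.1])]
    linarith [hx.2]
  have hz : ∀ i, ‖y i - y 0 - rot d (γ (t i) - γ a)‖ ≤ (2 + E) * B := fun i => by
    refine (norm_sub_le _ _).trans ?_
    have := norm_sub_le (y i) (y 0)
    have := hγ (t i) (ht.mem i)
    have := hy i
    have := hy 0
    nlinarith
  refine ⟨y 0, d, p, hp, hpt, fun j hj x hx => ?_⟩
  have h1 : ‖rot d (A.G j x - if j = 0 then γ a else 0)‖ * (b - a) ^ j ≤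
      E * H ^ (k + 1) * B := by
    rcases j with _ | j
    · simp only [if_true, pow_zero, mul_one, A.G_zero]
      refine (hγ x hx).trans ?_
      have : 1 ≤ H ^ (k + 1) := one_le_pow₀ hH1
      have h2 : E * B ≤ E * B * H ^ (k + 1) := le_mul_of_one_le_right (by positivity) this
      linarith
    · simp only [Nat.succ_ne_zero, if_false, sub_zero]
      rw [norm_rot, pow_succ]
      have h2 := A.G_le (j + 1) hj x (ht.subset hx)
      have h3 : (b - a) ^ j ≤ H ^ (k + 1) := pow_le_max_one_pow hba.le hbaL (by omega)
      calc _ ≤ ‖d‖ * A.D * (H ^ (k + 1) * (b - a)) := by gcongr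
        _ = ‖d‖ * (b - a) * A.D * H ^ (k + 1) := by ring
        _ ≤ E * B * H ^ (k + 1) := by gcongr
        _ = _ := by ring
  have h2 : ‖(if j = 0 then y 0 else 0 : Plane)‖ * (b - a) ^ j ≤ B := by
    split_ifs with h
    · subst h; simpa using hy 0
    · simpa using hB
  have h3 : ‖polyJet p j x‖ * (b - a) ^ j ≤
      2 * ((k + 1) * ((1 + (k + 1 : ℕ)) ^ k * (ε ^ k)⁻¹ * (2 + E))) * B := by
    refine (hpb _ hz j x hx).trans ?_
    have : (1 + j : ℝ) ≤ 1 + (k + 1 : ℕ) := by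
      have : (j : ℝ) ≤ (k + 1 : ℕ) := by exact_mod_cast hj
      linarith
    calc _ ≤ 2 * ((k + 1) * ((1 + (k + 1 : ℕ) : ℝ) ^ k * (ε ^ k)⁻¹ * ((2 + E) * B))) := by gcongr
      _ = _ := by ring
  rw [interpJet]
  calc _ ≤ (‖rot d (A.G j x - if j = 0 then γ a else 0)‖ + ‖(if j = 0 then y 0 else 0 : Plane)‖ +
        ‖polyJet p j x‖) * (b - a) ^ j := by
        gcongr
        exact norm_add₃_le
    _ ≤ _ := by
      rw [add_mul, add_mul, add_mul, add_mul, one_mul]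
      exact add_le_add (add_le_add h1 h2) h3

theorem IsBubble.polyJet_succ_eq_zero {a b : ℝ} {p : Fin 2 → Polynomial ℝ} (hp : IsBubble k a b p)
    (t : ℝ) : polyJet p (k + 1) t = 0 := by
  ext l
  have h1 := Polynomial.mem_degreeLE.1 (hp l).1
  have h2 : (p l).natDegree < k + 1 :=
    Nat.lt_succ_of_le (Polynomial.natDegree_le_of_degree_le h1)
  simp only [polyJet, Polynomial.iterate_derivative_eq_zero h2, Polynomial.eval_zero]
  rfl

/-- A vector valued `C^{k+1}` function vanishing at the nodes. -/
theorem IsJet.norm_le_of_nodes {ε a b : ℝ} (hε : 0 < ε) {t : Fin (k + 1) → ℝ}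
    (ht : IsParamNodes k L a b ε t) {Q : ℕ → ℝ → Plane} (hQ : IsJet (k + 1) (Icc a b) Q)
    (h0 : ∀ i, Q 0 (t i) = 0) {B : ℝ} (hB : ∀ x ∈ Icc a b, ‖Q (k + 1) x‖ ≤ B) :
    ∀ j ≤ k + 1, ∀ x ∈ Icc a b, ‖Q j x‖ ≤ 2 * (B * (b - a) ^ (k + 1 - j)) := by
  classical
  -- The interior nodes need not follow the order of the curve; sorting them gives the increasing
  -- zeros that Rolle's theorem needs.
  set Z : Finset ℝ := Finset.univ.image t with hZ
  have hcard : Z.card = k + 1 := by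
    rw [hZ, Finset.card_image_of_injective _ (ht.injective hε)]; simp
  have hz : ∀ i, ∃ l, t l = Z.orderEmbOfFin hcard i := fun i => by
    have := Z.orderEmbOfFin_mem hcard i
    obtain ⟨l, -, hl⟩ := Finset.mem_image.1 this
    exact ⟨l, hl⟩
  intro j hj x hx
  -- Rolle's theorem is scalar, so it is applied to each component; the two components produce the
  -- factor `2`.
  have hl : ∀ l : Fin 2, |Q j x l| ≤ B * (b - a) ^ (k + 1 - j) := fun l =>
    (hQ.clm (EuclideanSpace.proj l : Plane →L[ℝ] ℝ)).abs_le_of_zeros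
      (z := Z.orderEmbOfFin hcard) (Z.orderEmbOfFin hcard).strictMono
      (fun i => by obtain ⟨l, hl⟩ := hz i; rw [← hl]; exact ht.mem l)
      (fun i => by
        obtain ⟨l', hl'⟩ := hz i
        rw [← hl', h0, map_zero])
      (fun x hx => (abs_apply_le_norm _ l).trans (hB x hx)) j hj x hx
  have := norm_le_abs_add_abs (Q j x)
  linarith [hl 0, hl 1]

/-- The error vanishes at `k + 1` nodes, so all its derivatives follow from a bound at order `k +
1`. No estimate of the polynomial part is needed, because it has degree at most `k`. -/
theorem exists_interpJet_sub_le_of_smooth (A : ArcLengthData k L γ) {ε : ℝ} (hε : 0 < ε) :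
    ∃ C, 0 ≤ C ∧ ∀ a b (t : Fin (k + 1) → ℝ), IsParamNodes k L a b ε t →
      ∀ (T : ℕ → ℝ → Plane) (K : ℝ), (∀ j x, HasDerivAt (T j) (T (j + 1) x) x) →
      (∀ j, ∀ x ∈ Icc 0 (A.S 0 b - A.S 0 a), ‖T j x‖ ≤ K) →
      ∃ c d p, IsBubble k a b p ∧
        (∀ i, interpJet A a c d p 0 (t i) = T 0 (A.S 0 (t i) - A.S 0 a)) ∧
        ∃ Q : ℕ → ℝ → Plane, IsJet (k + 1) (Icc a b) Q ∧
        (∀ x, Q 0 x = T 0 (A.S 0 x - A.S 0 a) - interpJet A a c d p 0 x) ∧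
        ∀ j ≤ k + 1, ∀ x ∈ Icc a b, ‖Q j x‖ * (b - a) ^ j ≤ C * (K * (b - a) ^ (k + 1)) := by
  have hc := A.c_pos
  have hD := A.one_le_D
  refine ⟨2 * ((k + 1).factorial * A.D ^ (k + 1) + A.D / A.c * A.D), by positivity,
    fun a b t ht T K hT hTK => ?_⟩
  have hba : 0 < b - a := sub_pos.2 ht.lt
  set h := A.S 0 b - A.S 0 a with hh
  have hh0 : 0 < h := sub_pos.2 (A.strictMono_S ht.lt)
  have hK : 0 ≤ K := (norm_nonneg _).trans (hTK 0 0 (left_mem_Icc.2 hh0.le))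
  obtain ⟨d, p, hp, hpt, hd, -⟩ := exists_interpJet A hε ht
    (fun i => T 0 (A.S 0 (t i) - A.S 0 a))
  have hgjet : IsJet (k + 1) (Icc a b)
      (fun j x => A.S j x - if j = 0 then A.S 0 a else 0) := (A.jet_S.sub_const _).mono ht.subset
  have hmaps : MapsTo (fun x => A.S 0 x - if (0 : ℕ) = 0 then A.S 0 a else 0) (Icc a b)
      (Icc 0 h) := fun x hx => by
    simp only [if_true]
    exact ⟨sub_nonneg.2 (A.strictMono_S.monotone hx.1),
      sub_le_sub_right (A.strictMono_S.monotone hx.2) _⟩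
  obtain ⟨W, hW, hW0, hWb⟩ := (isJet_of_hasDerivAt hT (k + 1) (Icc 0 h)).exists_comp hgjet
    (uniqueDiffOn_Icc ht.lt) (uniqueDiffOn_Icc hh0) hmaps
  simp only [if_true] at hW0
  have hQ := hW.sub ((isJet_interpJet A a (T 0 (A.S 0 (t 0) - A.S 0 a)) d p).mono ht.subset)
  refine ⟨_, d, p, hp, hpt, _, hQ, fun x => by simp only [hW0], fun j hj x hx => ?_⟩
  -- `d` is the quotient of the increment of `T 0` over the edge by the chord. The increment is at
  -- most `K` times the length, and length and chord are comparable, so no negative power of `b - a`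
  -- remains.
  have hd' : ‖d‖ ≤ A.D / A.c * K := by
    have h1 : ‖T 0 (A.S 0 (t (Fin.last k)) - A.S 0 a) - T 0 (A.S 0 (t 0) - A.S 0 a)‖ ≤ K * h := by
      rw [ht.left, ht.right, sub_self]
      have := (convex_Icc 0 h).norm_image_sub_le_of_norm_hasDerivWithin_le
        (fun x _ => (hT 0 x).hasDerivWithinAt) (fun x hx => hTK 1 x hx)
        (left_mem_Icc.2 hh0.le) (right_mem_Icc.2 hh0.le)
      rwa [sub_zero, Real.norm_of_nonneg hh0.le] at this
    have h2 : h ≤ A.D * (b - a) := A.S_sub_le a b ht.lt.le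
    have h3 : A.c * (b - a) * ‖d‖ ≤ K * (A.D * (b - a)) := hd.trans (h1.trans (by gcongr))
    rw [div_mul_eq_mul_div, le_div_iff₀ hc]
    refine le_of_mul_le_mul_right ?_ hba
    linarith
  -- At order `k + 1` only the composition of `T` with arc length and the term `rot d` of the curve
  -- derivative survive.
  have hB : ∀ x ∈ Icc a b, ‖W (k + 1) x - interpJet A a (T 0 (A.S 0 (t 0) - A.S 0 a)) d p (k + 1) x‖
      ≤ ((k + 1).factorial * A.D ^ (k + 1) + A.D / A.c * A.D) * K := by
    intro x hx
    have h1 := hWb A.D hD (fun i hi h1 x hx => by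
      simp only [if_neg (show ¬ i = 0 by omega), sub_zero]
      exact A.S_le i hi x (ht.subset hx)) (k + 1) le_rfl K (fun i _ x hx => hTK i x hx) x hx
    have h2 : ‖interpJet A a (T 0 (A.S 0 (t 0) - A.S 0 a)) d p (k + 1) x‖ ≤
        A.D / A.c * K * A.D := by
      rw [interpJet, hp.polyJet_succ_eq_zero]
      simp only [Nat.succ_ne_zero, if_false, sub_zero, add_zero]
      rw [norm_rot]
      have := A.G_le (k + 1) le_rfl x (ht.subset hx)
      gcongr
    refine (norm_sub_le _ _).trans ((add_le_add h1 h2).trans (le_of_eq ?_))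
    ring
  have key := hQ.norm_le_of_nodes hε ht (fun i => by rw [hW0, hpt, sub_self]) hB j hj x hx
  calc _ ≤ 2 * (((k + 1).factorial * A.D ^ (k + 1) + A.D / A.c * A.D) * K *
        (b - a) ^ (k + 1 - j)) * (b - a) ^ j := by gcongr
    _ = 2 * ((k + 1).factorial * A.D ^ (k + 1) + A.D / A.c * A.D) *
        (K * ((b - a) ^ (k + 1 - j) * (b - a) ^ j)) := by ring
    _ = _ := by rw [← pow_add, Nat.sub_add_cancel hj]

/-- The interpolation error in the arc-length variable, for data close to a smooth field. -/
theorem exists_interpJet_error_le (A : ArcLengthData k L γ) {ε : ℝ} (hε : 0 < ε) :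
    ∃ C, 0 ≤ C ∧ ∀ a b (t : Fin (k + 1) → ℝ), IsParamNodes k L a b ε t →
      ∀ (T : ℕ → ℝ → Plane) (K : ℝ), (∀ j x, HasDerivAt (T j) (T (j + 1) x) x) →
      (∀ j, ∀ x ∈ Icc 0 (A.S 0 b - A.S 0 a), ‖T j x‖ ≤ K) →
      ∀ (y : Fin (k + 1) → Plane) (B : ℝ),
      (∀ i, ‖y i - T 0 (A.S 0 (t i) - A.S 0 a)‖ ≤ B) →
      ∃ c d p, IsBubble k a b p ∧ (∀ i, interpJet A a c d p 0 (t i) = y i) ∧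
        ∃ U : ℕ → ℝ → Plane, IsJet (k + 1) (Icc 0 (A.S 0 b - A.S 0 a)) U ∧
        (∀ x, U 0 x = T 0 x - interpJet A a c d p 0 (A.T 0 (A.S 0 a + x))) ∧
        ∀ j ≤ k + 1, ∀ x ∈ Icc 0 (A.S 0 b - A.S 0 a), ‖U j x‖ * (A.S 0 b - A.S 0 a) ^ j ≤
          C * (B + K * (A.S 0 b - A.S 0 a) ^ (k + 1)) := by
  obtain ⟨C₁, hC₁, H₁⟩ := exists_interpJet_le_of_le A hε
  obtain ⟨C₂, hC₂, H₂⟩ := exists_interpJet_sub_le_of_smooth A hε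
  have hc := A.c_pos
  have hD := A.one_le_D
  set H := max 1 L with hH
  have hH1 : 1 ≤ H := le_max_left 1 L
  -- Converts `(b - a) ^ (k + 1)` into `h ^ (k + 1)`; the `1` lets the same factor also cover the
  -- term in `B`.
  set M := max 1 (A.c⁻¹ ^ (k + 1)) with hM
  have hM1 : 1 ≤ M := le_max_left _ _
  refine ⟨(k + 1).factorial * ((C₁ + C₂) * M * H ^ (k + 1)) * A.D ^ (k + 1) * A.D ^ (k + 1),
    by positivity, fun a b t ht T K hT hTK y B hy => ?_⟩
  have hba : 0 < b - a := sub_pos.2 ht.lt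
  have hbaL : b - a ≤ L := by linarith [ht.a_nonneg, ht.b_le]
  have hB : 0 ≤ B := (norm_nonneg _).trans (hy 0)
  set h := A.S 0 b - A.S 0 a with hh
  have hh0 : 0 < h := sub_pos.2 (A.strictMono_S ht.lt)
  have hK : 0 ≤ K := (norm_nonneg _).trans (hTK 0 0 (left_mem_Icc.2 hh0.le))
  have hhD : h ≤ A.D * (b - a) := A.S_sub_le a b ht.lt.le
  have hhc : A.c * (b - a) ≤ h := A.le_S_sub a b ht.lt.le
  -- By linearity the interpolant is a sum: the deviation `y - T` is handled by stability, the
  -- values of `T` by the smooth estimate.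
  obtain ⟨c₁, d₁, p₁, hp₁, hi₁, hb₁⟩ := H₁ a b t ht _ B hy
  obtain ⟨c₂, d₂, p₂, hp₂, hi₂, Q, hQ, hQ0, hQb⟩ := H₂ a b t ht T K hT hTK
  have hR := hQ.sub ((isJet_interpJet A a c₁ d₁ p₁).mono ht.subset)
  set R : ℕ → ℝ → Plane := fun j x => Q j x - interpJet A a c₁ d₁ p₁ j x with hRdef
  set Y := B + K * h ^ (k + 1) with hY
  have hY0 : 0 ≤ Y := by positivity
  have hRb : ∀ j ≤ k + 1, ∀ x ∈ Icc a b, ‖R j x‖ * (b - a) ^ j ≤ (C₁ + C₂) * M * Y := by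
    intro j hj x hx
    have e1 : (b - a) ^ (k + 1) ≤ M * h ^ (k + 1) := by
      have : b - a ≤ A.c⁻¹ * h := by
        rw [inv_mul_eq_div, le_div_iff₀ hc]; linarith
      calc _ ≤ (A.c⁻¹ * h) ^ (k + 1) := by gcongr
        _ = A.c⁻¹ ^ (k + 1) * h ^ (k + 1) := mul_pow _ _ _
        _ ≤ _ := by gcongr; exact le_max_right _ _
    calc _ ≤ (‖Q j x‖ + ‖interpJet A a c₁ d₁ p₁ j x‖) * (b - a) ^ j := by
          gcongr; exact norm_sub_le _ _
      _ ≤ C₂ * (K * (b - a) ^ (k + 1)) + C₁ * B := by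
          rw [add_mul]; exact add_le_add (hQb j hj x hx) (hb₁ j hj x hx)
      _ ≤ C₂ * (K * (M * h ^ (k + 1))) + C₁ * B := by gcongr
      _ ≤ C₂ * M * Y + C₁ * M * Y := by
          refine add_le_add ?_ ?_
          · rw [hY]
            have : 0 ≤ C₂ * M * B := by positivity
            nlinarith
          · have h1 : B ≤ M * Y := by
              have : Y ≤ M * Y := le_mul_of_one_le_left hY0 hM1
              have : 0 ≤ K * h ^ (k + 1) := by positivity
              linarith
            calc _ ≤ C₁ * (M * Y) := by gcongr
              _ = _ := by ring
      _ = _ := by ring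
  have hSa : 0 ≤ A.S 0 a := by
    rw [← A.S_zero]; exact A.strictMono_S.monotone ht.a_nonneg
  have hSb : A.S 0 b ≤ A.S 0 L := A.strictMono_S.monotone ht.b_le
  have hshift : MapsTo (fun x => A.S 0 a + x) (Icc 0 h) (Icc 0 (A.S 0 L)) := fun x hx =>
    ⟨by linarith [hx.1], by linarith [hx.2]⟩
  have hg := A.jet_T.comp_const_add (A.S 0 a) hshift
  have hmaps : MapsTo (fun x => A.T 0 (A.S 0 a + x)) (Icc 0 h) (Icc a b) := fun x hx => by
    have h1 : A.S 0 (A.T 0 (A.S 0 a + x)) = A.S 0 a + x := A.S_T _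
    exact ⟨A.strictMono_S.le_iff_le.1 (by linarith [hx.1]),
      A.strictMono_S.le_iff_le.1 (by linarith [hx.2])⟩
  obtain ⟨U, hU, hU0, hUb⟩ := hR.exists_comp hg (uniqueDiffOn_Icc hh0) (uniqueDiffOn_Icc ht.lt)
    hmaps
  refine ⟨c₁ + c₂, d₁ + d₂, p₁ + p₂, fun l => ⟨Submodule.add_mem _ (hp₁ l).1 (hp₂ l).1, ?_, ?_⟩,
    fun i => ?_, U, hU, fun x => ?_, fun j hj x hx => ?_⟩
  · simp [(hp₁ l).2.1, (hp₂ l).2.1]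
  · simp [(hp₁ l).2.2, (hp₂ l).2.2]
  · rw [interpJet_add, hi₁, hi₂]; abel
  · rw [hU0]
    simp only [hRdef]
    rw [hQ0, A.S_T, add_sub_cancel_left, interpJet_add]; abel
  -- The chain rule mixes all orders `i ≤ j` and wants one bound for them; the worst scaling, `(b -
  -- a) ^ (-j)`, serves for all at the cost of `H ^ (k + 1)`.
  · have h1 := hUb A.D hD (fun i hi _ x hx => A.T_le i hi _ (hshift hx)) j hj
      ((C₁ + C₂) * M * Y * H ^ (k + 1) * ((b - a) ^ j)⁻¹) (fun i hi x hx => by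
        rw [← div_eq_mul_inv, le_div_iff₀ (by positivity)]
        have h2 := hRb i (hi.trans hj) x hx
        have h3 : (b - a) ^ (j - i) ≤ H ^ (k + 1) :=
          pow_le_max_one_pow hba.le hbaL (by omega)
        calc ‖R i x‖ * (b - a) ^ j = ‖R i x‖ * (b - a) ^ i * (b - a) ^ (j - i) := by
              rw [mul_assoc, ← pow_add, Nat.add_sub_cancel' hi]
          _ ≤ _ := by gcongr) x hx
    have h4 : h ^ j ≤ A.D ^ (k + 1) * (b - a) ^ j := by
      calc h ^ j ≤ (A.D * (b - a)) ^ j := by gcongr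
        _ = A.D ^ j * (b - a) ^ j := mul_pow _ _ _
        _ ≤ _ := by gcongr
    have h5 : (j.factorial : ℝ) ≤ (k + 1).factorial := by
      exact_mod_cast Nat.factorial_le hj
    calc _ ≤ j.factorial * ((C₁ + C₂) * M * Y * H ^ (k + 1) * ((b - a) ^ j)⁻¹) * A.D ^ j *
          (A.D ^ (k + 1) * (b - a) ^ j) := by gcongr
      _ = j.factorial * ((C₁ + C₂) * M * Y * H ^ (k + 1)) * A.D ^ j * A.D ^ (k + 1) := by
          field_simp
      _ ≤ (k + 1).factorial * ((C₁ + C₂) * M * Y * H ^ (k + 1)) * A.D ^ (k + 1) *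
          A.D ^ (k + 1) := by gcongr
      _ = _ := by ring

end InterpolationBounds

/-! ### Fields on the edge: arc-length form, unisolvence, uniqueness -/

section EdgeFields

variable {k : ℕ} {L : ℝ} {γ : ℝ → Plane} {a b : ℝ}

theorem exists_edgePt_eq (x : edge γ a b) : ∃ t : Icc a b, edgePt γ a b t = x := by
  obtain ⟨x, t, ht, rfl⟩ := x
  exact ⟨⟨t, ht⟩, rfl⟩

theorem inArcLength_sub (u v : edge γ a b → Plane) :
    inArcLength γ a b (u - v) = inArcLength γ a b u - inArcLength γ a b v := by
  funext σ
  simp only [inArcLength, Function.extend, Pi.sub_apply]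
  split_ifs <;> simp

theorem ArcLengthData.edgeLength_eq (A : ArcLengthData k L γ) (ha : 0 ≤ a) (hab : a < b)
    (hb : b ≤ L) : edgeLength γ a b = A.S 0 b - A.S 0 a :=
  A.arcLength_eq a b b ha hab hb (right_mem_Icc.2 hab.le)

theorem ArcLengthData.T_mem (A : ArcLengthData k L γ) {σ : ℝ}
    (hσ : σ ∈ Icc 0 (A.S 0 b - A.S 0 a)) : A.T 0 (A.S 0 a + σ) ∈ Icc a b := by
  have h1 : A.S 0 (A.T 0 (A.S 0 a + σ)) = A.S 0 a + σ := A.S_T _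
  exact ⟨A.strictMono_S.le_iff_le.1 (by linarith [hσ.1]),
    A.strictMono_S.le_iff_le.1 (by linarith [hσ.2])⟩

theorem ArcLengthData.S_sub_mem (A : ArcLengthData k L γ) {t : ℝ} (ht : t ∈ Icc a b) :
    A.S 0 t - A.S 0 a ∈ Icc 0 (A.S 0 b - A.S 0 a) :=
  ⟨sub_nonneg.2 (A.strictMono_S.monotone ht.1), sub_le_sub_right (A.strictMono_S.monotone ht.2) _⟩

/-- Arc length is injective on `[a, b]`, so the preimage chosen in `arcParam` has to be the one
given by `A.T 0`. -/
theorem ArcLengthData.inArcLength_eq (A : ArcLengthData k L γ) (ha : 0 ≤ a) (hab : a < b)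
    (hb : b ≤ L) (u : edge γ a b → Plane) {σ : ℝ} (hσ : σ ∈ Icc 0 (A.S 0 b - A.S 0 a)) :
    inArcLength γ a b u σ = u (edgePt γ a b ⟨A.T 0 (A.S 0 a + σ), A.T_mem hσ⟩) := by
  have hex : ∃ t ∈ Icc a b, arcLength γ a b t = σ := by
    refine ⟨_, A.T_mem hσ, ?_⟩
    rw [A.arcLength_eq a b _ ha hab hb (A.T_mem hσ), A.S_T, add_sub_cancel_left]
  have hmem := Function.invFunOn_mem hex
  have heq := Function.invFunOn_eq hex
  set t := Function.invFunOn (arcLength γ a b) (Icc a b) σ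
  rw [A.arcLength_eq a b t ha hab hb hmem] at heq
  have ht : A.T 0 (A.S 0 a + σ) = t := by
    rw [← heq, add_sub_cancel, A.T_S]
  have h1 : arcParam γ a b σ = (edgePt γ a b ⟨A.T 0 (A.S 0 a + σ), A.T_mem hσ⟩ : Plane) := by
    simp only [arcParam, edgePt, ht]
    rfl
  rw [inArcLength, h1]
  exact Subtype.val_injective.extend_apply u 0 _

theorem ArcLengthData.inArcLength_S (A : ArcLengthData k L γ) (ha : 0 ≤ a) (hab : a < b)
    (hb : b ≤ L) (u : edge γ a b → Plane) (t : Icc a b) :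
    inArcLength γ a b u (A.S 0 t - A.S 0 a) = u (edgePt γ a b t) := by
  rw [A.inArcLength_eq ha hab hb u (A.S_sub_mem t.2)]
  congr 2
  apply Subtype.ext
  simp [A.T_S]

theorem continuous_edgePt (A : ArcLengthData k L γ) (ha : 0 ≤ a) (hb : b ≤ L) :
    Continuous (edgePt γ a b) := by
  have h := A.jet_G.continuousOn (Nat.zero_le _)
  rw [A.G_zero] at h
  exact Continuous.subtype_mk
    (continuousOn_iff_continuous_domRestrict.1 (h.mono (Icc_subset_Icc ha hb))) _

/-- A continuous surjection from a compact space onto a Hausdorff one is a quotient map, so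
continuity on the edge can be tested in the parameter. -/
theorem continuous_of_comp_edgePt (A : ArcLengthData k L γ) (ha : 0 ≤ a) (hb : b ≤ L)
    {w : edge γ a b → Plane} (hw : Continuous fun t => w (edgePt γ a b t)) : Continuous w := by
  have h := continuous_edgePt A ha hb
  exact (h.isClosedMap.isQuotientMap h exists_edgePt_eq).continuous_iff.2 hw

theorem continuousOn_inArcLength (A : ArcLengthData k L γ) (ha : 0 ≤ a) (hab : a < b)
    (hb : b ≤ L) {w : edge γ a b → Plane} (hw : Continuous w) :
    ContinuousOn (inArcLength γ a b w) (Icc 0 (A.S 0 b - A.S 0 a)) := by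
  rw [continuousOn_iff_continuous_domRestrict]
  have hT : ContinuousOn (fun σ => A.T 0 (A.S 0 a + σ)) (Icc 0 (A.S 0 b - A.S 0 a)) := by
    refine (A.jet_T.continuousOn (Nat.zero_le _)).comp (by fun_prop) fun σ hσ => ?_
    have h1 : 0 ≤ A.S 0 a := by rw [← A.S_zero]; exact A.strictMono_S.monotone ha
    have h2 : A.S 0 b ≤ A.S 0 L := A.strictMono_S.monotone hb
    exact ⟨by linarith [hσ.1], by linarith [hσ.2]⟩
  have h : Continuous fun σ : Icc 0 (A.S 0 b - A.S 0 a) =>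
      w (edgePt γ a b ⟨A.T 0 (A.S 0 a + σ), A.T_mem σ.2⟩) :=
    hw.comp ((continuous_edgePt A ha hb).comp
      ((continuousOn_iff_continuous_domRestrict.1 hT).subtype_mk _))
  convert! h using 2 with σ
  exact A.inArcLength_eq ha hab hb w σ.2

theorem mem_VSpace_iff (A : ArcLengthData k L γ) {v : edge γ a b → Plane} :
    v ∈ VSpace γ a b k ↔ ∃ c d p, IsBubble k a b p ∧
      ∀ t : Icc a b, v (edgePt γ a b t) = interpJet A a c d p 0 t := by
  constructor
  · intro hv
    obtain ⟨r, ⟨c, d, hr⟩, q, ⟨p, hp, hq⟩, rfl⟩ := Submodule.mem_sup.1 hv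
    refine ⟨c, d, p, hp, fun t => ?_⟩
    have : q (edgePt γ a b t) = polyJet p 0 t := by ext l; simp [hq, polyJet]
    rw [Pi.add_apply, hr, this, mapF_eq, interpJet_zero]
    rfl
  · rintro ⟨c, d, p, hp, h⟩
    refine Submodule.mem_sup.2 ⟨fun x => mapF (γ a) c d x, ⟨c, d, fun x => rfl⟩,
      v - fun x : edge γ a b => mapF (γ a) c d x, ⟨p, hp, fun t l => ?_⟩, by simp⟩
    rw [Pi.sub_apply, h, mapF_eq, interpJet_zero]
    simp [edgePt, polyJet]

/-- The value at `a` kills `c`, the value at `b` kills `d` because the chord is nonzero, and each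
component of the bubble then has `k + 1` zeros with degree at most `k`. -/
theorem eq_zero_of_mem_VSpace (A : ArcLengthData k L γ) {ε : ℝ} (hε : 0 < ε)
    {t : Fin (k + 1) → ℝ} (ht : IsParamNodes k L a b ε t) {v : edge γ a b → Plane}
    (hv : v ∈ VSpace γ a b k) (h0 : ∀ i, v (edgePt γ a b ⟨t i, ht.mem i⟩) = 0) : v = 0 := by
  obtain ⟨c, d, p, hp, h⟩ := (mem_VSpace_iff A).1 hv
  have h0' : ∀ i, c + rot d (γ (t i) - γ a) + polyJet p 0 (t i) = 0 := fun i => by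
    rw [← interpJet_zero A, ← h ⟨t i, ht.mem i⟩, h0]
  have hpa : polyJet p 0 a = 0 := by ext l; simp [polyJet, (hp l).2.1]
  have hpb : polyJet p 0 b = 0 := by ext l; simp [polyJet, (hp l).2.2]
  have hc : c = 0 := by
    have := h0' 0
    rwa [ht.left, sub_self, map_zero, hpa, add_zero, add_zero] at this
  have hch := A.chord a b ht.a_nonneg ht.lt.le ht.b_le
  have hba : 0 < b - a := sub_pos.2 ht.lt
  have hne : 0 < ‖γ b - γ a‖ := lt_of_lt_of_le (mul_pos A.c_pos hba) hch
  have hd : d = 0 := by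
    have := h0' (Fin.last k)
    rw [ht.right, hpb, hc, zero_add, add_zero] at this
    have h1 := norm_rot d (γ b - γ a)
    rw [this, norm_zero] at h1
    exact norm_eq_zero.1 ((mul_eq_zero.1 h1.symm).resolve_right hne.ne')
  have hrot : ∀ y, rot d y = 0 := fun y => norm_eq_zero.1 (by rw [norm_rot, hd]; simp)
  have hpz : ∀ l, p l = 0 := fun l => by
    refine Polynomial.eq_zero_of_natDegree_lt_card_of_eval_eq_zero (p l) (ht.injective hε)
      (fun i => ?_) ?_
    · have := h0' i
      rw [hc, hrot, zero_add, zero_add] at this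
      simpa [polyJet] using congrArg (fun z : Plane => z l) this
    · rw [Fintype.card_fin]
      exact Nat.lt_succ_of_le
        (Polynomial.natDegree_le_of_degree_le (Polynomial.mem_degreeLE.1 (hp l).1))
  funext x
  obtain ⟨t, rfl⟩ := exists_edgePt_eq x
  rw [h, interpJet_zero, hc, hrot]
  ext l
  simp [polyJet, hpz]

/-- A field on an injective edge with prescribed values in the parameter. -/
theorem exists_edgeField (hinj : InjOn γ (Icc a b)) (f : ℝ → Plane) :
    ∃ v : edge γ a b → Plane, ∀ t : Icc a b, v (edgePt γ a b t) = f t := by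
  refine ⟨fun x => f (Function.invFunOn γ (Icc a b) x), fun t => ?_⟩
  have hex : ∃ τ ∈ Icc a b, γ τ = γ t := ⟨t, t.2, rfl⟩
  have := hinj (Function.invFunOn_mem hex) t.2 (Function.invFunOn_eq hex)
  change f (Function.invFunOn γ (Icc a b) (γ t)) = f t
  rw [this]

/-- Two continuous representatives agree almost everywhere on the open interval, hence everywhere on
the closed one, endpoints included. The nodal values are thus the same and unisolvence applies. -/
theorem IsInterpolant.unique (A : ArcLengthData k L γ) {ε : ℝ} (hε : 0 < ε)
    {t : Fin (k + 1) → ℝ} (ht : IsParamNodes k L a b ε t) {x : Fin (k + 1) → edge γ a b}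
    (hx : ∀ i, edgePt γ a b ⟨t i, ht.mem i⟩ = x i) {u v v' : edge γ a b → Plane}
    (hv : IsInterpolant γ a b x u v) (hv' : IsInterpolant γ a b x u v') : v' = v := by
  obtain ⟨hV, w, hw, hwu, hvw⟩ := hv
  obtain ⟨hV', w', hw', hwu', hvw'⟩ := hv'
  have ha := ht.a_nonneg
  have hb := ht.b_le
  have hh : 0 < A.S 0 b - A.S 0 a := sub_pos.2 (A.strictMono_S ht.lt)
  rw [A.edgeLength_eq ha ht.lt hb] at hwu hwu'
  have hae := hwu'.trans hwu.symm
  rw [Measure.restrict_congr_set Ioo_ae_eq_Icc] at hae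
  have heq := Measure.eqOn_Icc_of_ae_eq volume hh.ne hae
    (continuousOn_inArcLength A ha ht.lt hb hw') (continuousOn_inArcLength A ha ht.lt hb hw)
  rw [← sub_eq_zero]
  refine eq_zero_of_mem_VSpace A hε ht (Submodule.sub_mem _ hV' hV) fun i => ?_
  have h1 := heq (A.S_sub_mem (ht.mem i))
  rw [A.inArcLength_S ha ht.lt hb w' ⟨t i, ht.mem i⟩,
    A.inArcLength_S ha ht.lt hb w ⟨t i, ht.mem i⟩, hx] at h1
  rw [Pi.sub_apply, hx, hvw, hvw', h1, sub_self]

/-- Separation passes to the parameter: the edge is at least `A.c * (b - a)` long, and a chord is at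
most `A.D` times the parameter difference. This is the origin of `δ * A.c / A.D`. -/
theorem IsNodes.exists_isParamNodes (A : ArcLengthData k L γ) {δ : ℝ} (hδ : 0 < δ) (ha : 0 ≤ a)
    (hab : a < b) (hb : b ≤ L) (hinj : InjOn γ (Icc 0 L)) {x : Fin (k + 1) → edge γ a b}
    (hx : IsNodes γ a b δ x) :
    ∃ t, ∃ ht : IsParamNodes k L a b (δ * A.c / A.D) t,
      ∀ i, edgePt γ a b ⟨t i, ht.mem i⟩ = x i := by
  choose t ht using fun i => exists_edgePt_eq (x i)
  have hD := A.one_le_D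
  have hsub : Icc a b ⊆ Icc 0 L := Icc_subset_Icc ha hb
  have hγt : ∀ i, γ (t i) = x i := fun i => by rw [← ht i]; rfl
  refine ⟨fun i => t i, ⟨ha, hab, hb, ?_, ?_, fun i => (t i).2, fun i j hij => ?_⟩, ht⟩
  · refine hinj (hsub (t 0).2) (hsub (left_mem_Icc.2 hab.le)) ?_
    rw [hγt, hx.left]
  · refine hinj (hsub (t (Fin.last k)).2) (hsub (right_mem_Icc.2 hab.le)) ?_
    rw [hγt, hx.right]
  · have h1 := hx.separated i j hij
    have h2 := A.norm_sub_le (hsub (t j).2) (hsub (t i).2)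
    rw [hγt, hγt, ← dist_eq_norm] at h2
    have h3 := A.le_S_sub a b hab.le
    rw [A.edgeLength_eq ha hab hb] at h1
    rw [div_mul_eq_mul_div, div_le_iff₀ (by linarith)]
    calc δ * A.c * (b - a) = δ * (A.c * (b - a)) := by ring
      _ ≤ δ * (A.S 0 b - A.S 0 a) := by gcongr
      _ ≤ dist (x i) (x j) := h1
      _ ≤ _ := by rw [mul_comm]; exact h2

end EdgeFields

/-- Interpolation of a field of `H^s(0, h)` in the arc-length variable. -/
theorem exists_interpolant_error_le {k : ℕ} {L : ℝ} {γ : ℝ → Plane} (A : ArcLengthData k L γ)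
    (hinj : InjOn γ (Icc 0 L)) {ε : ℝ} (hε : 0 < ε) {s m : ℝ} (hs : 1 ≤ s) (hsk : s ≤ k + 1)
    (hm : 0 ≤ m) (hms : m ≤ s) :
    ∃ C, 0 ≤ C ∧ ∀ a b (t : Fin (k + 1) → ℝ) (ht : IsParamNodes k L a b ε t)
      (x : Fin (k + 1) → edge γ a b), (∀ i, edgePt γ a b ⟨t i, ht.mem i⟩ = x i) →
      ∀ u : edge γ a b → Plane, MemHs γ a b s u →
      ∃ uI, IsInterpolant γ a b x u uI ∧ edgeSeminorm γ a b m (u - uI) ≤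
        ENNReal.ofReal (C * (A.S 0 b - A.S 0 a) ^ (s - m)) * edgeNorm γ a b s u := by
  obtain ⟨CE, hCE, hE⟩ := exists_interpJet_error_le A hε
  have hD := A.one_le_D
  set H := max 1 (A.D * L) with hH
  have hH1 : 1 ≤ H := le_max_left _ _
  set n := ⌊s⌋₊ with hn
  set θ := s - n with hθ
  have hn1 : 1 ≤ n := Nat.le_floor (by simpa using hs)
  have hθ0 : 0 ≤ θ := sub_nonneg.2 (Nat.floor_le (by linarith))
  have hθ1 : θ < 1 := by have := Nat.lt_floor_add_one s; linarith
  have hnθ : (n : ℝ) + θ = s := by rw [hθ]; ring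
  set i := ⌊m⌋₊ with hi
  set μ := m - i with hμ
  have hμ0 : 0 ≤ μ := sub_nonneg.2 (Nat.floor_le hm)
  have hμ1 : μ < 1 := by have := Nat.lt_floor_add_one m; linarith
  have hμ1' := sub_pos.2 hμ1
  have hiμ : (i : ℝ) + μ = m := by rw [hμ]; ring
  have hin : i ≤ n := Nat.floor_le_floor hms
  have hik : i ≤ k + 1 := by
    have : (i : ℝ) ≤ (k + 1 : ℕ) := by push_cast; linarith
    exact_mod_cast this
  set K₀ : ℝ := (n + 1) * H ^ n * (1 + H) with hK₀
  refine ⟨2 * (2 / (1 - μ) + 2 / (1 - μ) * (CE * (1 + K₀ * H ^ (k + 1)))), by positivity,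
    fun a b t ht x hx u hu => ?_⟩
  have ha := ht.a_nonneg
  have hb := ht.b_le
  have hab := ht.lt
  have hEL := A.edgeLength_eq ha hab hb
  have hu' := hu
  rw [MemHs, edgeNorm, hEL] at hu'
  simp only [edgeSeminorm, edgeNorm, hEL, inArcLength_sub]
  set h := A.S 0 b - A.S 0 a with hh
  have hh0 : 0 < h := sub_pos.2 (A.strictMono_S hab)
  have hhH : h ≤ H := by
    refine ((A.S_sub_le a b hab.le).trans ?_).trans (le_max_right _ _)
    gcongr
    linarith
  set f := inArcLength γ a b u with hf
  set N := (norm h s f).toReal with hN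
  have hN0 : 0 ≤ N := ENNReal.toReal_nonneg
  have hNe : norm h s f = ENNReal.ofReal N := (ENNReal.ofReal_toReal hu'.ne).symm
  obtain ⟨w, hwd, hwN, hwc, hwf⟩ := exists_representation hh0 hu'
  rw [hNe] at hwN hwf
  rw [hNe]
  have hwm : ∀ j ≤ n, AEStronglyMeasurable (w j) (volume.restrict (Ioo 0 h)) := fun j hj =>
    (hwd j hj).2.1.aestronglyMeasurable
  obtain ⟨T, hT, hTb, hrb, hrs⟩ := exists_decomposition hh0 hhH hH1 hn1 hθ0 hθ1 hN0 hwm hwN hwc hwf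
  rw [hnθ] at hrb
  -- The two inputs of the error bound: the derivatives of `T` are at most `K₀ N h ^ (-1/2)`, and
  -- the nodal values deviate from `T` by at most `N h ^ (s - 1/2)`.
  obtain ⟨c, d, p, hp, hpt, U, hU, hU0, hUb⟩ := hE a b t ht T (K₀ * (N * h ^ (-(1 / 2) : ℝ))) hT hTb
    (fun i => w 0 (A.S 0 (t i) - A.S 0 a)) (N * h ^ (s - 1 / 2))
    (fun i => hrb _ (A.S_sub_mem (ht.mem i)))
  have hinj' : InjOn γ (Icc a b) := hinj.mono ht.subset
  obtain ⟨uI, huI⟩ := exists_edgeField hinj' (interpJet A a c d p 0)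
  obtain ⟨W, hW⟩ := exists_edgeField hinj' (fun τ => w 0 (A.S 0 τ - A.S 0 a))
  have hw0c : ContinuousOn (w 0) (Icc 0 h) := by
    have hi1 : IntegrableOn (w 1) (Ioo 0 h) volume := MemLp.integrable (q := 2) (by norm_num)
      ⟨hwm 1 hn1, (hwN 1 hn1).trans_lt ENNReal.ofReal_lt_top⟩
    exact (continuousOn_const.add (continuousOn_primitive_Icc hh0.le hi1)).congr
      fun x hx => hwc 0 hn1 x hx
  have hSc : Continuous fun τ : Icc a b => A.S 0 τ - A.S 0 a :=
    (continuousOn_iff_continuous_domRestrict.1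
      ((A.jet_S.continuousOn (Nat.zero_le _)).mono ht.subset)).sub continuous_const
  have hWc : Continuous W := by
    refine continuous_of_comp_edgePt A ha hb ?_
    simp only [hW]
    exact hw0c.comp_continuous hSc fun τ => A.S_sub_mem τ.2
  refine ⟨uI, ⟨(mem_VSpace_iff A).2 ⟨c, d, p, hp, huI⟩, W, hWc, ?_, fun j => ?_⟩, ?_⟩
  · rw [hEL]
    have h1 : inArcLength γ a b W =ᵐ[volume.restrict (Ioo 0 h)] w 0 := by
      refine (ae_restrict_iff' measurableSet_Ioo).2 (Filter.Eventually.of_forall fun σ hσ => ?_)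
      rw [A.inArcLength_eq ha hab hb W (Ioo_subset_Icc_self hσ), hW]
      simp only [A.S_T, add_sub_cancel_left]
    have hloc := (hwd 0 (Nat.zero_le _)).1
    exact h1.trans ((hwd 0 (Nat.zero_le _)).unique (isWeakDeriv_zero_self hloc))
  · rw [← hx, huI, hW, hpt]
  · have hTU := ((isJet_of_hasDerivAt hT (k + 1) (Icc 0 h)).sub hU).isWeakDeriv hik
    have huIae : (fun σ => T 0 σ - U 0 σ) =ᵐ[volume.restrict (Ioo 0 h)] inArcLength γ a b uI := by
      refine (ae_restrict_iff' measurableSet_Ioo).2 (Filter.Eventually.of_forall fun σ hσ => ?_)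
      rw [A.inArcLength_eq ha hab hb uI (Ioo_subset_Icc_self hσ), huI]
      simp only [hU0, sub_sub_cancel]
    have hwd' := (hwd i hin).sub (hTU.congr huIae Filter.EventuallyEq.rfl)
    rw [seminorm_eq hwd']
    -- The error is the Sobolev remainder `w - T` plus the smooth difference `U` between `T` and the
    -- interpolant; each is estimated by its own tool.
    have e : (w i - fun σ => T i σ - U i σ) = (w i - T i) + U i := by
      funext σ; simp only [Pi.sub_apply, Pi.add_apply]; abel
    rw [e]
    have hTc : Continuous (T i) := continuous_iff_continuousAt.2 fun x => (hT i x).continuousAt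
    have hUm : AEStronglyMeasurable (U i) (volume.restrict (Ioo 0 h)) :=
      ((hU.continuousOn hik).mono Ioo_subset_Icc_self).aestronglyMeasurable measurableSet_Ioo
    refine (fracSeminorm_add_le _ ((hwm i hin).sub hTc.aestronglyMeasurable) hUm).trans ?_
    have h1 := hrs i μ hμ0 hμ1 (by rw [hiμ, hnθ]; exact hms)
    rw [hnθ, hiμ] at h1
    set B' := CE * (N * h ^ (s - 1 / 2) + K₀ * (N * h ^ (-(1 / 2) : ℝ)) * h ^ (k + 1)) with hB'
    have hB'0 : 0 ≤ B' := by positivity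
    have h2 := hU.fracSeminorm_le hh0 hμ0 hμ1 (by push_cast; rw [hiμ]; linarith) hB'0
      fun j hj x hx => by
        rw [Real.rpow_neg hh0.le, Real.rpow_natCast, ← div_eq_mul_inv, le_div_iff₀ (by positivity)]
        exact hUb j hj x hx
    rw [hiμ] at h2
    have h3 : B' * h ^ (1 / 2 - m) ≤ CE * (1 + K₀ * H ^ (k + 1)) * (N * h ^ (s - m)) := by
      have e1 : h ^ (s - 1 / 2) * h ^ (1 / 2 - m) = h ^ (s - m) := by
        rw [← Real.rpow_add hh0]; congr 1; ring
      -- The surplus power `h ^ (k + 1 - s)` has a nonnegative exponent because `s ≤ k + 1`, so it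
      -- is bounded by a power of `H`.
      have e2 : h ^ (-(1 / 2) : ℝ) * h ^ (k + 1) * h ^ (1 / 2 - m) ≤ H ^ (k + 1) * h ^ (s - m) := by
        have e3 : h ^ (-(1 / 2) : ℝ) * h ^ (k + 1) * h ^ (1 / 2 - m) =
            h ^ ((k + 1 : ℕ) - s) * h ^ (s - m) := by
          rw [← Real.rpow_natCast, ← Real.rpow_add hh0, ← Real.rpow_add hh0, ← Real.rpow_add hh0]
          congr 1; ring
        rw [e3]
        refine mul_le_mul_of_nonneg_right ?_ (by positivity)
        rw [← Real.rpow_natCast H]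
        exact (Real.rpow_le_rpow hh0.le hhH (by push_cast; linarith)).trans
          (Real.rpow_le_rpow_of_exponent_le hH1 (by linarith))
      calc B' * h ^ (1 / 2 - m) = CE * (N * (h ^ (s - 1 / 2) * h ^ (1 / 2 - m)) +
            K₀ * N * (h ^ (-(1 / 2) : ℝ) * h ^ (k + 1) * h ^ (1 / 2 - m))) := by rw [hB']; ring
        _ ≤ CE * (N * h ^ (s - m) + K₀ * N * (H ^ (k + 1) * h ^ (s - m))) := by rw [e1]; gcongr
        _ = _ := by ring
    refine (mul_le_mul_right (add_le_add h1 h2) 2).trans ?_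
    have h2e : (2 : ℝ≥0∞) = ENNReal.ofReal 2 := by simp
    rw [← ENNReal.ofReal_add (by positivity) (by positivity), h2e,
      ← ENNReal.ofReal_mul (by norm_num), ← ENNReal.ofReal_mul (by positivity)]
    refine ENNReal.ofReal_le_ofReal ?_
    calc _ ≤ 2 * (2 / (1 - μ) * (N * h ^ (s - m)) +
          2 / (1 - μ) * (CE * (1 + K₀ * H ^ (k + 1)) * (N * h ^ (s - m)))) := by gcongr
      _ = _ := by ring

end CurvedEdge

end

/-! ### From the length of the edge to the diameter of the element -/

theorem mainTheorem1 (k : ℕ) (hk : 1 ≤ k) (L : ℝ) (hL : 0 < L) (γ : ℝ → CurvedEdge.Plane)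
    (hγ : CurvedEdge.IsRegularParam (k + 1) L γ) (δ : ℝ) (hδ : 0 < δ)
    (s m : ℝ) (hs : 1 ≤ s) (hsk : s ≤ k + 1) (hm : 0 ≤ m) (hms : m ≤ s) :
    ∃ C : ℝ, 0 < C ∧
      ∀ a b : ℝ, 0 ≤ a → a < b → b ≤ L →
      ∀ E : Set CurvedEdge.Plane, Bornology.IsBounded E → CurvedEdge.edge γ a b ⊆ frontier E →
      ∀ x : Fin (k + 1) → CurvedEdge.edge γ a b, CurvedEdge.IsNodes γ a b δ x →
      ∀ u : CurvedEdge.edge γ a b → CurvedEdge.Plane, CurvedEdge.MemHs γ a b s u →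
        ∃ uI : CurvedEdge.edge γ a b → CurvedEdge.Plane,
          (CurvedEdge.IsInterpolant γ a b x u uI ∧
            ∀ v, CurvedEdge.IsInterpolant γ a b x u v → v = uI) ∧
          CurvedEdge.edgeSeminorm γ a b m (u - uI) ≤
            ENNReal.ofReal (C * Metric.diam E ^ (s - m)) * CurvedEdge.edgeNorm γ a b s u := by
  obtain ⟨A⟩ := hγ.nonempty_arcLengthData hL
  have hc := A.c_pos
  have hD := A.one_le_D
  have hε : 0 < δ * A.c / A.D := by positivity
  obtain ⟨C, hC, H⟩ := CurvedEdge.exists_interpolant_error_le A hγ.injOn hε hs hsk hm hms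
  -- The power of `A.D / A.c` pays for replacing the length by the diameter; the `1` makes the
  -- constant positive even if `C = 0`.
  refine ⟨C * (A.D / A.c) ^ (s - m) + 1, by positivity,
    fun a b ha hab hb E hE hEe x hx u hu => ?_⟩
  obtain ⟨t, ht, htx⟩ := hx.exists_isParamNodes A hδ ha hab hb hγ.injOn
  obtain ⟨uI, huI, hbound⟩ := H a b t ht x htx u hu
  refine ⟨uI, ⟨huI, fun v hv => huI.unique A hε ht htx hv⟩, hbound.trans ?_⟩
  -- Both endpoints lie in the frontier of `E`, hence in its closure, which has the same diameter as
  -- `E`. Boundedness matters here: the diameter of an unbounded set is `0` by default.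
  have hdiam : ‖γ b - γ a‖ ≤ Metric.diam E := by
    rw [← dist_eq_norm, ← Metric.diam_closure]
    have hsub := hEe.trans frontier_subset_closure
    exact Metric.dist_le_diam_of_mem hE.closure
      (hsub (Set.mem_image_of_mem γ (Set.right_mem_Icc.2 hab.le)))
      (hsub (Set.mem_image_of_mem γ (Set.left_mem_Icc.2 hab.le)))
  have hh : A.S 0 b - A.S 0 a ≤ A.D / A.c * Metric.diam E := by
    have h1 := A.S_sub_le a b hab.le
    have h2 := A.chord a b ha hab.le hb
    rw [div_mul_eq_mul_div, le_div_iff₀ hc]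
    calc _ ≤ A.D * (b - a) * A.c := by gcongr
      _ = A.D * (A.c * (b - a)) := by ring
      _ ≤ _ := by gcongr; exact h2.trans hdiam
  have hh0 : 0 ≤ A.S 0 b - A.S 0 a := sub_nonneg.2 (A.strictMono_S hab).le
  have hd0 : 0 ≤ Metric.diam E := Metric.diam_nonneg
  refine mul_le_mul' (ENNReal.ofReal_le_ofReal ?_) le_rfl
  calc C * (A.S 0 b - A.S 0 a) ^ (s - m) ≤ C * (A.D / A.c * Metric.diam E) ^ (s - m) := by
        gcongr
    _ = C * (A.D / A.c) ^ (s - m) * Metric.diam E ^ (s - m) := by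
        rw [Real.mul_rpow (by positivity) hd0]; ring
    _ ≤ _ := by
        have : 0 ≤ Metric.diam E ^ (s - m) := by positivity
        linarith
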